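/- Let $E_0<0$ and let $U_0\in C^2(\mathbb R^3)$ be a spherically symmetric function with $\lim_{|x|\to\infty}U_0(x)=0$ and $$\Delta U_0(x)=4\pi\int_{\mathbb R^3} f_0(x,v)\,dv,\qquad f_0(x,v):=\bigl(e^{E_0-E(x,v)}-1\bigr)_+,\qquad E(x,v):=\tfrac12|v|^2+U_0(x),$$ i.e. $f_0$ is a (spherically symmetric) King model with potential $U_0$. For $f=f(x,v)$ write $\rho_f(x)=\int f(x,v)\,dv$ and $U_f(x)=-\int\frac{\rho_f(y)}{|x-y|}\,dy$, and let $L(x,v)=|x\times v|^2=|x|^2|v|^2-(x\cdot v)^2$ and $\Phi_0(s)=(1+s)\ln(1+s)-s$ for $s\ge 0$. Define the energy-Casimir functional $$\mathcal H_C(f)=\frac12\iint|v|^2f\,dv\,dx-\frac1{8\pi}\int|\nabla U_f|^2\,dx+\iint\Phi_0(f)\,dv\,dx$$ and the deviation $$d(f,f_0)=\iint\bigl[\Phi_0(f)-\Phi_0(f_0)+(E-E_0)(f-f_0)\bigr]\,dv\,dx+\frac1{8\pi}\int|\nabla U_f-\nabla U_0|^2\,dx\in[0,\infty],$$ where for $f\ge0$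 both integrands are non-negative. Let $\mathcal S_{f_0}$ be the set of all $f\in L^1(\mathbb R^6)$ such that $f\ge0$, $f$ is spherically symmetric (for every $A\in SO(3)$, $f(Ax,Av)=f(x,v)$ for almost all $(x,v)$), and for every $\Phi=\Phi(f,L)\in C^2([0,\infty[^2)$ with $\Phi(0,L)=\partial_f\Phi(0,L)=0$ for $L\ge0$ and $\partial_f^2\Phi$ bounded, the function $\Phi(f,L)$ is integrable on $\mathbb R^6$ and $$\iint\Phi(f,L)\,dv\,dx=\iint\Phi(f_0,L)\,dv\,dx .$$ Then there exist constants $\delta_0>0$ and $C_0>0$ such that for all $f\in\mathcal S_{f_0}$ with $d(f,f_0)\le\delta_0$, all integrals in $\mathcal H_C(f)$ and $\mathcal H_C(f_0)$ are finite, $\nabla U_f-\nabla U_0\in L^2(\mathbb R^3)$, and $$\mathcal H_C(f)-\mathcal H_C(f_0)\ \ge\ C_0\,\|\nabla U_f-\nabla U_0\|_2^2 .$$ -/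

import Mathlib

open MeasureTheory Set Filter Topology
open scoped ENNReal

noncomputable section

/-- Position space and velocity space `ℝ³` with the Euclidean norm. -/
abbrev Space : Type := EuclideanSpace ℝ (Fin 3)

/-- Phase space `ℝ³ × ℝ³`; a point is a pair `(x, v)`, and the volume is `dv dx`. -/
abbrev Phase : Type := Space × Space

/-- The spatial density `ρ_f(x) = ∫ f(x, v) dv`. -/
def spatialDensity (f : Phase → ℝ) (x : Space) : ℝ :=
  ∫ v : Space, f (x, v)

/-- The gravitational potential induced by `f`,
`U_f(x) = -∫ ρ_f(y) / |x - y| dy`, i.e. the solution of `Δ U = 4 π ρ_f` that vanishes at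
infinity. For spherically symmetric `f ∈ L¹` the integral converges absolutely at every `x ≠ 0`
and `U_f` is continuously differentiable on `ℝ³ ∖ {0}`, so that `gradient (potential f)` is the
classical gradient almost everywhere. -/
def potential (f : Phase → ℝ) (x : Space) : ℝ :=
  -∫ y : Space, spatialDensity f y / ‖x - y‖

/-- The particle energy `E(x, v) = |v|² / 2 + U(x)`. -/
def particleEnergy (U : Space → ℝ) (z : Phase) : ℝ :=
  ‖z.2‖ ^ 2 / 2 + U z.1

/-- The squared modulus of the angular momentum,
`L = |x × v|² = |x|² |v|² - (x · v)²`. -/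
def angularMomentumSq (z : Phase) : ℝ :=
  ‖z.1‖ ^ 2 * ‖z.2‖ ^ 2 - (inner ℝ z.1 z.2) ^ 2

/-- The King distribution `(e^{E₀ - E} - 1)₊`, where `E = |v|² / 2 + U₀(x)`. -/
def kingModel (E₀ : ℝ) (U₀ : Space → ℝ) (z : Phase) : ℝ :=
  max (Real.exp (E₀ - particleEnergy U₀ z) - 1) 0

/-- `U₀` is the potential of a (spherically symmetric) King model with cut-off energy `E₀ < 0`:
a classical radial solution of the semilinear Poisson equation
`Δ U₀ = 4 π ∫ (e^{E₀ - |v|²/2 - U₀} - 1)₊ dv` with `U₀(x) → 0` as `|x| → ∞`. -/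
structure IsKingPotential (E₀ : ℝ) (U₀ : Space → ℝ) : Prop where
  cutoff_neg : E₀ < 0
  contDiff : ContDiff ℝ 2 U₀
  radial : ∀ x y : Space, ‖x‖ = ‖y‖ → U₀ x = U₀ y
  poisson : ∀ x : Space,
    Laplacian.laplacian U₀ x = 4 * Real.pi * spatialDensity (kingModel E₀ U₀) x
  tendsto_zero : Tendsto U₀ (cocompact Space) (𝓝 0)

/-- Spherical symmetry of (the almost everywhere class of) a state: `f(A x, A v) = f(x, v)` for
every rotation `A ∈ SO(3)`. -/
def IsSphericallySymmetric (f : Phase → ℝ) : Prop :=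
  ∀ A : Space ≃ₗᵢ[ℝ] Space, LinearMap.det (A.toLinearEquiv : Space →ₗ[ℝ] Space) = 1 →
    ∀ᵐ z : Phase, f (A z.1, A z.2) = f z

/-- The generalized Casimir functions `Φ = Φ(f, L)`: `Φ ∈ C²([0, ∞[²)` with
`Φ(0, L) = ∂_f Φ(0, L) = 0` for `L ≥ 0` and `∂_f² Φ` bounded on `[0, ∞[²`. All derivatives are
taken within `[0, ∞[`, hence are one-sided at the boundary. -/
structure IsCasimirFunction (Φ : ℝ × ℝ → ℝ) : Prop where
  contDiffOn : ContDiffOn ℝ 2 Φ (Ici 0 ×ˢ Ici 0)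
  zero : ∀ L : ℝ, 0 ≤ L → Φ (0, L) = 0
  deriv_zero : ∀ L : ℝ, 0 ≤ L → derivWithin (fun s : ℝ => Φ (s, L)) (Ici 0) 0 = 0
  deriv_two_bounded : ∃ M : ℝ, ∀ s L : ℝ, 0 ≤ s → 0 ≤ L →
    |iteratedDerivWithin 2 (fun t : ℝ => Φ (t, L)) (Ici 0) s| ≤ M

/-- The class `S_{f₀}` of perturbations of `f₀`: non-negative, spherically symmetric
`f ∈ L¹(ℝ⁶)` for which every generalized Casimir integral `∬ Φ(f, L) dv dx` exists and
has the same value as for `f₀`. -/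
structure IsAdmissible (f₀ f : Phase → ℝ) : Prop where
  integrable : Integrable f
  nonneg : ∀ᵐ z : Phase, 0 ≤ f z
  symmetric : IsSphericallySymmetric f
  casimir_integrable : ∀ Φ : ℝ × ℝ → ℝ, IsCasimirFunction Φ →
    Integrable (fun z : Phase => Φ (f z, angularMomentumSq z))
  casimir_eq : ∀ Φ : ℝ × ℝ → ℝ, IsCasimirFunction Φ →
    ∫ z : Phase, Φ (f z, angularMomentumSq z) = ∫ z : Phase, Φ (f₀ z, angularMomentumSq z)

/-- The Casimir function of the King model, `Φ₀(s) = (1 + s) ln (1 + s) - s`. -/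
def kingCasimir (s : ℝ) : ℝ :=
  (1 + s) * Real.log (1 + s) - s

/-- The energy-Casimir functional
`H_C(f) = ½ ∬ |v|² f dv dx - (1 / 8π) ∫ |∇U_f|² dx + ∬ Φ₀(f) dv dx`. -/
def energyCasimir (f : Phase → ℝ) : ℝ :=
  (1 / 2) * (∫ z : Phase, ‖z.2‖ ^ 2 * f z)
    - (1 / (8 * Real.pi)) * (∫ x : Space, ‖gradient (potential f) x‖ ^ 2)
    + ∫ z : Phase, kingCasimir (f z)

/-- All three integrals in the energy-Casimir functional are finite, so that `H_C(f)` is a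
well-defined real number. -/
structure HasFiniteEnergyCasimir (f : Phase → ℝ) : Prop where
  kinetic : Integrable (fun z : Phase => ‖z.2‖ ^ 2 * f z)
  field : MemLp (gradient (potential f)) 2 (volume : Measure Space)
  casimir : Integrable (fun z : Phase => kingCasimir (f z))

/-- The deviation from the King model,
`d(f, f₀) = ∬ [Φ₀(f) - Φ₀(f₀) + (E - E₀)(f - f₀)] dv dx + (1 / 8π) ∫ |∇U_f - ∇U₀|² dx`.
For `f ≥ 0` the first integrand is non-negative by convexity of `Φ₀`, so that `d(f, f₀)` is
always defined as an element of `[0, ∞]`. -/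
def deviation (E₀ : ℝ) (U₀ : Space → ℝ) (f : Phase → ℝ) : ℝ≥0∞ :=
  (∫⁻ z : Phase, ENNReal.ofReal
      (kingCasimir (f z) - kingCasimir (kingModel E₀ U₀ z)
        + (particleEnergy U₀ z - E₀) * (f z - kingModel E₀ U₀ z)))
    + ENNReal.ofReal (1 / (8 * Real.pi))
      * ∫⁻ x : Space, ‖gradient (potential f) x - gradient U₀ x‖ₑ ^ 2

end

/-! Let m(s) be the difference of the masses of f and f₀ in the ball of radius s, and N = ∫ m²/s²
ds. By Newton's shell theorem both fields are radial and ‖∇U_f - ∇U₀‖² = 4πN. The Casimir terms of f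
and f₀ are equal, and the cross term of the field energies cancels against ∬ U₀ (f - f₀), so H_C(f)
- H_C(f₀) = ∬ E (f - f₀) - N/2 (`energyCasimir_expansion`). The linear term must therefore be
bounded below by strictly more than N/2; `exists_energy_bound` gives 33/64 N.

The constraint enters through `levelMeasure_eq`: the Casimir identities say that the regions under
the graphs of f and f₀ have the same joint distribution of level t and L. Hence ∫₀^f η(t, L) dt has
the same phase space integral for f and f₀, for every bounded measurable η. The bound then follows
by duality. Let ψ be the potential of m, so that ∬ ψ (f₀ - f) = N up to a truncation at the centre.
From (E + ψ)(f₀ - f) one may subtract both the integral of the level energy e(t) = E₀ - ln(1+t)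
between f and f₀ and that of η, since these contribute nothing in total. What remains is bounded
pointwise by the cost of displacing the boundary E = e(t) of the superlevel set {f₀ > t} = {E <
e(t)} by ψ - η (`ofReal_level_exchange_le`). Thus N ≤ ∬ E (f - f₀) + cost, and the task is to choose
η with cost below N/2 by a fixed margin.

To leading order the cost is 4π² ∫∫∫ (ψ - η)² / √(2y) dL dr dt, where y is the radial kinetic
energy. The best η(t, L) is the mean of ψ over the orbit with energy e(t) and angular momentum L
(`orbitMean`), which leaves a variance along each orbit. `orbit_poincare` and `antonov_orbit` bound
it by ∫ |ψ'|² (r/β) √(2y) dr with β = 3U₀' + rU₀''. The King density decreases outwards, so β ≥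
(16π/3) r ρ₀ (`antonov_weight`); integrating √(2y) over t and L gives r²ρ₀/(2π), the density
cancels, and the leading cost is at most 3/8 N.

The corrections are small. The quadratic approximation fails only in a layer around y = 0, whose
cost is O(N^(5/4)) (`lintegral_band_le`); this is where smallness of d(f, f₀) is used. Freezing the
potential inside a fixed radius ρ in the definition of η keeps η bounded and costs O(ρ²) N
(`lintegral_truncation_le`). Altogether the cost is at most 31/64 N (`exists_levelCost_bound`). -/

/-! ### Phase space integrals in the variables radius, radial velocity, angular momentum -/

/-- Radial functions in the plane, integrated in the variable `q = r²`. -/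
lemma lintegral_plane_radial (F : ℝ → ℝ≥0∞) (hF : Measurable F) :
    ∫⁻ p : ℝ × ℝ, F (p.1 ^ 2 + p.2 ^ 2) = ENNReal.ofReal Real.pi * ∫⁻ q in Ioi (0 : ℝ), F q := by
  rw [← lintegral_comp_polarCoord_symm]
  have h1 : ∀ p ∈ polarCoord.target, ENNReal.ofReal p.1 •
      F ((polarCoord.symm p).1 ^ 2 + (polarCoord.symm p).2 ^ 2)
      = ENNReal.ofReal p.1 * F (p.1 ^ 2) := by
    intro p _
    have : (polarCoord.symm p).1 ^ 2 + (polarCoord.symm p).2 ^ 2 = p.1 ^ 2 := by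
      simp only [polarCoord_symm_apply]
      have := Real.sin_sq_add_cos_sq p.2
      linear_combination p.1 ^ 2 * this
    rw [this, smul_eq_mul]
  rw [setLIntegral_congr_fun polarCoord.open_target.measurableSet h1, polarCoord_target,
    Measure.volume_eq_prod, ← Measure.prod_restrict, lintegral_prod _ (by fun_prop)]
  have h2 : (Ioi (0 : ℝ)) = (fun s : ℝ => s ^ 2) '' Ioi 0 := by
    ext q
    constructor
    · intro hq
      exact ⟨√q, Real.sqrt_pos.2 hq, Real.sq_sqrt (le_of_lt hq)⟩
    · rintro ⟨s, hs, rfl⟩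
      exact pow_pos (mem_Ioi.1 hs) 2
  have h3 := lintegral_image_eq_lintegral_abs_deriv_mul (s := Ioi (0 : ℝ)) (f := fun s : ℝ => s ^ 2)
    (f' := fun s => 2 * s) measurableSet_Ioi
    (fun s _ => by simpa using (hasDerivAt_pow 2 s).hasDerivWithinAt)
    (fun a ha b hb hab => by
      have ha' : (0 : ℝ) < a := ha
      have hb' : (0 : ℝ) < b := hb
      exact (pow_left_inj₀ ha'.le hb'.le two_ne_zero).1 hab) F
  rw [← h2] at h3
  rw [h3, ← lintegral_const_mul _ (by fun_prop)]
  refine setLIntegral_congr_fun measurableSet_Ioi fun s hs => ?_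
  have hs' : (0 : ℝ) < s := hs
  simp only [lintegral_const, MeasurableSet.univ, Measure.restrict_apply, univ_inter,
    Real.volume_Ioo]
  rw [abs_of_pos (by linarith), mul_comm, ← mul_assoc, ← mul_assoc,
    ← ENNReal.ofReal_mul (by linarith [Real.pi_pos]), ← ENNReal.ofReal_mul (by positivity)]
  ring_nf

lemma lintegral_space_coordinates (F : ℝ × ℝ → ℝ≥0∞) (hF : Measurable F) :
    ∫⁻ v : Space, F (v 0, v 1 ^ 2 + v 2 ^ 2)
      = ENNReal.ofReal Real.pi * ∫⁻ w : ℝ, ∫⁻ q in Ioi (0 : ℝ), F (w, q) := by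
  have e1 := PiLp.volume_preserving_ofLp (Fin 3)
  have e2 := volume_preserving_piFinSuccAbove (fun _ : Fin 3 => ℝ) 0
  have e3 := (MeasurePreserving.id (volume : Measure ℝ)).prod (volume_preserving_finTwoArrow ℝ)
  have h1 : Measurable (fun v : Fin 3 → ℝ => F (v 0, v 1 ^ 2 + v 2 ^ 2)) :=
    hF.comp (by fun_prop)
  have h2 : Measurable (fun p : ℝ × (Fin 2 → ℝ) => F (p.1, p.2 0 ^ 2 + p.2 1 ^ 2)) :=
    hF.comp (by fun_prop)
  have h3 : Measurable (fun p : ℝ × (ℝ × ℝ) => F (p.1, p.2.1 ^ 2 + p.2.2 ^ 2)) :=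
    hF.comp (by fun_prop)
  calc ∫⁻ v : Space, F (v 0, v 1 ^ 2 + v 2 ^ 2)
      = ∫⁻ v : Fin 3 → ℝ, F (v 0, v 1 ^ 2 + v 2 ^ 2) := e1.lintegral_comp h1
    _ = ∫⁻ p : ℝ × (Fin 2 → ℝ), F (p.1, p.2 0 ^ 2 + p.2 1 ^ 2) := by
        rw [← e2.lintegral_comp h2]
        rfl
    _ = ∫⁻ p : ℝ × (ℝ × ℝ), F (p.1, p.2.1 ^ 2 + p.2.2 ^ 2) := by
        have := e3.lintegral_comp h3
        rw [Measure.volume_eq_prod, Measure.volume_eq_prod, ← this]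
        rfl
    _ = ∫⁻ w : ℝ, ∫⁻ p : ℝ × ℝ, F (w, p.1 ^ 2 + p.2 ^ 2) := by
        rw [Measure.volume_eq_prod, lintegral_prod _ h3.aemeasurable]
    _ = ∫⁻ w : ℝ, ENNReal.ofReal Real.pi * ∫⁻ q in Ioi (0 : ℝ), F (w, q) :=
        lintegral_congr fun w => lintegral_plane_radial (fun q => F (w, q)) (by fun_prop)
    _ = _ := by
        rw [lintegral_const_mul]
        exact Measurable.lintegral_prod_right' hF

/-- Cylindrical coordinates around the axis spanned by the unit vector `e`. -/
lemma lintegral_cylindrical (e : Space) (he : ‖e‖ = 1) (F : ℝ × ℝ → ℝ≥0∞) (hF : Measurable F) :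
    ∫⁻ v : Space, F (inner ℝ e v, ‖v‖ ^ 2 - (inner ℝ e v) ^ 2)
      = ENNReal.ofReal Real.pi * ∫⁻ w : ℝ, ∫⁻ q in Ioi (0 : ℝ), F (w, q) := by
  set e₀ : Space := EuclideanSpace.single 0 1
  have he₀ : ‖e₀‖ = ‖e‖ := by simp [e₀, he]
  set A : Space ≃ₗᵢ[ℝ] Space := (ℝ ∙ (e₀ - e))ᗮ.reflection
  have hA : A e₀ = e := Submodule.reflection_sub he₀
  have hG : Measurable (fun v : Space => F (inner ℝ e v, ‖v‖ ^ 2 - (inner ℝ e v) ^ 2)) :=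
    hF.comp (by fun_prop)
  rw [← A.measurePreserving.lintegral_comp hG, ← lintegral_space_coordinates F hF]
  refine lintegral_congr fun v => ?_
  have h1 : inner ℝ e (A v) = v 0 := by
    rw [← hA, A.inner_map_map]
    simp [e₀, EuclideanSpace.inner_single_left]
  have h2 : ‖A v‖ ^ 2 = v 0 ^ 2 + v 1 ^ 2 + v 2 ^ 2 := by
    rw [A.norm_map, EuclideanSpace.norm_sq_eq, Fin.sum_univ_three]
    simp
  rw [h1, h2]
  ring_nf

/-- Integration of radial functions in `ℝ³`. -/
lemma lintegral_fun_norm (G : ℝ → ℝ≥0∞) (hG : Measurable G) :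
    ∫⁻ x : Space, G ‖x‖
      = ENNReal.ofReal (4 * Real.pi) * ∫⁻ r in Ioi (0 : ℝ), ENNReal.ofReal (r ^ 2) * G r := by
  have hm := (volume : Measure Space).measurePreserving_homeomorphUnitSphereProd
  calc ∫⁻ x : Space, G ‖x‖
      = ∫⁻ x : ({(0)}ᶜ : Set Space), G ‖x.1‖ ∂((volume : Measure Space).comap (↑)) := by
        rw [lintegral_subtype_comap (measurableSet_singleton _).compl fun x => G ‖x‖,
          restrict_compl_singleton]
    _ = ∫⁻ x, G x.2 ∂(volume : Measure Space).toSphere.prod (.volumeIoiPow 2) := by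
        have := hm.lintegral_comp_emb (Homeomorph.measurableEmbedding _)
          (fun p => G (p.2 : ℝ))
        simpa using this
    _ = ∫⁻ x : Ioi (0 : ℝ), (volume : Measure Space).toSphere univ * G x ∂.volumeIoiPow 2 := by
        rw [lintegral_prod_symm' _ (by fun_prop)]
        simp [mul_comm]
    _ = _ := by
        rw [lintegral_const_mul _ (by fun_prop), Measure.volumeIoiPow,
          lintegral_withDensity_eq_lintegral_mul _ (by fun_prop) (by fun_prop)]
        simp only [Pi.mul_apply]
        rw [lintegral_subtype_comap measurableSet_Ioi fun a => ENNReal.ofReal (a ^ 2) * G a]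
        congr 1
        rw [Measure.toSphere_apply_univ, EuclideanSpace.volume_ball_fin_three]
        simp only [finrank_euclideanSpace, Fintype.card_fin, ENNReal.ofReal_one, one_pow, one_mul]
        rw [show ((3 : ℕ) : ℝ≥0∞) = ENNReal.ofReal 3 by simp,
          ← ENNReal.ofReal_mul (by norm_num)]
        congr 1
        ring

lemma lintegral_Ioi_rescale {c : ℝ} (hc : 0 < c) (F : ℝ → ℝ≥0∞) :
    ∫⁻ q in Ioi (0 : ℝ), F q = ENNReal.ofReal c⁻¹ * ∫⁻ L in Ioi (0 : ℝ), F (L / c) := by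
  have h2 : (Ioi (0 : ℝ)) = (fun s : ℝ => s / c) '' Ioi 0 := by
    ext q
    constructor
    · intro hq
      exact ⟨q * c, mul_pos hq hc, by field_simp⟩
    · rintro ⟨s, hs, rfl⟩
      exact div_pos hs hc
  have h3 := lintegral_image_eq_lintegral_abs_deriv_mul (s := Ioi (0 : ℝ)) (f := fun s : ℝ => s / c)
    (f' := fun s => c⁻¹) measurableSet_Ioi
    (fun s _ => by simpa using ((hasDerivAt_id s).div_const c).hasDerivWithinAt)
    (fun a _ b _ hab => by
      have : a / c = b / c := hab
      field_simp at this
      exact this) F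
  rw [← h2] at h3
  rw [h3, abs_of_pos (by positivity), lintegral_const_mul' _ _ ENNReal.ofReal_ne_top]

/-- Reduction of phase space integrals to the variables `(r, w, L)`. -/
lemma lintegral_phase_reduction (F : ℝ × ℝ × ℝ → ℝ≥0∞) (hF : Measurable F) :
    ∫⁻ z : Phase, F (‖z.1‖, ‖z.2‖ ^ 2, angularMomentumSq z)
      = ENNReal.ofReal (4 * Real.pi ^ 2) * ∫⁻ r in Ioi (0 : ℝ), ∫⁻ L in Ioi (0 : ℝ),
          ∫⁻ w : ℝ, F (r, w ^ 2 + L / r ^ 2, L) := by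
  have hL : Measurable (fun z : Phase => F (‖z.1‖, ‖z.2‖ ^ 2, angularMomentumSq z)) := by
    unfold angularMomentumSq
    exact hF.comp (by fun_prop)
  rw [Measure.volume_eq_prod, lintegral_prod _ hL.aemeasurable]
  set J : ℝ → ℝ≥0∞ := fun r => ∫⁻ w : ℝ, ∫⁻ q in Ioi (0 : ℝ), F (r, w ^ 2 + q, r ^ 2 * q)
  have hJ : Measurable J := by
    refine Measurable.lintegral_prod_right' (f := fun p : ℝ × ℝ =>
      ∫⁻ q in Ioi (0 : ℝ), F (p.1, p.2 ^ 2 + q, p.1 ^ 2 * q)) ?_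
    exact Measurable.lintegral_prod_right' (f := fun p : (ℝ × ℝ) × ℝ =>
      F (p.1.1, p.1.2 ^ 2 + p.2, p.1.1 ^ 2 * p.2)) (hF.comp (by fun_prop))
  have h1 : ∀ᵐ x : Space, ∫⁻ v : Space, F (‖x‖, ‖v‖ ^ 2, angularMomentumSq (x, v))
      = ENNReal.ofReal Real.pi * J ‖x‖ := by
    have : ∀ᵐ x : Space, x ≠ 0 := by
      simp [ae_iff, measure_singleton]
    filter_upwards [this] with x hx
    have hn : ‖x‖ ≠ 0 := norm_ne_zero_iff.2 hx
    -- With axis x/|x| the transverse part q = |v|² - w² satisfies L = |x|² q.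
    rw [← lintegral_cylindrical ((‖x‖)⁻¹ • x) (by simp [norm_smul, hn])
      (fun p => F (‖x‖, p.1 ^ 2 + p.2, ‖x‖ ^ 2 * p.2)) (hF.comp (by fun_prop))]
    refine lintegral_congr fun v => ?_
    congr 2
    ext1
    · simp
    · simp only [angularMomentumSq, real_inner_smul_left]
      field_simp
  rw [lintegral_congr_ae h1, lintegral_const_mul _ (by fun_prop), lintegral_fun_norm J hJ,
    ← mul_assoc, ← ENNReal.ofReal_mul Real.pi_pos.le, show Real.pi * (4 * Real.pi) =
      4 * Real.pi ^ 2 by ring]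
  congr 1
  refine setLIntegral_congr_fun measurableSet_Ioi fun r hr => ?_
  have hr' : (0 : ℝ) < r := hr
  have hFm : Measurable (fun p : ℝ × ℝ => F (r, p.1 ^ 2 + p.2, r ^ 2 * p.2)) :=
    hF.comp (by fun_prop)
  -- The substitution L = r²q produces the factor r⁻², which cancels the surface factor r²: no
  -- weight in r remains.
  simp only [J]
  rw [lintegral_lintegral_swap hFm.aemeasurable, lintegral_Ioi_rescale (c := r ^ 2) (by positivity),
    ← mul_assoc, ← ENNReal.ofReal_mul (by positivity), mul_inv_cancel₀ (by positivity),
    ENNReal.ofReal_one, one_mul]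
  refine lintegral_congr fun L => lintegral_congr fun w => ?_
  congr 3
  field_simp

/-! ### Casimir functions and the level measure -/

/-- A product `P(f) q(L)` is a Casimir function under the natural conditions on the factors. -/
lemma IsCasimirFunction.of_mul {P p p' q : ℝ → ℝ} {K : ℝ} (hP : ∀ s, -1 < s → HasDerivAt P (p s) s)
    (hp : ∀ s, -1 < s → HasDerivAt p (p' s) s) (hp' : ContinuousOn p' (Ioi (-1)))
    (hP0 : P 0 = 0) (hp0 : p 0 = 0)
    (hbd : ∀ s, 0 ≤ s → |p' s| ≤ K) (hq : ContDiff ℝ 2 q) (hq1 : ∀ L, |q L| ≤ 1) :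
    IsCasimirFunction (fun y => P y.1 * q y.2) := by
  have hopen : IsOpen (Ioi (-1 : ℝ)) := isOpen_Ioi
  have hd1 : EqOn (deriv P) p (Ioi (-1)) := fun s hs => (hP s hs).deriv
  have hd2 : EqOn (deriv p) p' (Ioi (-1)) := fun s hs => (hp s hs).deriv
  have hpC : ContDiffOn ℝ 1 p (Ioi (-1)) := by
    rw [show (1 : WithTop ℕ∞) = 0 + 1 by norm_num, contDiffOn_succ_iff_deriv_of_isOpen hopen]
    refine ⟨fun s hs => (hp s hs).differentiableAt.differentiableWithinAt, by simp, ?_⟩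
    exact contDiffOn_zero.2 (hp'.congr hd2)
  have hPC : ContDiffOn ℝ 2 P (Ioi (-1)) := by
    rw [show (2 : WithTop ℕ∞) = 1 + 1 by norm_num, contDiffOn_succ_iff_deriv_of_isOpen hopen]
    refine ⟨fun s hs => (hP s hs).differentiableAt.differentiableWithinAt, by simp, ?_⟩
    exact hpC.congr hd1
  refine ⟨?_, fun L _ => by simp [hP0], fun L _ => ?_, K, fun s L hs _ => ?_⟩
  · refine ContDiffOn.mul (hPC.comp contDiff_fst.contDiffOn ?_)
      (hq.comp contDiff_snd).contDiffOn
    rintro ⟨s, L⟩ ⟨hs, _⟩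
    exact lt_of_lt_of_le (by norm_num) (mem_Ici.1 hs)
  · have := ((hP 0 (by norm_num)).mul_const (q L)).hasDerivWithinAt (s := Ici 0)
    rw [this.derivWithin (uniqueDiffOn_Ici 0 0 self_mem_Ici), hp0, zero_mul]
  · have hs1 : -1 < s := by linarith
    have hC : ContDiffAt ℝ 2 (fun t => P t * q L) s :=
      ((hPC.contDiffAt (hopen.mem_nhds hs1)).mul contDiffAt_const)
    -- P is C² on the open half-line s > -1, so the one-sided second derivative on [0, ∞) is the
    -- ordinary one, even at s = 0.
    rw [iteratedDerivWithin_eq_iteratedDeriv (uniqueDiffOn_Ici 0) (by exact_mod_cast hC) hs,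
      iteratedDeriv_succ, iteratedDeriv_one]
    have he : deriv (fun t => P t * q L) =ᶠ[𝓝 s] fun t => p t * q L := by
      filter_upwards [hopen.mem_nhds hs1] with t ht
      exact ((hP t ht).mul_const _).deriv
    rw [he.deriv_eq, ((hp s hs1).mul_const _).deriv, abs_mul]
    have := mul_le_mul (hbd s hs) (hq1 L) (abs_nonneg _) ((abs_nonneg _).trans (hbd s hs))
    linarith

/-- Supplies the bound on ∂_f²Φ for the smoothed cut-offs: the derivative is continuous and vanishes
off [0, 1]. -/
lemma exists_bound_deriv_smoothTransition : ∃ K : ℝ, ∀ x, |deriv Real.smoothTransition x| ≤ K := by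
  have hc : Continuous (deriv Real.smoothTransition) :=
    (Real.smoothTransition.contDiff (n := 1)).continuous_deriv le_rfl
  obtain ⟨K, hK⟩ := isCompact_Icc.exists_bound_of_continuousOn (s := Icc (0 : ℝ) 1) hc.continuousOn
  refine ⟨K, fun x => ?_⟩
  have hK0 : 0 ≤ K := (norm_nonneg _).trans (hK 0 (by simp))
  rcases lt_or_ge x 0 with hx | hx
  · have : Real.smoothTransition =ᶠ[𝓝 x] fun _ => 0 := by
      filter_upwards [Iio_mem_nhds hx] with y hy
      exact Real.smoothTransition.zero_of_nonpos (le_of_lt hy)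
    rw [this.deriv_eq]; simpa using hK0
  rcases lt_or_ge 1 x with hx1 | hx1
  · have : Real.smoothTransition =ᶠ[𝓝 x] fun _ => 1 := by
      filter_upwards [Ioi_mem_nhds hx1] with y hy
      exact Real.smoothTransition.one_of_one_le (le_of_lt hy)
    rw [this.deriv_eq]; simpa using hK0
  · exact hK x ⟨hx, hx1⟩

lemma hasDerivAt_kingCasimir {s : ℝ} (hs : -1 < s) :
    HasDerivAt kingCasimir (Real.log (1 + s)) s := by
  have h1 : HasDerivAt (fun s : ℝ => 1 + s) 1 s := (hasDerivAt_id s).const_add 1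
  have hne : 1 + s ≠ 0 := by linarith
  have h2 := (h1.mul (h1.log hne)).sub (hasDerivAt_id s)
  rw [mul_one_div_cancel hne, one_mul, add_sub_cancel_right] at h2
  exact h2

lemma isCasimirFunction_kingCasimir : IsCasimirFunction (fun y => kingCasimir y.1) := by
  have h := IsCasimirFunction.of_mul (P := kingCasimir) (p := fun s => Real.log (1 + s))
    (p' := fun s => 1 / (1 + s)) (q := fun _ => 1) (K := 1)
    (fun s hs => hasDerivAt_kingCasimir hs)
    (fun s hs => ((hasDerivAt_id s).const_add 1).log (by simp only [id]; linarith))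
    (by
      refine continuousOn_const.div (by fun_prop) fun s hs => ?_
      have : -1 < s := hs
      linarith)
    (by simp [kingCasimir]) (by simp)
    (fun s hs => by
      rw [abs_of_nonneg (by positivity), div_le_one (by linarith)]; linarith)
    contDiff_const (by simp)
  simpa using h

lemma measurable_angularMomentumSq : Measurable angularMomentumSq := by
  unfold angularMomentumSq
  fun_prop

/-- The region below the graph of a state. -/
def subgraph (f : Phase → ℝ) : Set (Phase × ℝ) := {p | 0 < p.2 ∧ p.2 < f p.1}

/-- The joint distribution of level and angular momentum below the graph of a state. -/
noncomputable def levelMeasure (f : Phase → ℝ) : Measure (ℝ × ℝ) :=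
  ((volume : Measure (Phase × ℝ)).restrict (subgraph f)).map
    (fun p => (p.2, angularMomentumSq p.1))

lemma measurableSet_subgraph {f : Phase → ℝ} (hf : Measurable f) :
    MeasurableSet (subgraph f) :=
  (measurableSet_lt measurable_const measurable_snd).inter
    (measurableSet_lt measurable_snd (hf.comp measurable_fst))

lemma volume_subgraph {f : Phase → ℝ} (hf : Measurable f) :
    volume (subgraph f) = ∫⁻ z, ENNReal.ofReal (f z) := by
  rw [Measure.volume_eq_prod, Measure.prod_apply (measurableSet_subgraph hf)]
  refine lintegral_congr fun z => ?_
  have : Prod.mk z ⁻¹' subgraph f = Ioo 0 (f z) := by ext t; simp [subgraph]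
  rw [this, Real.volume_Ioo, sub_zero]

lemma measurable_level : Measurable (fun p : Phase × ℝ => (p.2, angularMomentumSq p.1)) :=
  measurable_snd.prodMk (measurable_angularMomentumSq.comp measurable_fst)

lemma isFiniteMeasure_restrict_subgraph {f : Phase → ℝ} (hf : Measurable f) (hi : Integrable f) :
    IsFiniteMeasure ((volume : Measure (Phase × ℝ)).restrict (subgraph f)) := by
  refine ⟨?_⟩
  rw [Measure.restrict_apply_univ, volume_subgraph hf]
  exact hi.lintegral_lt_top

lemma isFiniteMeasure_levelMeasure {f : Phase → ℝ} (hf : Measurable f) (hi : Integrable f) :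
    IsFiniteMeasure (levelMeasure f) := by
  have := isFiniteMeasure_restrict_subgraph hf hi
  exact Measure.isFiniteMeasure_map _ _

/-- Fubini in the region under the graph. Equality of level measures thereby extends the Casimir
identities to functions whose f-derivative η is merely bounded and measurable, as is the case for
the orbit mean used later. -/
lemma integral_levelMeasure {f : Phase → ℝ} (hf : Measurable f) (hi : Integrable f)
    {η : ℝ × ℝ → ℝ} (hη : Measurable η) {K : ℝ} (hK : ∀ p, |η p| ≤ K) :
    Integrable (fun z => ∫ t in Ioo 0 (f z), η (t, angularMomentumSq z)) ∧
    ∫ p, η p ∂(levelMeasure f) = ∫ z, ∫ t in Ioo 0 (f z), η (t, angularMomentumSq z) := by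
  have := isFiniteMeasure_restrict_subgraph hf hi
  have hm := measurable_level
  have hint : Integrable (fun p : Phase × ℝ => η (p.2, angularMomentumSq p.1))
      ((volume : Measure (Phase × ℝ)).restrict (subgraph f)) :=
    Integrable.of_bound (hη.comp hm).aestronglyMeasurable K (ae_of_all _ fun p => hK _)
  rw [← IntegrableOn, ← integrable_indicator_iff (measurableSet_subgraph hf),
    Measure.volume_eq_prod] at hint
  have key : ∀ z, ∫ t, (subgraph f).indicator
      (fun p : Phase × ℝ => η (p.2, angularMomentumSq p.1)) (z, t)
      = ∫ t in Ioo 0 (f z), η (t, angularMomentumSq z) := by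
    intro z
    rw [← integral_indicator measurableSet_Ioo]
    rfl
  constructor
  · have := hint.integral_prod_left
    simpa only [key] using this
  · rw [levelMeasure, integral_map hm.aemeasurable hη.aestronglyMeasurable,
      ← integral_indicator (measurableSet_subgraph hf), Measure.volume_eq_prod,
      integral_prod _ hint]
    simp only [key]

/-- The smooth cut-off in the level variable approximating the indicator of `(a, ∞)`. -/
noncomputable def smoothStep (n : ℕ) (a t : ℝ) : ℝ := Real.smoothTransition (n * (t - a))

lemma smoothStep_contDiff (n : ℕ) (a : ℝ) {k : ℕ∞} : ContDiff ℝ k (smoothStep n a) :=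
  Real.smoothTransition.contDiff.comp (by fun_prop)

lemma abs_smoothStep_le (n : ℕ) (a t : ℝ) : |smoothStep n a t| ≤ 1 := by
  unfold smoothStep
  rw [abs_of_nonneg (Real.smoothTransition.nonneg _)]
  exact Real.smoothTransition.le_one _

lemma tendsto_smoothStep (a t : ℝ) :
    Tendsto (fun n => smoothStep n a t) atTop (𝓝 ((Ioi a).indicator (fun _ => 1) t)) := by
  by_cases h : a < t
  · rw [indicator_of_mem (by exact h)]
    refine tendsto_const_nhds.congr' ?_
    obtain ⟨n₀, hn₀⟩ := exists_nat_ge (1 / (t - a))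
    filter_upwards [eventually_ge_atTop n₀] with n hn
    have ht : 0 < t - a := by linarith
    refine (Real.smoothTransition.one_of_one_le ?_).symm
    have : (n₀ : ℝ) ≤ n := by exact_mod_cast hn
    rw [div_le_iff₀ ht] at hn₀
    nlinarith
  · rw [indicator_of_notMem (by exact h)]
    refine tendsto_const_nhds.congr fun n => ?_
    refine (Real.smoothTransition.zero_of_nonpos ?_).symm
    exact mul_nonpos_of_nonneg_of_nonpos (by positivity) (by linarith)

/-- The condition ∂_fΦ(0, L) = 0 is the vanishing of the cut-off at level 0, which is why a ≥ 0 is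
needed. -/
lemma isCasimirFunction_smoothStep (n : ℕ) {a : ℝ} (ha : 0 ≤ a) (b : ℝ) :
    IsCasimirFunction (fun y => (∫ t in (0 : ℝ)..y.1, smoothStep n a t) * smoothStep n b y.2) := by
  obtain ⟨K, hK⟩ := exists_bound_deriv_smoothTransition
  have hc : Continuous (smoothStep n a) := (smoothStep_contDiff n a (k := 0)).continuous
  have hd : ∀ s, HasDerivAt (smoothStep n a)
      (deriv Real.smoothTransition (n * (s - a)) * n) s := by
    intro s
    have h1 : HasDerivAt Real.smoothTransition (deriv Real.smoothTransition (n * (s - a)))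
      (n * (s - a)) := ((Real.smoothTransition.contDiff (n := 1)).differentiable
        (by norm_num)).differentiableAt.hasDerivAt
    have h2 : HasDerivAt (fun s : ℝ => (n : ℝ) * (s - a)) n s := by
      simpa using ((hasDerivAt_id s).sub_const a).const_mul (n : ℝ)
    exact h1.comp s h2
  refine IsCasimirFunction.of_mul (p := smoothStep n a) (K := K * n)
    (P := fun s => ∫ t in (0 : ℝ)..s, smoothStep n a t)
    (fun s _ => ?_) (fun s _ => hd s) ?_ (by simp) ?_ (fun s _ => ?_)
    (smoothStep_contDiff n b) (abs_smoothStep_le n b)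
  · exact intervalIntegral.integral_hasDerivAt_right (hc.intervalIntegrable _ _)
      hc.stronglyMeasurable.stronglyMeasurableAtFilter hc.continuousAt
  · have : Continuous (deriv Real.smoothTransition) :=
      (Real.smoothTransition.contDiff (n := 1)).continuous_deriv le_rfl
    fun_prop
  · exact Real.smoothTransition.zero_of_nonpos
      (mul_nonpos_of_nonneg_of_nonpos (by positivity) (by linarith))
  · rw [abs_mul, Nat.abs_cast]
    exact mul_le_mul_of_nonneg_right (hK _) (by positivity)

/-- Integrals of the smooth product cut-offs against the level measure are Casimir integrals;
dominated convergence then yields the indicator of the quadrant. -/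
lemma levelMeasure_real_Ioi_prod {f₀ f : Phase → ℝ} (hf₀ : Measurable f₀) (hi₀ : Integrable f₀)
    (h0₀ : ∀ z, 0 ≤ f₀ z) (hf : Measurable f) (hi : Integrable f) (h0 : ∀ z, 0 ≤ f z)
    (hcas : ∀ Φ : ℝ × ℝ → ℝ, IsCasimirFunction Φ →
      ∫ z : Phase, Φ (f z, angularMomentumSq z) = ∫ z : Phase, Φ (f₀ z, angularMomentumSq z))
    {a : ℝ} (ha : 0 ≤ a) (b : ℝ) :
    levelMeasure f (Ioi a ×ˢ Ioi b) = levelMeasure f₀ (Ioi a ×ˢ Ioi b) := by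
  have := isFiniteMeasure_levelMeasure hf hi
  have := isFiniteMeasure_levelMeasure hf₀ hi₀
  set η : ℕ → ℝ × ℝ → ℝ := fun n p => smoothStep n a p.1 * smoothStep n b p.2
  have hηc : ∀ n, Continuous (η n) := fun n =>
    ((smoothStep_contDiff n a (k := 0)).continuous.comp continuous_fst).mul
      ((smoothStep_contDiff n b (k := 0)).continuous.comp continuous_snd)
  have hη1 : ∀ n p, |η n p| ≤ 1 := fun n p => by
    rw [abs_mul]
    exact mul_le_one₀ (abs_smoothStep_le _ _ _) (abs_nonneg _) (abs_smoothStep_le _ _ _)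
  have hsame : ∀ n, ∫ p, η n p ∂(levelMeasure f) = ∫ p, η n p ∂(levelMeasure f₀) := by
    intro n
    rw [(integral_levelMeasure hf hi (hηc n).measurable (hη1 n)).2,
      (integral_levelMeasure hf₀ hi₀ (hηc n).measurable (hη1 n)).2]
    have hform : ∀ g : Phase → ℝ, (∀ z, 0 ≤ g z) → ∀ z,
        ∫ t in Ioo 0 (g z), η n (t, angularMomentumSq z) =
        (∫ t in (0 : ℝ)..g z, smoothStep n a t) * smoothStep n b (angularMomentumSq z) := by
      intro g hg z
      rw [intervalIntegral.integral_of_le (hg z), ← integral_Ioc_eq_integral_Ioo]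
      exact integral_mul_const (smoothStep n b (angularMomentumSq z)) _
    simp only [hform f h0, hform f₀ h0₀]
    exact hcas _ (isCasimirFunction_smoothStep n ha b)
  have hlim : ∀ (μ : Measure (ℝ × ℝ)) [IsFiniteMeasure μ],
      Tendsto (fun n => ∫ p, η n p ∂μ) atTop (𝓝 (μ.real (Ioi a ×ˢ Ioi b))) := by
    intro μ _
    have : μ.real (Ioi a ×ˢ Ioi b) = ∫ p, (Ioi a ×ˢ Ioi b).indicator (fun _ => (1 : ℝ)) p ∂μ := by
      rw [integral_indicator_const _ (measurableSet_Ioi.prod measurableSet_Ioi), smul_eq_mul,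
        mul_one]
    rw [this]
    refine tendsto_integral_of_dominated_convergence (fun _ => 1)
      (fun n => (hηc n).aestronglyMeasurable) (integrable_const 1)
      (fun n => ae_of_all _ fun p => hη1 n p) (ae_of_all _ fun p => ?_)
    have := (tendsto_smoothStep a p.1).mul (tendsto_smoothStep b p.2)
    convert this using 2
    simp only [indicator, mem_prod, mem_Ioi]
    split_ifs <;> simp_all
  have := tendsto_nhds_unique ((hlim (levelMeasure f)).congr hsame) (hlim (levelMeasure f₀))
  rwa [measureReal_eq_measureReal_iff] at this

/-- The subgraph contains positive levels only. This covers the thresholds a < 0, for which the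
smooth cut-off is not a Casimir function. -/
lemma levelMeasure_Ioi_prod_of_neg (f : Phase → ℝ) {a : ℝ} (ha : a < 0) (b : ℝ)
    (hf : Measurable f) :
    levelMeasure f (Ioi a ×ˢ Ioi b) = levelMeasure f (Ioi 0 ×ˢ Ioi b) := by
  have hm := measurable_level
  rw [levelMeasure, Measure.map_apply hm (measurableSet_Ioi.prod measurableSet_Ioi),
    Measure.map_apply hm (measurableSet_Ioi.prod measurableSet_Ioi),
    Measure.restrict_apply' (measurableSet_subgraph hf),
    Measure.restrict_apply' (measurableSet_subgraph hf)]
  congr 1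
  ext p
  simp only [subgraph, mem_inter_iff, mem_preimage, mem_prod, mem_Ioi, mem_ofPred_eq]
  constructor
  · rintro ⟨⟨_, h2⟩, h3, h4⟩; exact ⟨⟨h3, h2⟩, h3, h4⟩
  · rintro ⟨⟨h1, h2⟩, h3, h4⟩; exact ⟨⟨ha.trans h1, h2⟩, h3, h4⟩

/-- States with the same Casimir integrals have the same level measure. -/
theorem levelMeasure_eq {f₀ f : Phase → ℝ} (hf₀ : Measurable f₀) (hi₀ : Integrable f₀)
    (h0₀ : ∀ z, 0 ≤ f₀ z) (hf : Measurable f) (hi : Integrable f) (h0 : ∀ z, 0 ≤ f z)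
    (hcas : ∀ Φ : ℝ × ℝ → ℝ, IsCasimirFunction Φ →
      ∫ z : Phase, Φ (f z, angularMomentumSq z) = ∫ z : Phase, Φ (f₀ z, angularMomentumSq z)) :
    levelMeasure f = levelMeasure f₀ := by
  have := isFiniteMeasure_levelMeasure hf hi
  have := isFiniteMeasure_levelMeasure hf₀ hi₀
  have hrect : ∀ a b : ℝ, levelMeasure f (Ioi a ×ˢ Ioi b) = levelMeasure f₀ (Ioi a ×ˢ Ioi b) := by
    intro a b
    rcases lt_or_ge a 0 with ha | ha
    · rw [levelMeasure_Ioi_prod_of_neg f ha b hf, levelMeasure_Ioi_prod_of_neg f₀ ha b hf₀]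
      exact levelMeasure_real_Ioi_prod hf₀ hi₀ h0₀ hf hi h0 hcas le_rfl b
    · exact levelMeasure_real_Ioi_prod hf₀ hi₀ h0₀ hf hi h0 hcas ha b
  have hspan : IsCountablySpanning (range (Ioi : ℝ → Set ℝ)) := by
    refine ⟨fun n : ℕ => Ioi (-(n : ℝ)), fun n => mem_range_self _, ?_⟩
    ext x
    simp only [mem_iUnion, mem_Ioi, mem_univ, iff_true]
    obtain ⟨n, hn⟩ := exists_nat_gt (-x)
    exact ⟨n, by linarith⟩
  have hgen : MeasurableSpace.generateFrom (range (Ioi : ℝ → Set ℝ)) = (inferInstance : MeasurableSpace ℝ) := by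
    rw [← borel_eq_generateFrom_Ioi ℝ]
    exact (BorelSpace.measurable_eq (α := ℝ)).symm
  -- Open quadrants form a π-system generating the Borel sets; the total masses agree because the
  -- plane is an increasing union of quadrants.
  refine ext_of_generate_finite (image2 (· ×ˢ ·) (range (Ioi : ℝ → Set ℝ)) (range (Ioi : ℝ → Set ℝ)))
    (generateFrom_eq_prod hgen hgen hspan hspan).symm
    (isPiSystem_Ioi.prod isPiSystem_Ioi) ?_ ?_
  · rintro _ ⟨_, ⟨a, rfl⟩, _, ⟨b, rfl⟩, rfl⟩
    exact hrect a b
  · have huniv : (univ : Set (ℝ × ℝ)) = ⋃ n : ℕ, (Ioi (-(n : ℝ)) ×ˢ Ioi (-(n : ℝ))) := by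
      ext p
      simp only [mem_univ, mem_iUnion, mem_prod, mem_Ioi, true_iff]
      obtain ⟨n, hn⟩ := exists_nat_gt (max (-p.1) (-p.2))
      refine ⟨n, ?_, ?_⟩
      · linarith [le_max_left (-p.1) (-p.2)]
      · linarith [le_max_right (-p.1) (-p.2)]
    have hmono : Monotone (fun n : ℕ => Ioi (-(n : ℝ)) ×ˢ Ioi (-(n : ℝ))) := by
      intro n k hnk
      have : (n : ℝ) ≤ k := by exact_mod_cast hnk
      exact prod_mono (Ioi_subset_Ioi (by linarith)) (Ioi_subset_Ioi (by linarith))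
    rw [huniv, hmono.measure_iUnion, hmono.measure_iUnion]
    simp only [hrect]

/-- If a state is bounded by `T`, so is every state with the same level measure. -/
lemma ae_le_of_levelMeasure_eq {f₀ f : Phase → ℝ} (hf₀ : Measurable f₀)
    (hf : Measurable f) {T : ℝ} (hT : 0 ≤ T) (hfT : ∀ z, f₀ z ≤ T)
    (h : levelMeasure f = levelMeasure f₀) : ∀ᵐ z, f z ≤ T := by
  have hm := measurable_level
  have hS : MeasurableSet (Ioi T ×ˢ (univ : Set ℝ)) := measurableSet_Ioi.prod MeasurableSet.univ
  have h0 : levelMeasure f₀ (Ioi T ×ˢ univ) = 0 := by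
    rw [levelMeasure, Measure.map_apply hm hS, Measure.restrict_apply' (measurableSet_subgraph hf₀)]
    convert measure_empty (μ := volume)
    ext p
    simp only [subgraph, mem_inter_iff, mem_preimage, mem_prod, mem_Ioi, mem_ofPred_eq, mem_univ,
      and_true, mem_empty_iff_false, iff_false, not_and, not_lt]
    intro h1 _
    exact (hfT _).trans h1.le
  rw [← h, levelMeasure, Measure.map_apply hm hS,
    Measure.restrict_apply' (measurableSet_subgraph hf)] at h0
  have hset : ((fun p : Phase × ℝ => (p.2, angularMomentumSq p.1)) ⁻¹' (Ioi T ×ˢ univ)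
      ∩ subgraph f) = {p : Phase × ℝ | T < p.2 ∧ p.2 < f p.1} := by
    ext p
    simp only [subgraph, mem_inter_iff, mem_preimage, mem_prod, mem_Ioi, mem_ofPred_eq, mem_univ,
      and_true]
    constructor
    · rintro ⟨h1, _, h3⟩; exact ⟨h1, h3⟩
    · rintro ⟨h1, h3⟩; exact ⟨h1, hT.trans_lt h1, h3⟩
  have hms : MeasurableSet {p : Phase × ℝ | T < p.2 ∧ p.2 < f p.1} :=
    (measurableSet_lt measurable_const measurable_snd).inter
      (measurableSet_lt measurable_snd (hf.comp measurable_fst))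
  rw [hset, Measure.volume_eq_prod, Measure.measure_prod_null hms] at h0
  filter_upwards [h0] with z hz
  have : Prod.mk z ⁻¹' {p : Phase × ℝ | T < p.2 ∧ p.2 < f p.1} = Ioo T (f z) := by
    ext t; simp
  rw [this, Real.volume_Ioo] at hz
  simpa using hz

/-! ### Rotations, Newton's shell theorem and the force field of a symmetric state -/

lemma exists_unit_orthogonal (x : Space) : ∃ u : Space, u ≠ 0 ∧ inner ℝ u x = 0 := by
  by_contra! h
  have hinj : Function.Injective ((innerSL ℝ x : Space →L[ℝ] ℝ) : Space →ₗ[ℝ] ℝ) := by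
    rw [← LinearMap.ker_eq_bot, LinearMap.ker_eq_bot']
    intro u hu
    by_contra hne
    exact h u hne (by rw [real_inner_comm]; simpa using hu)
  have := LinearMap.finrank_le_finrank_of_injective hinj
  simp at this

/-- The dimension is odd: (-1)³ times the determinant -1 of the reflection. -/
lemma det_neg_reflection {u : Space} (hu : u ≠ 0) :
    LinearMap.det ((((ℝ ∙ u)ᗮ.reflection).trans (LinearIsometryEquiv.neg ℝ)).toLinearEquiv :
      Space →ₗ[ℝ] Space) = 1 := by
  have h1 : ((((ℝ ∙ u)ᗮ.reflection).trans (LinearIsometryEquiv.neg ℝ)).toLinearEquiv :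
      Space →ₗ[ℝ] Space) = (-1 : ℝ) • ((ℝ ∙ u)ᗮ.reflection).toLinearMap := by
    ext1 v
    simp
  rw [h1, LinearMap.det_smul, Submodule.det_reflection, Submodule.orthogonal_orthogonal,
    finrank_span_singleton hu]
  simp
  norm_num

/-- `SO(3)` acts transitively on spheres. -/
lemma exists_rotation {x y : Space} (h : ‖x‖ = ‖y‖) :
    ∃ A : Space ≃ₗᵢ[ℝ] Space,
      LinearMap.det (A.toLinearEquiv : Space →ₗ[ℝ] Space) = 1 ∧ A x = y := by
  by_cases hxy : x - -y = 0
  · obtain ⟨u, hu, hux⟩ := exists_unit_orthogonal x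
    refine ⟨_, det_neg_reflection hu, ?_⟩
    have hmem : x ∈ (ℝ ∙ u)ᗮ := Submodule.mem_orthogonal_singleton_iff_inner_right.2 hux
    have : (ℝ ∙ u)ᗮ.reflection x = x := Submodule.reflection_mem_subspace_eq_self hmem
    simp only [LinearIsometryEquiv.trans_apply, this, LinearIsometryEquiv.coe_neg]
    rw [sub_neg_eq_add] at hxy
    exact (eq_neg_of_add_eq_zero_right hxy).symm
  · refine ⟨_, det_neg_reflection hxy, ?_⟩
    have : (ℝ ∙ (x - -y))ᗮ.reflection x = -y := Submodule.reflection_sub (by simpa using h)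
    simp only [LinearIsometryEquiv.trans_apply, this, LinearIsometryEquiv.coe_neg, neg_neg]

lemma spatialDensity_rotate {f : Phase → ℝ} (hf : IsSphericallySymmetric f)
    (A : Space ≃ₗᵢ[ℝ] Space) (hA : LinearMap.det (A.toLinearEquiv : Space →ₗ[ℝ] Space) = 1) :
    ∀ᵐ y : Space, spatialDensity f (A y) = spatialDensity f y := by
  have h := hf A hA
  rw [Measure.volume_eq_prod] at h
  filter_upwards [Measure.ae_ae_of_ae_prod h] with y hy
  unfold spatialDensity
  rw [← A.measurePreserving.integral_comp' (f := A.toMeasurableEquiv) (fun v => f (A y, v))]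
  exact integral_congr_ae hy

/-- Averages over directions in `ℝ³` of functions of the angle to a fixed axis. -/
lemma lintegral_ball_direction (e : Space) (he : ‖e‖ = 1) (H : ℝ → ℝ≥0∞) (hH : Measurable H) :
    ∫⁻ ξ in Metric.ball (0 : Space) 1, H (inner ℝ e ξ / ‖ξ‖)
      = volume (Metric.ball (0 : Space) 1) * (2⁻¹ * ∫⁻ t in Ioo (-1 : ℝ) 1, H t) := by
  have key : ∀ H : ℝ → ℝ≥0∞, Measurable H →
      ∫⁻ ξ in Metric.ball (0 : Space) 1, H (inner ℝ e ξ / ‖ξ‖)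
      = (ENNReal.ofReal Real.pi * ∫⁻ u in Ioo (0 : ℝ) 1, ENNReal.ofReal √u)
        * ∫⁻ t in Ioo (-1 : ℝ) 1, H t := by
    intro H hH
    -- In cylindrical coordinates |ξ|² = w² + q. Taking u = w² + q as variable, and then w = √u t,
    -- separates the radius from the cosine t.
    set F : ℝ × ℝ → ℝ≥0∞ := fun p =>
      (Iio (1 : ℝ)).indicator (fun u => H (p.1 / √u)) (p.1 ^ 2 + p.2)
    have hset : MeasurableSet {p : ℝ × ℝ | p.1 ^ 2 < p.2 ∧ p.2 < 1} :=
      (measurableSet_lt (f := fun p : ℝ × ℝ => p.1 ^ 2) (by fun_prop) measurable_snd).inter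
        (measurableSet_lt measurable_snd measurable_const)
    have hF : Measurable F := by
      have : F = {p : ℝ × ℝ | p.1 ^ 2 + p.2 < 1}.indicator
          (fun p => H (p.1 / √(p.1 ^ 2 + p.2))) := by
        ext p; simp [F, indicator]
      rw [this]
      exact Measurable.indicator (by fun_prop) (measurableSet_lt (by fun_prop) (by fun_prop))
    have h1 : ∫⁻ ξ in Metric.ball (0 : Space) 1, H (inner ℝ e ξ / ‖ξ‖)
        = ∫⁻ v : Space, F (inner ℝ e v, ‖v‖ ^ 2 - (inner ℝ e v) ^ 2) := by
      rw [← lintegral_indicator measurableSet_ball]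
      refine lintegral_congr fun v => ?_
      simp only [F, indicator, Metric.mem_ball, dist_zero_right, mem_Iio, add_sub_cancel,
        Real.sqrt_sq (norm_nonneg v)]
      have : ‖v‖ < 1 ↔ ‖v‖ ^ 2 < 1 := by
        rw [sq_lt_one_iff₀ (norm_nonneg v)]
      simp only [this]
    rw [h1, lintegral_cylindrical e he F hF, mul_assoc]
    congr 1
    set Q : ℝ × ℝ → ℝ≥0∞ := {p : ℝ × ℝ | p.1 ^ 2 < p.2 ∧ p.2 < 1}.indicator
      (fun p => H (p.1 / √p.2))
    have hQ : Measurable Q := Measurable.indicator (by fun_prop) hset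
    have h2 : ∀ w : ℝ, ∫⁻ q in Ioi (0 : ℝ), F (w, q) = ∫⁻ u : ℝ, Q (w, u) := by
      intro w
      rw [← lintegral_indicator measurableSet_Ioi,
        ← lintegral_add_left_eq_self (fun u => Q (w, u)) (w ^ 2)]
      refine lintegral_congr fun q => ?_
      simp only [F, Q, indicator, mem_Ioi, mem_Iio, mem_ofPred_eq]
      by_cases hq : 0 < q <;> by_cases hq1 : w ^ 2 + q < 1 <;> simp [hq, hq1]
    simp only [h2]
    rw [lintegral_lintegral_swap (f := fun w u => Q (w, u)) hQ.aemeasurable, ← lintegral_mul_const _ (by fun_prop),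
      ← lintegral_indicator measurableSet_Ioo]
    refine lintegral_congr fun u => ?_
    by_cases hu : u ∈ Ioo (0 : ℝ) 1
    · rw [indicator_of_mem hu]
      have hsu : 0 < √u := Real.sqrt_pos.2 hu.1
      have himg : (fun t : ℝ => √u * t) '' Ioo (-1) 1 = Ioo (-√u) √u := by
        rw [image_mul_left_Ioo hsu]; simp
      have h3 := lintegral_image_eq_lintegral_abs_deriv_mul (s := Ioo (-1 : ℝ) 1)
        (f := fun t : ℝ => √u * t) (f' := fun _ => √u) measurableSet_Ioo
        (fun s _ => by simpa using ((hasDerivAt_id s).const_mul √u).hasDerivWithinAt)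
        (fun a _ b _ hab => mul_left_cancel₀ hsu.ne' hab) (fun w => H (w / √u))
      rw [himg, abs_of_pos hsu, lintegral_const_mul' _ _ ENNReal.ofReal_ne_top] at h3
      have h4 : ∀ w, Q (w, u) = (Ioo (-√u) √u).indicator (fun w => H (w / √u)) w := by
        intro w
        simp only [Q, indicator, mem_ofPred_eq, hu.2, and_true, mem_Ioo]
        have : w ^ 2 < u ↔ (-√u < w ∧ w < √u) := by
          rw [← abs_lt, ← sq_lt_sq₀ (abs_nonneg w) hsu.le, sq_abs, Real.sq_sqrt hu.1.le]
        simp only [this]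
      refine (lintegral_congr h4).trans ?_
      rw [lintegral_indicator measurableSet_Ioo, h3]
      congr 2
      ext t
      rw [mul_div_cancel_left₀ _ hsu.ne']
    · rw [indicator_of_notMem hu]
      refine (lintegral_congr fun w => ?_).trans (lintegral_zero (α := ℝ) (μ := volume))
      refine indicator_of_notMem ?_ _
      rintro ⟨h3, h4⟩
      exact hu ⟨(sq_nonneg w).trans_lt h3, h4⟩
  -- Testing with the constant function identifies the prefactor as half the ball volume, so the
  -- integral of √u need not be evaluated.
  have h1 := key (fun _ => 1) measurable_const
  simp only [lintegral_const, MeasurableSet.univ, Measure.restrict_apply, univ_inter, one_mul,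
    Real.volume_Ioo] at h1
  rw [key H hH, h1, show ENNReal.ofReal (1 - -1) = 2 by norm_num, mul_assoc _ (2 : ℝ≥0∞),
    ← mul_assoc (2 : ℝ≥0∞), ENNReal.mul_inv_cancel (by norm_num) (by norm_num), one_mul]

/-- An antiderivative is -√(r² - 2rst + s²)/(rs). The square roots at the end points are |r - s| and
r + s, and (r + s - |r - s|)/(rs) = 2/max(r, s). -/
lemma lintegral_inv_sqrt_newton {r s : ℝ} (hr : 0 < r) (hs : 0 < s) (hrs : s ≠ r) :
    ∫⁻ t in Ioo (-1 : ℝ) 1, ENNReal.ofReal (1 / √(r ^ 2 - 2 * (r * s) * t + s ^ 2))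
      = ENNReal.ofReal (2 / max r s) := by
  have hD : ∀ t ∈ Icc (-1 : ℝ) 1, 0 < r ^ 2 - 2 * (r * s) * t + s ^ 2 := by
    intro t ht
    have h1 : 0 < (r - s) ^ 2 := by
      have : r - s ≠ 0 := sub_ne_zero.2 hrs.symm
      positivity
    nlinarith [mul_pos hr hs, ht.2]
  have hcont : ContinuousOn (fun t : ℝ => 1 / √(r ^ 2 - 2 * (r * s) * t + s ^ 2)) (Icc (-1) 1) :=
    continuousOn_const.div (by fun_prop) fun t ht => (Real.sqrt_pos.2 (hD t ht)).ne'
  have hint : IntervalIntegrable (fun t : ℝ => 1 / √(r ^ 2 - 2 * (r * s) * t + s ^ 2))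
      volume (-1) 1 := by
    apply ContinuousOn.intervalIntegrable
    rwa [uIcc_of_le (by norm_num)]
  have hftc := intervalIntegral.integral_eq_sub_of_hasDerivAt (a := -1) (b := 1)
    (f := fun t : ℝ => -√(r ^ 2 - 2 * (r * s) * t + s ^ 2) / (r * s))
    (f' := fun t : ℝ => 1 / √(r ^ 2 - 2 * (r * s) * t + s ^ 2))
    (fun t ht => by
      rw [uIcc_of_le (by norm_num)] at ht
      have h0 := hD t ht
      have h1 : HasDerivAt (fun t : ℝ => r ^ 2 - 2 * (r * s) * t + s ^ 2) (-(2 * (r * s))) t := by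
        simpa using (((hasDerivAt_id t).const_mul (2 * (r * s))).const_sub (r ^ 2)).add_const (s ^ 2)
      have h2 := ((h1.sqrt h0.ne').neg).div_const (r * s)
      refine h2.congr_deriv ?_
      have := (Real.sqrt_pos.2 h0).ne'
      field_simp) hint
  rw [← ofReal_integral_eq_lintegral_ofReal
    ((intervalIntegrable_iff_integrableOn_Ioo_of_le (by norm_num)).1 hint)
    (ae_of_all _ fun t => by positivity), ← integral_Ioc_eq_integral_Ioo,
    ← intervalIntegral.integral_of_le (by norm_num), hftc]
  congr 1
  rw [show r ^ 2 - 2 * (r * s) * 1 + s ^ 2 = (r - s) ^ 2 by ring,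
    show r ^ 2 - 2 * (r * s) * -1 + s ^ 2 = (r + s) ^ 2 by ring, Real.sqrt_sq_eq_abs,
    Real.sqrt_sq (by positivity)]
  rcases lt_or_gt_of_ne hrs with h | h
  · rw [abs_of_pos (by linarith), max_eq_left h.le]
    field_simp
    ring
  · rw [abs_of_neg (by linarith), max_eq_right h.le]
    field_simp
    ring

/-- Newton's shell theorem: the mean of `1 / |rω - y|` over directions `ω`. -/
lemma lintegral_ball_newton {r : ℝ} (hr : 0 < r) {y : Space} (hy : y ≠ 0) (hyr : ‖y‖ ≠ r) :
    ∫⁻ ξ in Metric.ball (0 : Space) 1, ENNReal.ofReal (1 / ‖(r / ‖ξ‖) • ξ - y‖)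
      = volume (Metric.ball (0 : Space) 1) * ENNReal.ofReal (1 / max r ‖y‖) := by
  have hs : 0 < ‖y‖ := norm_pos_iff.2 hy
  have h := lintegral_ball_direction ((‖y‖)⁻¹ • y) (by simp [norm_smul, hs.ne'])
    (fun t => ENNReal.ofReal (1 / √(r ^ 2 - 2 * (r * ‖y‖) * t + ‖y‖ ^ 2))) (by fun_prop)
  rw [lintegral_inv_sqrt_newton hr hs hyr] at h
  have hc : (2⁻¹ : ℝ≥0∞) * ENNReal.ofReal (2 / max r ‖y‖) = ENNReal.ofReal (1 / max r ‖y‖) := by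
    rw [show (2⁻¹ : ℝ≥0∞) = ENNReal.ofReal (2⁻¹) by
      rw [ENNReal.ofReal_inv_of_pos (by norm_num)]; norm_num, ← ENNReal.ofReal_mul (by norm_num)]
    congr 1
    ring
  rw [hc] at h
  rw [← h]
  refine lintegral_congr_ae (ae_restrict_of_ae ?_)
  have : ∀ᵐ x : Space, x ≠ 0 := by simp [ae_iff, measure_singleton]
  filter_upwards [this] with ξ hξ
  have hξ' : ‖ξ‖ ≠ 0 := norm_ne_zero_iff.2 hξ
  congr 2
  rw [← Real.sqrt_sq (norm_nonneg ((r / ‖ξ‖) • ξ - y)), norm_sub_sq_real, norm_smul,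
    real_inner_smul_left, real_inner_smul_left, Real.norm_of_nonneg (by positivity),
    div_mul_cancel₀ _ hξ', real_inner_comm y ξ]
  congr 2
  field_simp

lemma ae_norm_ne (r : ℝ) : ∀ᵐ y : Space, ‖y‖ ≠ r := by
  have h : volume (Metric.sphere (0 : Space) r) = 0 := Measure.addHaar_sphere _ _ _
  have hs : {y : Space | ¬ ‖y‖ ≠ r} = Metric.sphere 0 r := by ext y; simp
  rw [ae_iff, hs, h]

/-- The Newtonian potential of a rotation invariant density. -/
lemma lintegral_newton {ρ : Space → ℝ≥0∞} (hρ : Measurable ρ)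
    (hrot : ∀ A : Space ≃ₗᵢ[ℝ] Space, LinearMap.det (A.toLinearEquiv : Space →ₗ[ℝ] Space) = 1 →
      ∀ᵐ y : Space, ρ (A y) = ρ y) {x : Space} (hx : x ≠ 0) :
    ∫⁻ y, ρ y * ENNReal.ofReal (1 / ‖x - y‖)
      = ∫⁻ y, ρ y * ENNReal.ofReal (1 / max ‖x‖ ‖y‖) := by
  set φ : Space → ℝ≥0∞ := fun x => ∫⁻ y, ρ y * ENNReal.ofReal (1 / ‖x - y‖)
  have hr : 0 < ‖x‖ := norm_pos_iff.2 hx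
  have hφ : ∀ x' : Space, ‖x‖ = ‖x'‖ → φ x' = φ x := by
    intro x' hx'
    obtain ⟨A, hA, hAx⟩ := exists_rotation hx'
    have hm : Measurable (fun y => ρ y * ENNReal.ofReal (1 / ‖x' - y‖)) := by fun_prop
    simp only [φ]
    rw [← A.measurePreserving.lintegral_comp hm]
    refine lintegral_congr_ae ?_
    filter_upwards [hrot A hA] with y hy
    rw [hy, ← hAx, ← map_sub, A.norm_map]
  set B := Metric.ball (0 : Space) 1
  have hB0 : volume B ≠ 0 := (Metric.measure_ball_pos volume _ one_pos).ne'
  have hBt : volume B ≠ ⊤ := measure_ball_lt_top.ne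
  have hmeas : Measurable (fun p : Space × Space =>
      ρ p.2 * ENNReal.ofReal (1 / ‖(‖x‖ / ‖p.1‖) • p.1 - p.2‖)) := by
    refine (hρ.comp measurable_snd).mul (Measurable.ennreal_ofReal ?_)
    fun_prop
  have h0 : ∀ᵐ x : Space, x ≠ 0 := by simp [ae_iff, measure_singleton]
  have h1 : volume B * φ x = volume B * ∫⁻ y, ρ y * ENNReal.ofReal (1 / max ‖x‖ ‖y‖) := by
    -- The ball B, through ξ ↦ ξ/|ξ|, stands in for the uniform measure on directions. The potential
    -- is constant on the sphere through x, so it equals its mean, and the mean is taken inside the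
    -- integral over y.
    calc volume B * φ x = ∫⁻ _ in B, φ x := by
          rw [lintegral_const, Measure.restrict_apply_univ, mul_comm]
      _ = ∫⁻ ξ in B, φ ((‖x‖ / ‖ξ‖) • ξ) := by
          refine lintegral_congr_ae (ae_restrict_of_ae ?_)
          filter_upwards [h0] with ξ hξ
          refine (hφ _ ?_).symm
          rw [norm_smul, Real.norm_of_nonneg (by positivity),
            div_mul_cancel₀ _ (norm_ne_zero_iff.2 hξ)]
      _ = ∫⁻ y, ∫⁻ ξ in B, ρ y * ENNReal.ofReal (1 / ‖(‖x‖ / ‖ξ‖) • ξ - y‖) :=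
          lintegral_lintegral_swap hmeas.aemeasurable
      _ = ∫⁻ y, volume B * (ρ y * ENNReal.ofReal (1 / max ‖x‖ ‖y‖)) := by
          refine lintegral_congr_ae ?_
          filter_upwards [h0, ae_norm_ne ‖x‖] with y hy hyx
          rw [lintegral_const_mul _ (by fun_prop), lintegral_ball_newton hr hy hyx]
          ring
      _ = _ := by rw [lintegral_const_mul _ (by fun_prop)]
  exact (ENNReal.mul_right_inj hB0 hBt).1 h1

lemma integral_Ioi_inv_sq {c : ℝ} (hc : 0 < c) :
    IntegrableOn (fun s : ℝ => 1 / s ^ 2) (Ioi c) ∧ ∫ s in Ioi c, 1 / s ^ 2 = 1 / c := by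
  have hd : ∀ s ∈ Ici c, HasDerivAt (fun s : ℝ => -s⁻¹) (1 / s ^ 2) s := by
    intro s hs
    have : s ≠ 0 := (hc.trans_le hs).ne'
    exact ((hasDerivAt_inv this).neg).congr_deriv (by field_simp)
  have hl : Tendsto (fun s : ℝ => -s⁻¹) atTop (𝓝 (-0)) := tendsto_inv_atTop_zero.neg
  have hpos : ∀ s ∈ Ioi c, (0 : ℝ) ≤ 1 / s ^ 2 := fun s _ => by positivity
  refine ⟨integrableOn_Ioi_deriv_of_nonneg' hd hpos hl, ?_⟩
  rw [integral_Ioi_of_hasDerivAt_of_nonneg' hd hpos hl]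
  simp

lemma lintegral_Ioi_inv_sq {c : ℝ} (hc : 0 < c) :
    ∫⁻ s in Ioi c, ENNReal.ofReal (1 / s ^ 2) = ENNReal.ofReal (1 / c) := by
  rw [← ofReal_integral_eq_lintegral_ofReal (integral_Ioi_inv_sq hc).1
    (ae_of_all _ fun s => by positivity), (integral_Ioi_inv_sq hc).2]

/-- Fubini after writing 1/max(r, |y|) as the integral of s⁻² over s > max(r, |y|). -/
lemma lintegral_max_eq_mass {ρ : Space → ℝ≥0∞} (hρ : Measurable ρ) {r : ℝ} (hr : 0 < r) :
    ∫⁻ y, ρ y * ENNReal.ofReal (1 / max r ‖y‖)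
      = ∫⁻ s in Ioi r, ENNReal.ofReal (1 / s ^ 2) * ∫⁻ y in Metric.ball 0 s, ρ y := by
  set Q : Space × ℝ → ℝ≥0∞ := {p : Space × ℝ | ‖p.1‖ < p.2}.indicator
    (fun p => ρ p.1 * ENNReal.ofReal (1 / p.2 ^ 2))
  have hQ : Measurable Q := Measurable.indicator (by fun_prop)
    (measurableSet_lt (by fun_prop) (by fun_prop))
  calc ∫⁻ y, ρ y * ENNReal.ofReal (1 / max r ‖y‖) = ∫⁻ y, ∫⁻ s in Ioi r, Q (y, s) := by
        refine lintegral_congr fun y => ?_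
        rw [← lintegral_Ioi_inv_sq (lt_max_of_lt_left hr), ← lintegral_const_mul _ (by fun_prop),
          ← lintegral_indicator measurableSet_Ioi, ← lintegral_indicator measurableSet_Ioi]
        refine lintegral_congr fun s => ?_
        simp only [Q, indicator, mem_Ioi, max_lt_iff, mem_ofPred_eq]
        by_cases h1 : r < s <;> by_cases h2 : ‖y‖ < s <;> simp [h1, h2]
    _ = ∫⁻ s in Ioi r, ∫⁻ y, Q (y, s) :=
        lintegral_lintegral_swap (f := fun y s => Q (y, s)) hQ.aemeasurable
    _ = _ := by
        refine lintegral_congr fun s => ?_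
        rw [← lintegral_const_mul _ (by fun_prop), ← lintegral_indicator measurableSet_ball]
        refine lintegral_congr fun y => ?_
        simp only [Q, indicator, mem_ofPred_eq, Metric.mem_ball, dist_zero_right]
        split_ifs
        · rw [mul_comm]
        · rfl

/-- The mass of a state inside the ball of radius `s`. -/
noncomputable def massIn (f : Phase → ℝ) (s : ℝ) : ℝ :=
  ∫ y in Metric.ball (0 : Space) s, spatialDensity f y

lemma spatialDensity_measurable {f : Phase → ℝ} (hf : Measurable f) :
    Measurable (spatialDensity f) :=
  (hf.stronglyMeasurable.integral_prod_right').measurable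

lemma spatialDensity_nonneg {f : Phase → ℝ} (h0 : ∀ z, 0 ≤ f z) (x : Space) :
    0 ≤ spatialDensity f x := integral_nonneg fun _ => h0 _

lemma spatialDensity_integrable {f : Phase → ℝ} (hi : Integrable f) :
    Integrable (spatialDensity f) := by
  rw [Measure.volume_eq_prod] at hi
  exact hi.integral_prod_left

lemma massIn_nonneg {f : Phase → ℝ} (h0 : ∀ z, 0 ≤ f z) (s : ℝ) : 0 ≤ massIn f s :=
  integral_nonneg fun _ => spatialDensity_nonneg h0 _

lemma massIn_le {f : Phase → ℝ} (h0 : ∀ z, 0 ≤ f z) (hi : Integrable f) (s : ℝ) :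
    massIn f s ≤ ∫ z, f z := by
  have : ∫ z, f z = ∫ y, spatialDensity f y := by
    rw [Measure.volume_eq_prod] at hi ⊢
    exact integral_prod _ hi
  rw [this]
  exact setIntegral_le_integral (spatialDensity_integrable hi)
    (ae_of_all _ fun y => spatialDensity_nonneg h0 y)

/-- Spheres are null sets, so the indicators of the balls converge almost everywhere. -/
lemma massIn_continuous {f : Phase → ℝ} (hi : Integrable f) :
    Continuous (massIn f) := by
  have hρ := spatialDensity_integrable hi
  rw [continuous_iff_continuousAt]
  intro s
  have hform : massIn f = fun s => ∫ y, (Metric.ball (0 : Space) s).indicator (spatialDensity f) y :=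
    funext fun s => (integral_indicator measurableSet_ball).symm
  rw [hform]
  refine tendsto_integral_filter_of_dominated_convergence (fun y => ‖spatialDensity f y‖)
    (Eventually.of_forall fun s => (hρ.indicator measurableSet_ball).aestronglyMeasurable)
    (Eventually.of_forall fun s => ae_of_all _ fun y => norm_indicator_le_norm_self _ _)
    hρ.norm ?_
  filter_upwards [ae_norm_ne s] with y hy
  refine tendsto_const_nhds.congr' ?_
  rcases lt_or_gt_of_ne hy with h | h
  · filter_upwards [Ioi_mem_nhds h] with s' hs'
    rw [indicator_of_mem (by simpa using h), indicator_of_mem (by simpa using hs')]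
  · filter_upwards [Iio_mem_nhds h] with s' hs'
    rw [indicator_of_notMem (by simpa using h.le),
      indicator_of_notMem (by simpa using le_of_lt (mem_Iio.1 hs'))]

lemma massIn_div_sq_integrableOn {f : Phase → ℝ} (hi : Integrable f) (h0 : ∀ z, 0 ≤ f z)
    {r : ℝ} (hr : 0 < r) : IntegrableOn (fun s => massIn f s / s ^ 2) (Ioi r) := by
  have h1 := (integral_Ioi_inv_sq hr).1.const_mul (∫ z, f z)
  refine Integrable.mono' h1 ?_ (ae_of_all _ fun s => ?_)
  · exact ((massIn_continuous hi).measurable.div (by fun_prop)).aestronglyMeasurable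
  · rw [Real.norm_of_nonneg (div_nonneg (massIn_nonneg h0 s) (sq_nonneg s)), mul_one_div]
    exact div_le_div_of_nonneg_right (massIn_le h0 hi s) (sq_nonneg s)

/-- The shell theorem reduces the potential to one variable and exhibits its radial derivative m/r²,
without any regularity of the density. -/
lemma potential_eq {f : Phase → ℝ} (hf : Measurable f) (hi : Integrable f) (h0 : ∀ z, 0 ≤ f z)
    (hs : IsSphericallySymmetric f) {x : Space} (hx : x ≠ 0) :
    potential f x = -∫ s in Ioi ‖x‖, massIn f s / s ^ 2 := by
  have hρm := spatialDensity_measurable hf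
  have hρ0 := spatialDensity_nonneg h0
  have hρi := spatialDensity_integrable hi
  have hr : 0 < ‖x‖ := norm_pos_iff.2 hx
  unfold potential
  rw [integral_eq_lintegral_of_nonneg_ae (ae_of_all _ fun y => div_nonneg (hρ0 y) (norm_nonneg _))
    (hρm.div (by fun_prop)).aestronglyMeasurable, integral_eq_lintegral_of_nonneg_ae
    (ae_of_all _ fun s => div_nonneg (massIn_nonneg h0 s) (sq_nonneg s))
    (massIn_div_sq_integrableOn hi h0 hr).aestronglyMeasurable]
  congr 2
  have h1 : ∀ y, ENNReal.ofReal (spatialDensity f y / ‖x - y‖)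
      = ENNReal.ofReal (spatialDensity f y) * ENNReal.ofReal (1 / ‖x - y‖) := fun y => by
    rw [← ENNReal.ofReal_mul (hρ0 y), mul_one_div]
  simp only [h1]
  rw [lintegral_newton (ρ := fun y => ENNReal.ofReal (spatialDensity f y)) (by fun_prop)
    (fun A hA => by
      filter_upwards [spatialDensity_rotate hs A hA] with y hy
      rw [hy]) hx, lintegral_max_eq_mass (by fun_prop) hr]
  refine lintegral_congr fun s => ?_
  rw [← ofReal_integral_eq_lintegral_ofReal hρi.integrableOn (ae_of_all _ hρ0),
    ← ENNReal.ofReal_mul (by positivity), one_div_mul_eq_div]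
  rfl

lemma hasDerivAt_integral_Ioi {g : ℝ → ℝ} {r : ℝ} (hr : 0 < r) (hg : ContinuousOn g (Ioi 0))
    (hi : ∀ a, 0 < a → IntegrableOn g (Ioi a)) :
    HasDerivAt (fun r => -∫ s in Ioi r, g s) (g r) r := by
  have h2 : 0 < r / 2 := by positivity
  have hloc : ∀ᶠ t in 𝓝 r, -∫ s in Ioi t, g s
      = (∫ s in (r / 2)..t, g s) - ∫ s in Ioi (r / 2), g s := by
    filter_upwards [Ioi_mem_nhds (show r / 2 < r by linarith)] with t ht
    have := intervalIntegral.integral_Ioi_sub_Ioi (hi _ h2) (le_of_lt ht)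
    rw [← this]
    ring
  refine HasDerivAt.congr_of_eventuallyEq ?_ hloc
  refine HasDerivAt.sub_const _ ?_
  refine intervalIntegral.integral_hasDerivAt_right ?_ ?_ ?_
  · apply ContinuousOn.intervalIntegrable
    rw [uIcc_of_le (by linarith)]
    exact hg.mono fun s hs => h2.trans_le hs.1
  · exact ContinuousOn.stronglyMeasurableAtFilter isOpen_Ioi hg r hr
  · exact hg.continuousAt (Ioi_mem_nhds hr)

lemma hasGradientAt_radial {G : ℝ → ℝ} {U : Space → ℝ} {g : ℝ} {x : Space} (hx : x ≠ 0)
    (hG : HasDerivAt G g ‖x‖) (hU : ∀ y : Space, y ≠ 0 → U y = G ‖y‖) :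
    HasGradientAt U ((g / ‖x‖) • x) x := by
  have hr : 0 < ‖x‖ := norm_pos_iff.2 hx
  have h1 : HasFDerivAt (fun y : Space => ‖y‖ ^ 2) ((2 : ℝ) • innerSL ℝ x) x := by
    refine (hasStrictFDerivAt_norm_sq x).hasFDerivAt.congr_fderiv ?_
    ext v
    simp
  have h2 := h1.sqrt (by positivity)
  have h3 : HasFDerivAt (fun y : Space => ‖y‖) ((1 / ‖x‖) • innerSL ℝ x) x := by
    have h4 : (fun y : Space => √(‖y‖ ^ 2)) = fun y => ‖y‖ :=
      funext fun y => Real.sqrt_sq (norm_nonneg y)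
    rw [h4, Real.sqrt_sq hr.le, smul_smul] at h2
    refine h2.congr_fderiv ?_
    congr 1
    field_simp
  have h5 := hG.comp_hasFDerivAt x h3
  rw [hasGradientAt_iff_hasFDerivAt]
  have hloc : U =ᶠ[𝓝 x] fun y => G ‖y‖ := by
    filter_upwards [isOpen_ne.mem_nhds hx] with y hy
    exact hU y hy
  refine (h5.congr_of_eventuallyEq hloc).congr_fderiv ?_
  ext v
  simp [smul_smul, div_eq_mul_inv]

/-- The force field of a spherically symmetric state. -/
theorem gradient_potential {f : Phase → ℝ} (hf : Measurable f) (hi : Integrable f)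
    (h0 : ∀ z, 0 ≤ f z) (hs : IsSphericallySymmetric f) {x : Space} (hx : x ≠ 0) :
    gradient (potential f) x = (massIn f ‖x‖ / ‖x‖ ^ 3) • x := by
  have hr : 0 < ‖x‖ := norm_pos_iff.2 hx
  have h1 := hasDerivAt_integral_Ioi (g := fun s => massIn f s / s ^ 2) hr
    ((massIn_continuous hi).continuousOn.div (by fun_prop) fun s hs => by
      have : (0 : ℝ) < s := hs
      positivity)
    fun a ha => massIn_div_sq_integrableOn hi h0 ha
  have h2 := hasGradientAt_radial hx h1 fun y hy => potential_eq hf hi h0 hs hy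
  rw [h2.gradient]
  congr 1
  field_simp

/-! ### Radial calculus and the structure of the King potential -/

/-- A unit vector along which radial functions are evaluated. -/
noncomputable def axisVector : Space := EuclideanSpace.single 0 1

lemma norm_axisVector : ‖axisVector‖ = 1 := by simp [axisVector]

/-- The radial profile `r ↦ U(r e)` of a function on `ℝ³`. -/
noncomputable def radialProfile (U : Space → ℝ) (r : ℝ) : ℝ := U (r • axisVector)

lemma norm_smul_axisVector (r : ℝ) : ‖r • axisVector‖ = |r| := by
  rw [norm_smul, norm_axisVector, mul_one, Real.norm_eq_abs]

/-- Reduces the Laplacian to second derivatives along lines, on which a radial function depends on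
one variable. -/
lemma iteratedFDeriv_two_eq_deriv_line {U : Space → ℝ} (hU : ContDiff ℝ 2 U) (x v : Space) :
    iteratedFDeriv ℝ 2 U x ![v, v] = deriv (deriv fun t : ℝ => U (x + t • v)) 0 := by
  have hline : ∀ t : ℝ, HasDerivAt (fun t : ℝ => x + t • v) v t := fun t => by
    simpa using ((hasDerivAt_id t).smul_const v).const_add x
  have hd1 : Differentiable ℝ U := hU.differentiable (by norm_num)
  have hd2 : Differentiable ℝ (fderiv ℝ U) :=
    (hU.fderiv_right (m := 1) (by norm_num)).differentiable (by norm_num)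
  have h1 : deriv (fun t : ℝ => U (x + t • v)) = fun t => fderiv ℝ U (x + t • v) v := by
    ext t
    exact ((hd1 _).hasFDerivAt.comp_hasDerivAt t (hline t)).deriv
  rw [h1, iteratedFDeriv_two_apply]
  have h2 := ((hd2 (x + (0 : ℝ) • v)).hasFDerivAt.comp_hasDerivAt (0 : ℝ) (hline 0))
  have h3 := h2.clm_apply (hasDerivAt_const (0 : ℝ) v)
  have h4 := h3.deriv
  simp only [Function.comp_def, zero_smul, add_zero, map_zero] at h4
  simpa using h4.symm

section Radial

variable {U : Space → ℝ} (hU : ContDiff ℝ 2 U) (hrad : ∀ x y : Space, ‖x‖ = ‖y‖ → U x = U y)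

include hrad in
lemma eq_radialProfile (x : Space) : U x = radialProfile U ‖x‖ :=
  hrad _ _ (by rw [norm_smul_axisVector, abs_of_nonneg (norm_nonneg x)])

include hU in
lemma radialProfile_contDiff : ContDiff ℝ 2 (radialProfile U) :=
  hU.comp (contDiff_id.smul contDiff_const)

include hU in
lemma hasDerivAt_radialProfile (r : ℝ) :
    HasDerivAt (radialProfile U) (deriv (radialProfile U) r) r :=
  ((radialProfile_contDiff hU).differentiable (by norm_num) r).hasDerivAt

include hU in
lemma contDiff_deriv_radialProfile : ContDiff ℝ 1 (deriv (radialProfile U)) := by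
  have := radialProfile_contDiff hU
  rw [show (2 : WithTop ℕ∞) = 1 + 1 by norm_num, contDiff_succ_iff_deriv] at this
  exact this.2.2

include hU in
lemma hasDerivAt_deriv_radialProfile (r : ℝ) :
    HasDerivAt (deriv (radialProfile U)) (deriv (deriv (radialProfile U)) r) r :=
  ((contDiff_deriv_radialProfile hU).differentiable (by norm_num) r).hasDerivAt

include hU in
lemma continuous_deriv_deriv_radialProfile : Continuous (deriv (deriv (radialProfile U))) :=
  (contDiff_deriv_radialProfile hU).continuous_deriv le_rfl

-- On a line orthogonal to the axis the norm is √(r² + t²), so the first derivative is t κ(t) with κ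
-- = U'/norm. Its derivative at t = 0 is κ(0), which uses continuity of κ only and hence no third
-- derivative of U.
include hU hrad in
lemma deriv_deriv_orthogonal {r : ℝ} (hr : 0 < r) {v : Space} (hv : ‖v‖ = 1)
    (hov : inner ℝ axisVector v = 0) :
    deriv (deriv fun t : ℝ => U (r • axisVector + t • v)) 0 = deriv (radialProfile U) r / r := by
  have hpos : ∀ t : ℝ, 0 < r ^ 2 + t ^ 2 := fun t => by positivity
  have h1 : (fun t : ℝ => U (r • axisVector + t • v)) =
      fun t => radialProfile U √(r ^ 2 + t ^ 2) := by
    ext t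
    rw [eq_radialProfile hrad]
    congr 1
    rw [← Real.sqrt_sq (norm_nonneg (r • axisVector + t • v)), norm_add_sq_real, norm_smul,
      norm_smul, hv, norm_axisVector, real_inner_smul_left, real_inner_smul_right, hov]
    simp
  have h2 : deriv (fun t : ℝ => U (r • axisVector + t • v)) =
      fun t => t * (deriv (radialProfile U) √(r ^ 2 + t ^ 2) / √(r ^ 2 + t ^ 2)) := by
    rw [h1]
    ext t
    have h3 : HasDerivAt (fun t : ℝ => √(r ^ 2 + t ^ 2)) (t / √(r ^ 2 + t ^ 2)) t := by
      have h4 : HasDerivAt (fun t : ℝ => r ^ 2 + t ^ 2) (2 * t) t := by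
        simpa using (hasDerivAt_pow 2 t).const_add (r ^ 2)
      refine (h4.sqrt (hpos t).ne').congr_deriv ?_
      have := (Real.sqrt_pos.2 (hpos t)).ne'
      field_simp
    have h5 : HasDerivAt (fun t => radialProfile U √(r ^ 2 + t ^ 2)) _ t :=
      (hasDerivAt_radialProfile hU _).comp t h3
    rw [h5.deriv]
    ring
  rw [h2]
  have hk : ContinuousAt (fun t => deriv (radialProfile U) √(r ^ 2 + t ^ 2) / √(r ^ 2 + t ^ 2))
      0 := by
    refine ContinuousAt.div ?_ (by fun_prop) (Real.sqrt_pos.2 (hpos 0)).ne'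
    have := (contDiff_deriv_radialProfile hU).continuous
    fun_prop
  have h5 : HasDerivAt (fun t => t * (deriv (radialProfile U) √(r ^ 2 + t ^ 2) / √(r ^ 2 + t ^ 2)))
      (deriv (radialProfile U) r / r) 0 := by
    rw [hasDerivAt_iff_tendsto_slope]
    have h6 := hk.tendsto
    simp only [ne_eq, OfNat.ofNat_ne_zero, not_false_eq_true, zero_pow, add_zero,
      Real.sqrt_sq hr.le] at h6
    refine (h6.mono_left nhdsWithin_le_nhds).congr' ?_
    filter_upwards [self_mem_nhdsWithin] with t ht
    have ht0 : t ≠ 0 := ht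
    simp only [slope_def_field, zero_mul, sub_zero]
    rw [mul_div_cancel_left₀ _ ht0]
  exact h5.deriv

include hU hrad in
/-- The Laplacian of a radial function. -/
lemma laplacian_radial {r : ℝ} (hr : 0 < r) :
    Laplacian.laplacian U (r • axisVector)
      = deriv (deriv (radialProfile U)) r + 2 * (deriv (radialProfile U) r / r) := by
  rw [InnerProductSpace.laplacian_eq_iteratedFDeriv_orthonormalBasis U
    (EuclideanSpace.basisFun (Fin 3) ℝ)]
  simp only [iteratedFDeriv_two_eq_deriv_line hU, Fin.sum_univ_three,
    EuclideanSpace.basisFun_apply]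
  rw [deriv_deriv_orthogonal hU hrad hr (v := EuclideanSpace.single 1 1) (by simp)
      (by simp [axisVector, EuclideanSpace.inner_single_left]),
    deriv_deriv_orthogonal hU hrad hr (v := EuclideanSpace.single 2 1) (by simp)
      (by simp [axisVector, EuclideanSpace.inner_single_left])]
  have h1 : (fun t : ℝ => U (r • axisVector + t • EuclideanSpace.single 0 1)) =
      fun t => radialProfile U (r + t) := by
    ext t
    simp only [radialProfile, add_smul]
    rfl
  have h2 : deriv (fun t => radialProfile U (r + t)) = fun t => deriv (radialProfile U) (r + t) :=
    funext fun t => deriv_comp_const_add _ _ _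
  rw [h1, h2, deriv_comp_const_add]
  simp only [add_zero]
  ring

end Radial

/-- The spatial density of the King model as a function of the local potential. -/
noncomputable def kingDensity (E₀ c : ℝ) : ℝ :=
  ∫ v : Space, max (Real.exp (E₀ - (‖v‖ ^ 2 / 2 + c)) - 1) 0

lemma kingDensity_integrable (E₀ c : ℝ) :
    Integrable (fun v : Space => max (Real.exp (E₀ - (‖v‖ ^ 2 / 2 + c)) - 1) 0) := by
  refine Continuous.integrable_of_hasCompactSupport (by fun_prop) ?_
  refine HasCompactSupport.intro (isCompact_closedBall 0 √(2 * |E₀ - c|)) fun v hv => ?_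
  simp only [Metric.mem_closedBall, dist_zero_right, not_le] at hv
  rw [max_eq_right]
  rw [sub_nonpos, Real.exp_le_one_iff]
  have h1 := (Real.sqrt_lt' ((Real.sqrt_nonneg _).trans_lt hv)).1 hv
  have := le_abs_self (E₀ - c)
  linarith

/-- A deeper potential well holds more matter. Since U₀ increases with the radius, the density
decreases outwards. -/
lemma kingDensity_antitone (E₀ : ℝ) : Antitone (kingDensity E₀) := by
  intro c d hcd
  refine integral_mono (kingDensity_integrable E₀ d) (kingDensity_integrable E₀ c) fun v => ?_
  refine max_le_max_right _ (sub_le_sub_right (Real.exp_le_exp.2 (by linarith)) 1)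

lemma kingDensity_nonneg (E₀ c : ℝ) : 0 ≤ kingDensity E₀ c :=
  integral_nonneg fun _ => le_max_right _ _

lemma spatialDensity_kingModel (E₀ : ℝ) (U₀ : Space → ℝ) (x : Space) :
    spatialDensity (kingModel E₀ U₀) x = kingDensity E₀ (U₀ x) := rfl

lemma kingModel_nonneg (E₀ : ℝ) (U₀ : Space → ℝ) (z : Phase) : 0 ≤ kingModel E₀ U₀ z :=
  le_max_right _ _

namespace IsKingPotential

variable {E₀ : ℝ} {U₀ : Space → ℝ} (hU : IsKingPotential E₀ U₀)
include hU

lemma eq_profile (x : Space) : U₀ x = radialProfile U₀ ‖x‖ := eq_radialProfile hU.radial x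

/-- By Gauss' law r²U₀' is the mass inside radius r; `deriv_mass_eq` identifies this derivative as
4πr²ρ₀. -/
lemma hasDerivAt_mass (r : ℝ) :
    HasDerivAt (fun r => r ^ 2 * deriv (radialProfile U₀) r)
      (2 * r * deriv (radialProfile U₀) r + r ^ 2 * deriv (deriv (radialProfile U₀)) r) r := by
  have h1 : HasDerivAt (fun r : ℝ => r ^ 2) (2 * r) r := by simpa using hasDerivAt_pow 2 r
  exact h1.mul (hasDerivAt_deriv_radialProfile hU.contDiff r)

lemma poisson_radial {r : ℝ} (hr : 0 < r) :
    deriv (deriv (radialProfile U₀)) r + 2 * (deriv (radialProfile U₀) r / r)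
      = 4 * Real.pi * kingDensity E₀ (radialProfile U₀ r) := by
  rw [← laplacian_radial hU.contDiff hU.radial hr, hU.poisson, spatialDensity_kingModel]
  rfl

lemma deriv_mass_eq {r : ℝ} (hr : 0 < r) :
    2 * r * deriv (radialProfile U₀) r + r ^ 2 * deriv (deriv (radialProfile U₀)) r
      = 4 * Real.pi * r ^ 2 * kingDensity E₀ (radialProfile U₀ r) := by
  have h := hU.poisson_radial hr
  have h2 : r ^ 2 * (deriv (deriv (radialProfile U₀)) r + 2 * (deriv (radialProfile U₀) r / r))
      = r ^ 2 * (4 * Real.pi * kingDensity E₀ (radialProfile U₀ r)) := by rw [h]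
  field_simp at h2
  linear_combination r * h2

/-- The mass function r²U₀' starts at 0 and has non-negative derivative. -/
lemma deriv_profile_nonneg {r : ℝ} (hr : 0 < r) : 0 ≤ deriv (radialProfile U₀) r := by
  have hmono : MonotoneOn (fun r => r ^ 2 * deriv (radialProfile U₀) r) (Ici 0) := by
    refine monotoneOn_of_deriv_nonneg (convex_Ici 0)
      (fun r _ => (hU.hasDerivAt_mass r).continuousAt.continuousWithinAt)
      (fun r _ => (hU.hasDerivAt_mass r).differentiableAt.differentiableWithinAt) fun s hs => ?_
    rw [interior_Ici] at hs
    rw [(hU.hasDerivAt_mass s).deriv, hU.deriv_mass_eq hs]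
    have := kingDensity_nonneg E₀ (radialProfile U₀ s)
    have := Real.pi_pos
    positivity
  have h := hmono (self_mem_Ici) (mem_Ici.2 hr.le) hr.le
  simp only [ne_eq, OfNat.ofNat_ne_zero, not_false_eq_true, zero_pow, zero_mul] at h
  exact nonneg_of_mul_nonneg_right h (by positivity)

lemma profile_monotoneOn : MonotoneOn (radialProfile U₀) (Ici 0) := by
  refine monotoneOn_of_deriv_nonneg (convex_Ici 0)
    (radialProfile_contDiff hU.contDiff).continuous.continuousOn
    ((radialProfile_contDiff hU.contDiff).differentiable (by norm_num)).differentiableOn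
    fun s hs => ?_
  rw [interior_Ici] at hs
  exact hU.deriv_profile_nonneg hs

lemma profile_tendsto : Tendsto (radialProfile U₀) atTop (𝓝 0) := by
  refine hU.tendsto_zero.comp ?_
  rw [← Metric.cobounded_eq_cocompact, ← tendsto_norm_atTop_iff_cobounded]
  simp only [norm_smul_axisVector]
  exact tendsto_abs_atTop_atTop

lemma profile_nonpos {r : ℝ} (hr : 0 ≤ r) : radialProfile U₀ r ≤ 0 := by
  refine ge_of_tendsto hU.profile_tendsto ?_
  filter_upwards [eventually_ge_atTop r] with s hs
  exact hU.profile_monotoneOn hr (hr.trans hs) hs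

lemma profile_zero_le {r : ℝ} (hr : 0 ≤ r) : radialProfile U₀ 0 ≤ radialProfile U₀ r :=
  hU.profile_monotoneOn self_mem_Ici hr hr

lemma potential_lower (x : Space) : radialProfile U₀ 0 ≤ U₀ x := by
  rw [hU.eq_profile x]; exact hU.profile_zero_le (norm_nonneg x)

lemma potential_nonpos (x : Space) : U₀ x ≤ 0 := by
  rw [hU.eq_profile x]; exact hU.profile_nonpos (norm_nonneg x)

/-- The mean density inside a ball is at least the density at its boundary. -/
lemma density_le_mean {r : ℝ} (hr : 0 < r) :
    4 * Real.pi / 3 * r ^ 3 * kingDensity E₀ (radialProfile U₀ r)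
      ≤ r ^ 2 * deriv (radialProfile U₀) r := by
  set k := kingDensity E₀ (radialProfile U₀ r)
  have hd : ∀ s, HasDerivAt (fun s => s ^ 2 * deriv (radialProfile U₀) s
      - 4 * Real.pi / 3 * s ^ 3 * k)
      (2 * s * deriv (radialProfile U₀) s + s ^ 2 * deriv (deriv (radialProfile U₀)) s
        - 4 * Real.pi / 3 * (3 * s ^ 2) * k) s := by
    intro s
    have h3 : HasDerivAt (fun s : ℝ => s ^ 3) (3 * s ^ 2) s := by simpa using hasDerivAt_pow 3 s
    exact (hU.hasDerivAt_mass s).sub ((h3.const_mul (4 * Real.pi / 3)).mul_const k)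
  have hmono : MonotoneOn (fun s => s ^ 2 * deriv (radialProfile U₀) s
      - 4 * Real.pi / 3 * s ^ 3 * k) (Icc 0 r) := by
    refine monotoneOn_of_deriv_nonneg (convex_Icc 0 r)
      (fun r _ => (hd r).continuousAt.continuousWithinAt)
      (fun r _ => (hd r).differentiableAt.differentiableWithinAt) fun s hs => ?_
    rw [interior_Icc] at hs
    rw [(hd s).deriv, hU.deriv_mass_eq hs.1]
    have h1 : k ≤ kingDensity E₀ (radialProfile U₀ s) :=
      kingDensity_antitone E₀ (hU.profile_monotoneOn hs.1.le hr.le hs.2.le)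
    have h2 : 0 ≤ 4 * Real.pi * s ^ 2 * (kingDensity E₀ (radialProfile U₀ s) - k) :=
      mul_nonneg (by have := Real.pi_pos; positivity) (by linarith)
    linarith
  have h := hmono (left_mem_Icc.2 hr.le) (right_mem_Icc.2 hr.le) hr.le
  simp only [ne_eq, OfNat.ofNat_ne_zero, not_false_eq_true, zero_pow, zero_mul, mul_zero,
    sub_zero] at h
  linarith

/-- The lower bound behind Antonov's coercivity estimate. -/
lemma antonov_weight {r : ℝ} (hr : 0 < r) :
    16 * Real.pi / 3 * kingDensity E₀ (radialProfile U₀ r)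
      ≤ deriv (deriv (radialProfile U₀)) r + 3 * (deriv (radialProfile U₀) r / r) := by
  -- The Poisson equation turns the right side into 4πρ₀ + U₀'/r, and the mean density bound gives
  -- U₀'/r ≥ (4π/3)ρ₀. This gain is decisive: with 4πρ₀ alone the leading cost would be exactly N/2,
  -- leaving no margin.
  have h1 := hU.poisson_radial hr
  have h2 := hU.density_le_mean hr
  have h3 : 4 * Real.pi / 3 * kingDensity E₀ (radialProfile U₀ r)
      ≤ deriv (radialProfile U₀) r / r := by
    rw [le_div_iff₀ hr]
    have hr2 : 0 < r ^ 2 := by positivity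
    refine le_of_mul_le_mul_left ?_ hr2
    linarith
  linarith

lemma exists_radius {c : ℝ} (hc : c < 0) :
    ∃ R : ℝ, 0 < R ∧ ∀ r, R ≤ r → c < radialProfile U₀ r := by
  have h := hU.profile_tendsto.eventually (lt_mem_nhds hc)
  obtain ⟨R, hR⟩ := eventually_atTop.1 h
  exact ⟨max R 1, by positivity, fun r hr => hR r ((le_max_left _ _).trans hr)⟩

lemma kingModel_continuous : Continuous (kingModel E₀ U₀) := by
  have := hU.contDiff.continuous
  unfold kingModel particleEnergy
  fun_prop

lemma kingModel_hasCompactSupport : HasCompactSupport (kingModel E₀ U₀) := by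
  obtain ⟨R, hR, hRU⟩ := hU.exists_radius hU.cutoff_neg
  set c := radialProfile U₀ 0
  refine HasCompactSupport.intro ((isCompact_closedBall (0 : Space) R).prod
    (isCompact_closedBall (0 : Space) √(2 * |E₀ - c|))) fun z hz => ?_
  simp only [mem_prod, Metric.mem_closedBall, dist_zero_right, not_and_or, not_le] at hz
  unfold kingModel particleEnergy
  rw [max_eq_right]
  rw [sub_nonpos, Real.exp_le_one_iff]
  rcases hz with hz | hz
  · have h1 := hRU _ hz.le
    rw [← hU.eq_profile] at h1
    have := sq_nonneg ‖z.2‖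
    linarith
  · have h1 := (Real.sqrt_lt' ((Real.sqrt_nonneg _).trans_lt hz)).1 hz
    have := le_abs_self (E₀ - c)
    have := hU.potential_lower z.1
    linarith

lemma kingModel_integrable : Integrable (kingModel E₀ U₀) :=
  hU.kingModel_continuous.integrable_of_hasCompactSupport hU.kingModel_hasCompactSupport

lemma kingModel_mul_integrable {g : Phase → ℝ} (hg : Continuous g) :
    Integrable (fun z => g z * kingModel E₀ U₀ z) :=
  (hg.mul hU.kingModel_continuous).integrable_of_hasCompactSupport
    hU.kingModel_hasCompactSupport.mul_left

lemma kingModel_symmetric : IsSphericallySymmetric (kingModel E₀ U₀) := by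
  intro A _
  refine ae_of_all _ fun z => ?_
  unfold kingModel particleEnergy
  rw [A.norm_map, hU.radial (A z.1) z.1 (A.norm_map _)]

lemma kingModel_le (z : Phase) :
    kingModel E₀ U₀ z ≤ max (Real.exp (E₀ - radialProfile U₀ 0) - 1) 0 := by
  refine max_le_max_right _ (sub_le_sub_right (Real.exp_le_exp.2 ?_) 1)
  have := hU.potential_lower z.1
  have := sq_nonneg ‖z.2‖
  unfold particleEnergy
  linarith

/-- Both sides are ∫₀^r 4πs²ρ₀ ds, one by polar coordinates and the other by the fundamental theorem
of calculus. -/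
lemma massIn_kingModel {r : ℝ} (hr : 0 < r) :
    massIn (kingModel E₀ U₀) r = r ^ 2 * deriv (radialProfile U₀) r := by
  have hc : Continuous (fun s : ℝ => 2 * s * deriv (radialProfile U₀) s
      + s ^ 2 * deriv (deriv (radialProfile U₀)) s) := by
    have := (contDiff_deriv_radialProfile hU.contDiff).continuous
    have := continuous_deriv_deriv_radialProfile hU.contDiff
    fun_prop
  have hftc := intervalIntegral.integral_eq_sub_of_hasDerivAt (a := 0) (b := r)
    (fun s _ => hU.hasDerivAt_mass s) (hc.intervalIntegrable _ _)
  simp only [ne_eq, OfNat.ofNat_ne_zero, not_false_eq_true, zero_pow, zero_mul, sub_zero] at hftc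
  rw [← hftc, intervalIntegral.integral_of_le hr.le, integral_Ioc_eq_integral_Ioo, massIn,
    ← integral_indicator measurableSet_ball]
  have h1 : (Metric.ball (0 : Space) r).indicator (spatialDensity (kingModel E₀ U₀)) =
      fun x => (Iio r).indicator (fun s => kingDensity E₀ (radialProfile U₀ s)) ‖x‖ := by
    ext x
    simp only [indicator, Metric.mem_ball, dist_zero_right, mem_Iio, spatialDensity_kingModel]
    rw [hU.eq_profile]
  rw [h1, integral_fun_norm_addHaar volume
    ((Iio r).indicator (fun s => kingDensity E₀ (radialProfile U₀ s)))]
  have hvol : (volume : Measure Space).real (Metric.ball 0 1) = Real.pi * 4 / 3 := by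
    rw [Measure.real, EuclideanSpace.volume_ball_fin_three]
    simp only [ENNReal.ofReal_one, one_pow, one_mul]
    exact ENNReal.toReal_ofReal (by have := Real.pi_pos; positivity)
  rw [hvol, finrank_euclideanSpace, Fintype.card_fin, ← integral_indicator measurableSet_Ioi,
    ← integral_indicator measurableSet_Ioo, nsmul_eq_mul, smul_eq_mul, ← mul_assoc,
    ← integral_const_mul]
  refine integral_congr_ae (ae_of_all _ fun s => ?_)
  simp only [indicator, mem_Ioi, mem_Iio, mem_Ioo, smul_eq_mul]
  by_cases hs : 0 < s
  · rw [hU.deriv_mass_eq hs]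
    by_cases hsr : s < r
    · simp only [hs, hsr, if_true, and_self]
      push_cast
      ring
    · simp [hs, hsr]
  · simp [hs]

/-- The form is that of `gradient_potential`, so the difference of the two fields depends on the
mass difference alone. -/
lemma gradient_eq {x : Space} (hx : x ≠ 0) :
    gradient U₀ x = (massIn (kingModel E₀ U₀) ‖x‖ / ‖x‖ ^ 3) • x := by
  have hr : 0 < ‖x‖ := norm_pos_iff.2 hx
  rw [(hasGradientAt_radial hx (hasDerivAt_radialProfile hU.contDiff ‖x‖)
    fun y _ => hU.eq_profile y).gradient, hU.massIn_kingModel hr]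
  congr 1
  field_simp

/-- A monotone function with a finite limit has an integrable derivative; this uses the
normalization of U₀ at infinity. -/
lemma integral_deriv_profile {r : ℝ} (hr : 0 ≤ r) :
    IntegrableOn (deriv (radialProfile U₀)) (Ioi r) ∧
      radialProfile U₀ r = -∫ s in Ioi r, deriv (radialProfile U₀) s := by
  have hd : ∀ s ∈ Ici r, HasDerivAt (radialProfile U₀) (deriv (radialProfile U₀) s) s :=
    fun s _ => hasDerivAt_radialProfile hU.contDiff s
  have hpos : ∀ s ∈ Ioi r, 0 ≤ deriv (radialProfile U₀) s :=
    fun s hs => hU.deriv_profile_nonneg (hr.trans_lt hs)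
  refine ⟨integrableOn_Ioi_deriv_of_nonneg' hd hpos hU.profile_tendsto, ?_⟩
  rw [integral_Ioi_of_hasDerivAt_of_nonneg' hd hpos hU.profile_tendsto]
  ring

end IsKingPotential

/-! ### A weighted Poincaré inequality -/

section Variance

variable {μ : Measure ℝ} [IsFiniteMeasure μ]

lemma integrable_of_abs_le {ψ : ℝ → ℝ} (hψ : Measurable ψ) {K : ℝ} (hK : ∀ r, |ψ r| ≤ K) :
    Integrable ψ μ :=
  Integrable.of_bound hψ.aestronglyMeasurable K (ae_of_all _ hK)

lemma integrable_sq_of_abs_le {ψ : ℝ → ℝ} (hψ : Measurable ψ) {K : ℝ} (hK : ∀ r, |ψ r| ≤ K) :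
    Integrable (fun r => ψ r ^ 2) μ := by
  refine integrable_of_abs_le (hψ.pow_const 2) (K := K ^ 2) fun r => ?_
  rw [abs_pow]
  exact pow_le_pow_left₀ (abs_nonneg _) (hK r) 2

/-- The variance as a double integral. -/
lemma lintegral_variance {ψ : ℝ → ℝ} (hψ : Measurable ψ) {K : ℝ} (hK : ∀ r, |ψ r| ≤ K)
    (hμ : 0 < μ.real univ) :
    ENNReal.ofReal (2 * μ.real univ) *
        ∫⁻ r, ENNReal.ofReal ((ψ r - (∫ s, ψ s ∂μ) / μ.real univ) ^ 2) ∂μ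
      = ∫⁻ r, ∫⁻ s, ENNReal.ofReal ((ψ r - ψ s) ^ 2) ∂μ ∂μ := by
  set m := μ.real univ
  have hi := integrable_of_abs_le (μ := μ) hψ hK
  have hi2 := integrable_sq_of_abs_le (μ := μ) hψ hK
  set P := ∫ s, ψ s ∂μ with hP
  set P2 := ∫ s, ψ s ^ 2 ∂μ with hP2
  have hsq : ∀ c : ℝ, Integrable (fun r => (ψ r - c) ^ 2) μ ∧
      ∫ r, (ψ r - c) ^ 2 ∂μ = P2 - 2 * c * P + c ^ 2 * m := by
    intro c
    have he : (fun r => (ψ r - c) ^ 2) = fun r => (ψ r ^ 2 - 2 * c * ψ r) + c ^ 2 := by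
      ext r; ring
    rw [he]
    have h1 : Integrable (fun r => ψ r ^ 2 - 2 * c * ψ r) μ := hi2.sub (hi.const_mul _)
    refine ⟨h1.add (integrable_const _), ?_⟩
    rw [integral_add h1 (integrable_const _), integral_sub hi2 (hi.const_mul _),
      integral_const_mul, integral_const]
    simp only [smul_eq_mul, ← hP, ← hP2]
    ring
  have hinner : ∀ r, ∫⁻ s, ENNReal.ofReal ((ψ r - ψ s) ^ 2) ∂μ
      = ENNReal.ofReal (P2 - 2 * ψ r * P + ψ r ^ 2 * m) := by
    intro r
    rw [← (hsq (ψ r)).2, ofReal_integral_eq_lintegral_ofReal (hsq (ψ r)).1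
      (ae_of_all _ fun s => sq_nonneg _)]
    refine lintegral_congr fun s => ?_
    rw [← neg_sub, neg_sq]
  simp only [hinner]
  have hi3 : Integrable (fun r => P2 - 2 * ψ r * P) μ :=
    (integrable_const _).sub ((hi.const_mul 2).mul_const P)
  have hi4 : Integrable (fun r => P2 - 2 * ψ r * P + ψ r ^ 2 * m) μ := hi3.add (hi2.mul_const m)
  have hnn : ∀ r, 0 ≤ P2 - 2 * ψ r * P + ψ r ^ 2 * m := fun r => by
    rw [← (hsq (ψ r)).2]
    exact integral_nonneg fun s => sq_nonneg _
  rw [← ofReal_integral_eq_lintegral_ofReal (hsq (P / m)).1 (ae_of_all _ fun s => sq_nonneg _),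
    ← ofReal_integral_eq_lintegral_ofReal hi4 (ae_of_all _ hnn),
    ← ENNReal.ofReal_mul (by positivity), (hsq (P / m)).2]
  congr 1
  rw [integral_add hi3 (hi2.mul_const m), integral_sub (integrable_const _)
    ((hi.const_mul 2).mul_const P), integral_mul_const, integral_mul_const, integral_const_mul,
    integral_const, ← hP, ← hP2]
  simp only [smul_eq_mul]
  field_simp
  ring

/-- A weighted Poincaré inequality on an interval, for a measure with a monotone reference
function `b`. -/
lemma lintegral_variance_le [NullSingletonClass μ] {ψ b a : ℝ → ℝ} {q : ℝ → ℝ≥0∞} (hψ : Measurable ψ) {K : ℝ}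
    (hK : ∀ r, |ψ r| ≤ K) (hμ : 0 < μ.real univ) {r₁ r₂ : ℝ} (hS : ∀ᵐ r ∂μ, r ∈ Ioo r₁ r₂)
    (hb : Measurable b) (hbi : Integrable b μ) (hbm : MonotoneOn b (Ioo r₁ r₂)) (hq : Measurable q)
    (hψb : ∀ s ∈ Ioo r₁ r₂, ∀ r ∈ Ioo r₁ r₂, s < r →
      ENNReal.ofReal ((ψ r - ψ s) ^ 2) ≤ (∫⁻ t in Ioo s r, q t) * ENNReal.ofReal (b r - b s))
    (ha : ∀ t ∈ Ioo r₁ r₂, ∫ r in Ioi t, b r ∂μ = a t)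
    (ha' : ∀ t ∈ Ioo r₁ r₂, ∫ r in Iio t, b r ∂μ = -a t) :
    ∫⁻ r, ENNReal.ofReal ((ψ r - (∫ s, ψ s ∂μ) / μ.real univ) ^ 2) ∂μ
      ≤ ∫⁻ t in Ioo r₁ r₂, q t * ENNReal.ofReal (a t) := by
  set m := μ.real univ with hm
  set D : ℝ → ℝ → ℝ≥0∞ := fun r s => ENNReal.ofReal ((ψ r - ψ s) ^ 2)
  have hDm : Measurable (Function.uncurry D) := by
    simp only [D, Function.uncurry_def]
    fun_prop
  -- The double integral for the variance is symmetric, so half of it, over s < r, suffices.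
  set T : ℝ × ℝ → ℝ≥0∞ := {p : ℝ × ℝ | p.2 < p.1}.indicator (fun p => D p.1 p.2)
  have hTm : Measurable T := hDm.indicator (measurableSet_lt measurable_snd measurable_fst)
  have hsplit : ∫⁻ r, ∫⁻ s, D r s ∂μ ∂μ = 2 * ∫⁻ r, ∫⁻ s, T (r, s) ∂μ ∂μ := by
    have h1 : ∀ r s, D r s = T (r, s) + T (s, r) := by
      intro r s
      simp only [T, indicator, mem_ofPred_eq]
      rcases lt_trichotomy r s with h | h | h
      · simp only [h, h.not_gt, if_true, if_false, zero_add, D]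
        rw [← neg_sub, neg_sq]
      · simp [h, D]
      · simp only [h, h.not_gt, if_true, if_false, add_zero]
    simp only [h1]
    have h2 : ∀ r, ∫⁻ s, T (r, s) + T (s, r) ∂μ = (∫⁻ s, T (r, s) ∂μ) + ∫⁻ s, T (s, r) ∂μ :=
      fun r => lintegral_add_left (by fun_prop) _
    simp only [h2]
    rw [lintegral_add_left hTm.lintegral_prod_right',
      lintegral_lintegral_swap (f := fun r s => T (s, r)) (by
        exact (hTm.comp measurable_swap).aemeasurable)]
    ring
  -- The bound for each pair s < r is spread over the intermediate points t, so that Fubini can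
  -- integrate over the pairs first.
  set Q : ℝ → ℝ → ℝ → ℝ≥0∞ := fun t r s =>
    {p : ℝ × ℝ × ℝ | p.2.2 < p.1 ∧ p.1 < p.2.1}.indicator
      (fun p => q p.1 * ENNReal.ofReal (b p.2.1 - b p.2.2)) (t, r, s)
  have hQm : Measurable (fun p : ℝ × ℝ × ℝ => Q p.1 p.2.1 p.2.2) := by
    have hset : MeasurableSet {p : ℝ × ℝ × ℝ | p.2.2 < p.1 ∧ p.1 < p.2.1} :=
      (measurableSet_lt (f := fun p : ℝ × ℝ × ℝ => p.2.2) (by fun_prop) (by fun_prop)).inter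
        (measurableSet_lt (f := fun p : ℝ × ℝ × ℝ => p.1) (by fun_prop) (by fun_prop))
    exact Measurable.indicator (by fun_prop) hset
  have hT : ∀ r ∈ Ioo r₁ r₂, ∀ s ∈ Ioo r₁ r₂, T (r, s) ≤ ∫⁻ t in Ioo r₁ r₂, Q t r s := by
    intro r hr s hs
    by_cases hsr : s < r
    · have h1 : T (r, s) = D r s := indicator_of_mem (by exact hsr) _
      rw [h1]
      refine (hψb s hs r hr hsr).trans ?_
      rw [← lintegral_mul_const _ hq, ← lintegral_indicator measurableSet_Ioo,
        ← lintegral_indicator measurableSet_Ioo]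
      refine lintegral_mono fun t => ?_
      simp only [indicator, Q, mem_Ioo, mem_ofPred_eq]
      by_cases ht : s < t ∧ t < r
      · simp [ht, hs.1.trans ht.1, ht.2.trans hr.2]
      · simp [ht]
    · have h1 : T (r, s) = 0 := indicator_of_notMem (by exact hsr) _
      rw [h1]
      exact zero_le
  -- Integrating b(r) - b(s) over s < t < r gives a(t) μ(s < t) + a(t) μ(r > t), by the two formulas
  -- for the partial integrals of b. Since t is not an atom this is a(t) times the total mass.
  have hinner : ∀ t ∈ Ioo r₁ r₂, ∫⁻ r, ∫⁻ s, Q t r s ∂μ ∂μ = q t * ENNReal.ofReal (m * a t) := by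
    intro t ht
    have h1 : ∀ r, ∫⁻ s, Q t r s ∂μ = (Ioi t).indicator
        (fun r => q t * ∫⁻ s in Iio t, ENNReal.ofReal (b r - b s) ∂μ) r := by
      intro r
      by_cases hr : t < r
      · rw [indicator_of_mem (by exact hr), ← lintegral_const_mul _ (by fun_prop),
          ← lintegral_indicator measurableSet_Iio]
        refine lintegral_congr fun s => ?_
        simp only [Q, indicator, mem_ofPred_eq, hr, and_true, mem_Iio]
      · rw [indicator_of_notMem (by exact hr)]
        refine (lintegral_congr fun s => ?_).trans (lintegral_zero (μ := μ))
        refine indicator_of_notMem ?_ _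
        rintro ⟨_, h⟩
        exact hr h
    simp only [h1]
    rw [lintegral_indicator measurableSet_Ioi, lintegral_const_mul]
    swap
    · exact Measurable.lintegral_prod_right' (ν := μ.restrict (Iio t))
        (f := fun p : ℝ × ℝ => ENNReal.ofReal (b p.1 - b p.2)) (by fun_prop)
    congr 1
    have hS1 : ∀ᵐ r ∂(μ.restrict (Ioi t)), r ∈ Ioo r₁ r₂ ∧ t < r :=
      (ae_restrict_of_ae hS).and (ae_restrict_mem measurableSet_Ioi)
    have hS2 : ∀ᵐ s ∂(μ.restrict (Iio t)), s ∈ Ioo r₁ r₂ ∧ s < t :=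
      (ae_restrict_of_ae hS).and (ae_restrict_mem measurableSet_Iio)
    have hbm' : ∀ r, r ∈ Ioo r₁ r₂ ∧ t < r → ∀ s, s ∈ Ioo r₁ r₂ ∧ s < t → 0 ≤ b r - b s :=
      fun r hr s hs => sub_nonneg.2 (hbm hs.1 hr.1 (hs.2.trans hr.2).le)
    set mm := μ.real (Iio t)
    set mp := μ.real (Ioi t)
    have h2 : ∀ r, r ∈ Ioo r₁ r₂ ∧ t < r → ∫⁻ s in Iio t, ENNReal.ofReal (b r - b s) ∂μ
        = ENNReal.ofReal (b r * mm + a t) := by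
      intro r hr
      have hi : Integrable (fun s => b r - b s) (μ.restrict (Iio t)) :=
        (integrable_const _).sub hbi.restrict
      rw [← ofReal_integral_eq_lintegral_ofReal hi
        (hS2.mono fun s hs => hbm' r hr s hs), integral_sub (integrable_const _) hbi.restrict,
        ha' t ht, integral_const]
      congr 1
      simp only [measureReal_restrict_apply_univ, smul_eq_mul, mm]
      ring
    rw [lintegral_congr_ae (hS1.mono h2)]
    have hint : Integrable (fun r => b r * mm + a t) (μ.restrict (Ioi t)) :=
      (hbi.restrict.mul_const _).add (integrable_const _)
    rw [← ofReal_integral_eq_lintegral_ofReal hint, integral_add (hbi.restrict.mul_const _)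
      (integrable_const _), integral_mul_const, ha t ht, integral_const]
    · congr 1
      have hsum : m = mm + mp := by
        rw [hm, ← measureReal_add_measureReal_compl (μ := μ) (measurableSet_Iio (a := t)),
          compl_Iio, measureReal_congr (Ioi_ae_eq_Ici (μ := μ) (a := t)).symm]
      simp only [measureReal_restrict_apply_univ, smul_eq_mul]
      rw [hsum]
      ring
    · refine hS1.mono fun r hr => ?_
      have h4 : b r * mm + a t = ∫ s in Iio t, (b r - b s) ∂μ := by
        rw [integral_sub (integrable_const _) hbi.restrict, ha' t ht, integral_const]
        simp only [measureReal_restrict_apply_univ, smul_eq_mul, mm]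
        ring
      simp only [Pi.zero_apply, h4]
      exact integral_nonneg_of_ae (hS2.mono fun s hs => hbm' r hr s hs)
  have hmain : ∫⁻ r, ∫⁻ s, T (r, s) ∂μ ∂μ
      ≤ ENNReal.ofReal m * ∫⁻ t in Ioo r₁ r₂, q t * ENNReal.ofReal (a t) := by
    calc ∫⁻ r, ∫⁻ s, T (r, s) ∂μ ∂μ
        ≤ ∫⁻ r, ∫⁻ s, (∫⁻ t in Ioo r₁ r₂, Q t r s) ∂μ ∂μ := by
          refine lintegral_mono_ae (hS.mono fun r hr => ?_)
          exact lintegral_mono_ae (hS.mono fun s hs => hT r hr s hs)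
      _ = ∫⁻ r, (∫⁻ t in Ioo r₁ r₂, ∫⁻ s, Q t r s ∂μ) ∂μ := by
          refine lintegral_congr fun r => ?_
          refine lintegral_lintegral_swap (f := fun s t => Q t r s) ?_
          exact (hQm.comp (f := fun p : ℝ × ℝ => (p.2, r, p.1)) (by fun_prop)).aemeasurable
      _ = ∫⁻ t in Ioo r₁ r₂, ∫⁻ r, ∫⁻ s, Q t r s ∂μ ∂μ := by
          refine lintegral_lintegral_swap (f := fun r t => ∫⁻ s, Q t r s ∂μ) ?_
          refine Measurable.aemeasurable ?_
          exact Measurable.lintegral_prod_right' (f := fun p : (ℝ × ℝ) × ℝ => Q p.1.2 p.1.1 p.2)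
            (hQm.comp (f := fun p : (ℝ × ℝ) × ℝ => (p.1.2, p.1.1, p.2)) (by fun_prop))
      _ = ∫⁻ t in Ioo r₁ r₂, ENNReal.ofReal m * (q t * ENNReal.ofReal (a t)) := by
          refine setLIntegral_congr_fun measurableSet_Ioo fun t ht => ?_
          rw [hinner t ht, ENNReal.ofReal_mul hμ.le]
          ring
      _ = _ := lintegral_const_mul' _ _ ENNReal.ofReal_ne_top
  have hvar := lintegral_variance (μ := μ) hψ hK hμ
  rw [show (∫⁻ r, ∫⁻ s, ENNReal.ofReal ((ψ r - ψ s) ^ 2) ∂μ ∂μ) = ∫⁻ r, ∫⁻ s, D r s ∂μ ∂μ from rfl,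
    hsplit, ← hm, ENNReal.ofReal_mul (by norm_num), show ENNReal.ofReal 2 = 2 by norm_num,
    mul_assoc, ENNReal.mul_right_inj (by norm_num) (by norm_num)] at hvar
  rw [← hvar] at hmain
  exact (ENNReal.mul_le_mul_iff_right (by simpa using hμ) ENNReal.ofReal_ne_top).1 hmain

end Variance

/-- Cauchy–Schwarz for |χ| = (|χ|/√β) √β, with ∫ β = b(r) - b(s). Integrability of β is automatic,
as it is the positive derivative of a function continuous up to the ends. -/
lemma sq_le_lintegral_mul {ψ χ b β : ℝ → ℝ} {s r : ℝ} (hsr : s < r) (hχ : Measurable χ)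
    (hβm : Measurable β) (hb : ContinuousOn b (Icc s r))
    (hbd : ∀ t ∈ Ioo s r, HasDerivAt b (β t) t) (hβ : ∀ t ∈ Ioo s r, 0 < β t)
    (hψ : ENNReal.ofReal |ψ r - ψ s| ≤ ∫⁻ t in Ioo s r, ENNReal.ofReal |χ t|) :
    ENNReal.ofReal ((ψ r - ψ s) ^ 2)
      ≤ (∫⁻ t in Ioo s r, ENNReal.ofReal (χ t ^ 2 / β t)) * ENNReal.ofReal (b r - b s) := by
  have hβi : IntegrableOn β (Ioo s r) :=
    (integrableOn_Ioc_iff_integrableOn_Ioo).1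
      (intervalIntegral.integrableOn_deriv_of_nonneg hb hbd fun t ht => (hβ t ht).le)
  have hftc : ∫⁻ t in Ioo s r, ENNReal.ofReal (β t) = ENNReal.ofReal (b r - b s) := by
    rw [← ofReal_integral_eq_lintegral_ofReal hβi
      (ae_restrict_of_forall_mem measurableSet_Ioo fun t ht => (hβ t ht).le),
      ← integral_Ioc_eq_integral_Ioo, ← intervalIntegral.integral_of_le hsr.le,
      intervalIntegral.integral_eq_sub_of_hasDerivAt_of_le hsr.le hb hbd
        ((intervalIntegrable_iff_integrableOn_Ioo_of_le hsr.le).2 hβi)]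
  have hcs := ENNReal.lintegral_mul_le_Lp_mul_Lq (volume.restrict (Ioo s r))
    (p := 2) (q := 2) (by constructor <;> norm_num)
    (f := fun t => ENNReal.ofReal (|χ t| / √(β t))) (g := fun t => ENNReal.ofReal √(β t))
    (by fun_prop) (by fun_prop)
  have h1 : ∫⁻ t in Ioo s r, ENNReal.ofReal |χ t| = ∫⁻ t in Ioo s r,
      ((fun t => ENNReal.ofReal (|χ t| / √(β t))) * fun t => ENNReal.ofReal √(β t)) t := by
    refine setLIntegral_congr_fun measurableSet_Ioo fun t ht => ?_
    have := Real.sqrt_pos.2 (hβ t ht)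
    simp only [Pi.mul_apply]
    rw [← ENNReal.ofReal_mul (by positivity), div_mul_cancel₀ _ this.ne']
  have h2 : ∫⁻ t in Ioo s r, ENNReal.ofReal (|χ t| / √(β t)) ^ (2 : ℝ)
      = ∫⁻ t in Ioo s r, ENNReal.ofReal (χ t ^ 2 / β t) := by
    refine setLIntegral_congr_fun measurableSet_Ioo fun t ht => ?_
    rw [ENNReal.rpow_two, ← ENNReal.ofReal_pow (by positivity), div_pow, sq_abs,
      Real.sq_sqrt (hβ t ht).le]
  have h3 : ∫⁻ t in Ioo s r, ENNReal.ofReal √(β t) ^ (2 : ℝ)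
      = ∫⁻ t in Ioo s r, ENNReal.ofReal (β t) := by
    refine setLIntegral_congr_fun measurableSet_Ioo fun t ht => ?_
    rw [ENNReal.rpow_two, ← ENNReal.ofReal_pow (by positivity), Real.sq_sqrt (hβ t ht).le]
  rw [← h1, h2, h3, hftc] at hcs
  have h4 := pow_le_pow_left' (hψ.trans hcs) 2
  rw [← ENNReal.ofReal_pow (abs_nonneg _), sq_abs, mul_pow, ← ENNReal.rpow_mul_natCast,
    ← ENNReal.rpow_mul_natCast] at h4
  simpa using h4

/-- The weighted Poincaré inequality for an orbit: `k` is the time density, `a' = -b k`, and `b`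
is increasing. -/
lemma orbit_poincare {r₁ r₂ : ℝ} (h12 : r₁ < r₂) {a b β k ψ χ : ℝ → ℝ}
    (ha : ContinuousOn a (Icc r₁ r₂)) (ha1 : a r₁ = 0) (ha2 : a r₂ = 0)
    (had : ∀ t ∈ Ioo r₁ r₂, HasDerivAt a (-(b t * k t)) t)
    (hbm : Measurable b) (hb : ContinuousOn b (Icc r₁ r₂))
    (hbd : ∀ t ∈ Ioo r₁ r₂, HasDerivAt b (β t) t) (hβm : Measurable β)
    (hβ : ∀ t ∈ Ioo r₁ r₂, 0 < β t) (hkm : Measurable k) (hk : ∀ t ∈ Ioo r₁ r₂, 0 < k t)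
    (hki : IntegrableOn k (Ioo r₁ r₂)) (hψm : Measurable ψ) {K : ℝ} (hK : ∀ r, |ψ r| ≤ K)
    (hχ : Measurable χ)
    (hψ : ∀ s ∈ Ioo r₁ r₂, ∀ r ∈ Ioo r₁ r₂, s < r →
      ENNReal.ofReal |ψ r - ψ s| ≤ ∫⁻ t in Ioo s r, ENNReal.ofReal |χ t|) :
    ∫⁻ r in Ioo r₁ r₂, ENNReal.ofReal ((ψ r - (∫ s in Ioo r₁ r₂, ψ s * k s)
        / ∫ s in Ioo r₁ r₂, k s) ^ 2 * k r)
      ≤ ∫⁻ t in Ioo r₁ r₂, ENNReal.ofReal (χ t ^ 2 / β t * a t) := by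
  set ν := volume.restrict (Ioo r₁ r₂)
  set μ := ν.withDensity fun t => ENNReal.ofReal (k t)
  have hkν : ∀ᵐ t ∂ν, t ∈ Ioo r₁ r₂ := ae_restrict_mem measurableSet_Ioo
  have hS : ∀ᵐ t ∂μ, t ∈ Ioo r₁ r₂ := withDensity_absolutelyContinuous ν _ |>.ae_le hkν
  have hfin : IsFiniteMeasure μ := isFiniteMeasure_withDensity_ofReal hki.2
  have hk0 : ∀ᵐ t ∂ν, 0 ≤ k t := hkν.mono fun t ht => (hk t ht).le
  have hkpos : 0 < ∫ s in Ioo r₁ r₂, k s := by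
    rw [setIntegral_pos_iff_support_of_nonneg_ae hk0 hki]
    have : Ioo r₁ r₂ ⊆ Function.support k ∩ Ioo r₁ r₂ := fun t ht => ⟨(hk t ht).ne', ht⟩
    exact lt_of_lt_of_le (by simpa using h12) (measure_mono this)
  have hint : ∀ (g : ℝ → ℝ) (S : Set ℝ), MeasurableSet S →
      ∫ t in S, g t ∂μ = ∫ t in S ∩ Ioo r₁ r₂, g t * k t := by
    intro g S hS
    simp only [μ]
    rw [setIntegral_withDensity_eq_setIntegral_toReal_smul (by fun_prop)
      (ae_of_all _ fun _ => ENNReal.ofReal_lt_top) _ hS, Measure.restrict_restrict hS]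
    refine setIntegral_congr_fun (hS.inter measurableSet_Ioo) fun t ht => ?_
    simp only [smul_eq_mul]
    rw [ENNReal.toReal_ofReal (hk t ht.2).le, mul_comm]
  have hmass : μ.real univ = ∫ s in Ioo r₁ r₂, k s := by
    have h1 := hint (fun _ => 1) univ MeasurableSet.univ
    simpa using h1
  have hmean : ∫ s, ψ s ∂μ = ∫ s in Ioo r₁ r₂, ψ s * k s := by
    have h1 := hint ψ univ MeasurableSet.univ
    simpa using h1
  obtain ⟨Kb, hKb⟩ := isCompact_Icc.exists_bound_of_continuousOn hb
  have hbi : Integrable b μ := Integrable.of_bound hbm.aestronglyMeasurable Kb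
    (hS.mono fun t ht => hKb t (Ioo_subset_Icc_self ht))
  have hbk : IntegrableOn (fun t => b t * k t) (Ioo r₁ r₂) := by
    refine Integrable.bdd_mul (c := Kb) hki hbm.aestronglyMeasurable ?_
    exact hkν.mono fun t ht => hKb t (Ioo_subset_Icc_self ht)
  have hmono : MonotoneOn b (Ioo r₁ r₂) := by
    refine monotoneOn_of_deriv_nonneg (convex_Ioo r₁ r₂) (hb.mono Ioo_subset_Icc_self)
      (fun t ht => ?_) fun t ht => ?_
    · rw [interior_Ioo] at ht
      exact (hbd t ht).differentiableAt.differentiableWithinAt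
    · rw [interior_Ioo] at ht
      rw [(hbd t ht).deriv]
      exact (hβ t ht).le
  -- Since a' = -bk and a vanishes at both ends, the integral of b against k dt is a(t) to the right
  -- of t and -a(t) to the left.
  have hftc : ∀ s ∈ Icc r₁ r₂, ∀ r ∈ Icc r₁ r₂, s ≤ r →
      ∫ t in Ioo s r, b t * k t = a s - a r := by
    intro s hs r hr hsr
    have hsub : Ioo s r ⊆ Ioo r₁ r₂ := Ioo_subset_Ioo hs.1 hr.2
    have h1 := intervalIntegral.integral_eq_sub_of_hasDerivAt_of_le hsr
      (ha.mono (Icc_subset_Icc hs.1 hr.2)) (fun t ht => had t (hsub ht))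
      ((intervalIntegrable_iff_integrableOn_Ioo_of_le hsr).2 (hbk.mono_set hsub).neg)
    rw [intervalIntegral.integral_neg, intervalIntegral.integral_of_le hsr,
      integral_Ioc_eq_integral_Ioo] at h1
    linarith
  have key := lintegral_variance_le (μ := μ) (a := a) (b := b)
    (q := fun t => ENNReal.ofReal (χ t ^ 2 / β t)) hψm hK (by rw [hmass]; exact hkpos) hS hbm hbi
    hmono (by fun_prop)
    (fun s hs r hr hsr => sq_le_lintegral_mul hsr hχ hβm
      (hb.mono (Icc_subset_Icc hs.1.le hr.2.le))
      (fun t ht => hbd t (Ioo_subset_Ioo hs.1.le hr.2.le ht))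
      (fun t ht => hβ t (Ioo_subset_Ioo hs.1.le hr.2.le ht)) (hψ s hs r hr hsr))
    (fun t ht => by
      rw [hint b _ measurableSet_Ioi, show Ioi t ∩ Ioo r₁ r₂ = Ioo t r₂ by
        ext x; simp only [mem_inter_iff, mem_Ioi, mem_Ioo]
        exact ⟨fun h => ⟨h.1, h.2.2⟩, fun h => ⟨h.1, ht.1.trans h.1, h.2⟩⟩,
        hftc t (Ioo_subset_Icc_self ht) r₂ (right_mem_Icc.2 h12.le) ht.2.le, ha2, sub_zero])
    (fun t ht => by
      rw [hint b _ measurableSet_Iio, show Iio t ∩ Ioo r₁ r₂ = Ioo r₁ t by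
        ext x; simp only [mem_inter_iff, mem_Iio, mem_Ioo]
        exact ⟨fun h => ⟨h.2.1, h.1⟩, fun h => ⟨h.2, h.1, h.2.trans ht.2⟩⟩,
        hftc r₁ (left_mem_Icc.2 h12.le) t (Ioo_subset_Icc_self ht) ht.1.le, ha1, zero_sub])
  rw [hmass, hmean] at key
  simp only [μ] at key
  rw [lintegral_withDensity_eq_lintegral_mul _ (by fun_prop) (by fun_prop)] at key
  refine le_trans (le_of_eq ?_) (key.trans (le_of_eq ?_))
  · refine setLIntegral_congr_fun measurableSet_Ioo fun t ht => ?_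
    simp only [Pi.mul_apply]
    rw [ENNReal.ofReal_mul (sq_nonneg _), mul_comm]
  · refine setLIntegral_congr_fun measurableSet_Ioo fun t ht => ?_
    rw [ENNReal.ofReal_mul (div_nonneg (sq_nonneg _) (hβ t ht).le)]

/-! ### The cost of displacing a level of the kinetic energy -/

lemma lintegral_comp_abs_eq (h : ℝ → ℝ≥0∞) :
    ∫⁻ w : ℝ, h |w| = 2 * ∫⁻ w in Ioi (0 : ℝ), h w := by
  have h1 : ∫⁻ w in Ioi (0 : ℝ), h |w| = ∫⁻ w in Ioi (0 : ℝ), h w :=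
    setLIntegral_congr_fun measurableSet_Ioi fun w hw => by
      have hw' : (0 : ℝ) < w := hw
      rw [abs_of_pos hw']
  have h2 : ∫⁻ w in Iio (0 : ℝ), h |w| = ∫⁻ w in Ioi (0 : ℝ), h |w| := by
    rw [← lintegral_indicator measurableSet_Iio, ← lintegral_indicator measurableSet_Ioi,
      ← lintegral_neg_eq_self]
    refine lintegral_congr fun w => ?_
    simp [indicator]
  rw [← lintegral_add_compl _ (measurableSet_Ioi (a := (0 : ℝ))), compl_Ioi,
    setLIntegral_congr Iio_ae_eq_Iic.symm, h2, h1, two_mul]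

/-- The cost of moving the level `y` of the kinetic energy by `g`. -/
noncomputable def levelCost (y g w : ℝ) : ℝ :=
  if w ^ 2 / 2 < y then max (w ^ 2 / 2 - y + g) 0 else max (-(w ^ 2 / 2 - y + g)) 0

/-- The displacement cost lives on a band p < |w| < q and is dominated there by l; the two signs of
w account for the factor 2, and |w| = p is a null set. -/
lemma lintegral_le_of_band {F : ℝ → ℝ} {c p q : ℝ} (hp : 0 ≤ p) (hpq : p ≤ q)
    {l : ℝ → ℝ} (hl : Continuous l) (hl0 : ∀ s ∈ Icc p q, 0 ≤ l s)
    (hlc : ∫ s in p..q, l s = c)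
    (hF : ∀ w, p < |w| → |w| < q → F w ≤ l |w|)
    (hF0 : ∀ w, ¬ (p < |w| ∧ |w| < q) → |w| ≠ p → F w ≤ 0) :
    ∫⁻ w, ENNReal.ofReal (F w) ≤ ENNReal.ofReal (2 * c) := by
  have hnull : ∀ᵐ w : ℝ, |w| ≠ p := by
    have : volume ({p, -p} : Set ℝ) = 0 := (Set.toFinite _).measure_zero _
    rw [ae_iff]
    refine measure_mono_null (fun w hw => ?_) this
    simp only [mem_ofPred_eq, not_not] at hw
    rcases abs_choice w with h | h
    · left; rw [← h, hw]
    · right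
      have : w = -p := by rw [← hw, h, neg_neg]
      exact this
  calc ∫⁻ w, ENNReal.ofReal (F w)
      ≤ ∫⁻ w, (fun s => (Ioo p q).indicator (fun s => ENNReal.ofReal (l s)) s) |w| := by
        refine lintegral_mono_ae (hnull.mono fun w hwp => ?_)
        by_cases hw : p < |w| ∧ |w| < q
        · simp only [indicator_of_mem (show |w| ∈ Ioo p q from hw)]
          exact ENNReal.ofReal_le_ofReal (hF w hw.1 hw.2)
        · rw [ENNReal.ofReal_of_nonpos (hF0 w hw hwp)]
          exact zero_le
    _ = 2 * ∫⁻ w in Ioo p q, ENNReal.ofReal (l w) := by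
        rw [lintegral_comp_abs_eq, ← lintegral_indicator measurableSet_Ioi,
          ← lintegral_indicator measurableSet_Ioo]
        congr 1
        refine lintegral_congr fun w => ?_
        simp only [indicator, mem_Ioi, mem_Ioo]
        by_cases h : p < w ∧ w < q
        · simp [h, hp.trans_lt h.1]
        · simp [h]
    _ = ENNReal.ofReal (2 * c) := by
        have hi : IntegrableOn l (Ioo p q) :=
          (intervalIntegrable_iff_integrableOn_Ioo_of_le hpq).1 (hl.intervalIntegrable _ _)
        rw [← ofReal_integral_eq_lintegral_ofReal hi (ae_restrict_of_forall_mem measurableSet_Ioo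
          fun s hs => hl0 s (Ioo_subset_Icc_self hs)), ← integral_Ioc_eq_integral_Ioo,
          ← intervalIntegral.integral_of_le hpq, hlc, ENNReal.ofReal_mul (by norm_num)]
        norm_num

lemma sqrt_two_mul_sq {y : ℝ} (hy : 0 ≤ y) : √(2 * y) ^ 2 / 2 = y := by
  rw [Real.sq_sqrt (by linarith)]; ring

/-- The level moves outwards from w₁ to w₂, and the cost (w₂² - w²)/2 is at most w₂(w₂ - w). As g² =
(w₂ - w₁)²(w₂ + w₁)²/4, the claim is w₁w₂ ≤ ((w₁ + w₂)/2)². -/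
lemma levelCost_of_neg {y g : ℝ} (hy : 0 < y) (hg : g ≤ 0) :
    ∫⁻ w, ENNReal.ofReal (levelCost y g w) ≤ ENNReal.ofReal (g ^ 2 / √(2 * y)) := by
  set w₁ := √(2 * y) with hw₁
  set w₂ := √(2 * (y - g)) with hw₂
  have h1 : 0 < w₁ := Real.sqrt_pos.2 (by linarith)
  have h12 : w₁ ≤ w₂ := Real.sqrt_le_sqrt (by linarith)
  have hs1 : w₁ ^ 2 / 2 = y := sqrt_two_mul_sq hy.le
  have hs2 : w₂ ^ 2 / 2 = y - g := sqrt_two_mul_sq (by linarith)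
  refine (lintegral_le_of_band (c := w₂ * (w₂ - w₁) ^ 2 / 2) (p := w₁) (q := w₂)
    (l := fun s => w₂ * (w₂ - s)) h1.le h12 (by fun_prop)
    (fun s hs => mul_nonneg (by linarith) (by linarith [hs.2])) ?_ ?_ ?_).trans ?_
  · rw [intervalIntegral.integral_const_mul, intervalIntegral.integral_sub (by simp) (by simp),
      intervalIntegral.integral_const, integral_id, smul_eq_mul]
    ring
  · intro w hp hq
    have hwsq : w ^ 2 = |w| ^ 2 := (sq_abs w).symm
    have hnot : ¬ w ^ 2 / 2 < y := by
      rw [hwsq]; nlinarith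
    rw [levelCost, if_neg hnot]
    refine max_le ?_ (mul_nonneg (by linarith) (by linarith))
    rw [hwsq]
    nlinarith
  · intro w hw hwp
    have hwsq : w ^ 2 = |w| ^ 2 := (sq_abs w).symm
    rw [levelCost]
    split_ifs with h
    · exact max_le (by linarith) le_rfl
    · refine max_le ?_ le_rfl
      have h3 : w₁ ≤ |w| := by
        by_contra! hlt
        exact h (by rw [hwsq]; nlinarith [abs_nonneg w])
      have h4 : w₂ ≤ |w| := by
        by_contra! hlt
        exact hw ⟨lt_of_le_of_ne h3 (Ne.symm hwp), hlt⟩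
      rw [hwsq]
      nlinarith
  · refine ENNReal.ofReal_le_ofReal ?_
    rw [le_div_iff₀ h1]
    have hg2 : g ^ 2 = ((w₂ - w₁) * (w₂ + w₁)) ^ 2 / 4 := by
      have : (w₂ - w₁) * (w₂ + w₁) = -2 * g := by nlinarith
      rw [this]; ring
    rw [hg2]
    nlinarith [mul_nonneg (sq_nonneg (w₂ - w₁)) (sq_nonneg (w₂ - w₁))]

/-- The level moves inwards from w₁ to w₀. For g ≤ y/6 one has w₀ ≥ 0.9 w₁, and the loss against the
quadratic cost is the factor 9/8. -/
lemma levelCost_of_small {y g : ℝ} (hg : 0 < g) (hy : 6 * g ≤ y) :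
    ∫⁻ w, ENNReal.ofReal (levelCost y g w) ≤ ENNReal.ofReal (9 / 8 * (g ^ 2 / √(2 * y))) := by
  have hy0 : 0 < y := by linarith
  set w₁ := √(2 * y) with hw₁
  set w₀ := √(2 * (y - g)) with hw₀
  have h1 : 0 < w₁ := Real.sqrt_pos.2 (by linarith)
  have h0 : 0 < w₀ := Real.sqrt_pos.2 (by linarith)
  have h01 : w₀ ≤ w₁ := Real.sqrt_le_sqrt (by linarith)
  have hs1 : w₁ ^ 2 / 2 = y := sqrt_two_mul_sq hy0.le
  have hs0 : w₀ ^ 2 / 2 = y - g := sqrt_two_mul_sq (by linarith)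
  refine (lintegral_le_of_band (c := w₁ * (w₁ - w₀) ^ 2 / 2) (p := w₀) (q := w₁)
    (l := fun s => w₁ * (s - w₀)) h0.le h01 (by fun_prop)
    (fun s hs => mul_nonneg (by linarith) (by linarith [hs.1])) ?_ ?_ ?_).trans ?_
  · rw [intervalIntegral.integral_const_mul, intervalIntegral.integral_sub (by simp) (by simp),
      intervalIntegral.integral_const, integral_id, smul_eq_mul]
    ring
  · intro w hp hq
    have hwsq : w ^ 2 = |w| ^ 2 := (sq_abs w).symm
    have hlt : w ^ 2 / 2 < y := by
      rw [hwsq]; nlinarith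
    rw [levelCost, if_pos hlt]
    refine max_le ?_ (mul_nonneg (by linarith) (by linarith))
    rw [hwsq]
    nlinarith
  · intro w hw hwp
    have hwsq : w ^ 2 = |w| ^ 2 := (sq_abs w).symm
    rw [levelCost]
    split_ifs with h
    · refine max_le ?_ le_rfl
      have h3 : |w| < w₁ := by
        by_contra! hlt
        rw [hwsq] at h
        nlinarith [abs_nonneg w]
      have h4 : |w| ≤ w₀ := by
        by_contra! hlt
        exact hw ⟨hlt, h3⟩
      rw [hwsq]
      nlinarith [abs_nonneg w]
    · exact max_le (by linarith) le_rfl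
  · refine ENNReal.ofReal_le_ofReal ?_
    rw [show 9 / 8 * (g ^ 2 / w₁) = 9 / 8 * g ^ 2 / w₁ by ring, le_div_iff₀ h1]
    have hg2 : g ^ 2 = ((w₁ - w₀) * (w₁ + w₀)) ^ 2 / 4 := by
      have : (w₁ - w₀) * (w₁ + w₀) = 2 * g := by nlinarith
      rw [this]; ring
    have h9 : 9 / 10 * w₁ ≤ w₀ := by
      refine le_of_sq_le_sq ?_ h0.le
      nlinarith
    have h10 : w₁ ^ 2 ≤ 9 / 32 * (w₁ + w₀) ^ 2 := by nlinarith
    rw [hg2]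
    have := mul_le_mul_of_nonneg_left h10 (sq_nonneg (w₁ - w₀))
    nlinarith

/-- The cost is at most g on |w| < √(2y), and √(2y) < √(12g) ≤ (7/2)√g. -/
lemma levelCost_of_large {y g : ℝ} (hg : 0 < g) (hy0 : 0 < y) (hy : y < 6 * g) :
    ∫⁻ w, ENNReal.ofReal (levelCost y g w) ≤ ENNReal.ofReal (7 * (g * √g)) := by
  set w₁ := √(2 * y) with hw₁
  have h1 : 0 < w₁ := Real.sqrt_pos.2 (by linarith)
  have hs1 : w₁ ^ 2 / 2 = y := sqrt_two_mul_sq hy0.le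
  refine (lintegral_le_of_band (c := g * w₁) (p := 0) (q := w₁)
    (l := fun s => g) le_rfl h1.le (by fun_prop)
    (fun s hs => hg.le) ?_ ?_ ?_).trans ?_
  · rw [intervalIntegral.integral_const, smul_eq_mul]
    ring
  · intro w _ _
    rw [levelCost]
    split_ifs with h
    · exact max_le (by linarith) hg.le
    · exact max_le (by linarith) hg.le
  · intro w hw hwp
    have hwsq : w ^ 2 = |w| ^ 2 := (sq_abs w).symm
    have hpos : 0 < |w| := lt_of_le_of_ne (abs_nonneg w) (Ne.symm hwp)
    rw [levelCost, if_neg]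
    · refine max_le ?_ le_rfl
      have : w₁ ≤ |w| := by by_contra! hlt; exact hw ⟨hpos, hlt⟩
      rw [hwsq]; nlinarith
    · have : w₁ ≤ |w| := by by_contra! hlt; exact hw ⟨hpos, hlt⟩
      rw [hwsq]; nlinarith
  · refine ENNReal.ofReal_le_ofReal ?_
    have hsg := Real.sqrt_nonneg g
    have hsq := Real.sq_sqrt hg.le
    have : w₁ ≤ 7 / 2 * √g := by
      refine le_of_sq_le_sq ?_ (by positivity)
      nlinarith
    nlinarith

/-- The unperturbed level set is empty; the displacement creates one of height y - g ≤ |g| on |w| <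
√(2(y - g)). -/
lemma levelCost_of_nonpos {y g : ℝ} (hy : y ≤ 0) (hg : g < y) :
    ∫⁻ w, ENNReal.ofReal (levelCost y g w) ≤ ENNReal.ofReal (7 * (|g| * √|g|)) := by
  set δ := y - g
  have hδ : 0 < δ := by simp only [δ]; linarith
  have hδg : δ ≤ |g| := by
    rw [abs_of_neg (by linarith)]; simp only [δ]; linarith
  set w₁ := √(2 * δ) with hw₁
  have h1 : 0 < w₁ := Real.sqrt_pos.2 (by linarith)
  have hs1 : w₁ ^ 2 / 2 = δ := sqrt_two_mul_sq hδ.le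
  have hcost : ∀ w, levelCost y g w = max (δ - w ^ 2 / 2) 0 := by
    intro w
    rw [levelCost, if_neg (by nlinarith [sq_nonneg w])]
    congr 1
    simp only [δ]
    ring
  refine (lintegral_le_of_band (c := δ * w₁) (p := 0) (q := w₁)
    (l := fun s => δ) le_rfl h1.le (by fun_prop)
    (fun s hs => hδ.le) ?_ ?_ ?_).trans ?_
  · rw [intervalIntegral.integral_const, smul_eq_mul]
    ring
  · intro w _ _
    rw [hcost]
    exact max_le (by nlinarith [sq_nonneg w]) hδ.le
  · intro w hw hwp
    have hwsq : w ^ 2 = |w| ^ 2 := (sq_abs w).symm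
    have hpos : 0 < |w| := lt_of_le_of_ne (abs_nonneg w) (Ne.symm hwp)
    have : w₁ ≤ |w| := by by_contra! hlt; exact hw ⟨hpos, hlt⟩
    rw [hcost, hwsq]
    exact max_le (by nlinarith) le_rfl
  · refine ENNReal.ofReal_le_ofReal ?_
    have hsg := Real.sqrt_nonneg |g|
    have hsq := Real.sq_sqrt (abs_nonneg g)
    have h5 : w₁ ≤ 7 / 2 * √|g| := by
      refine le_of_sq_le_sq ?_ (by positivity)
      nlinarith
    have h6 : δ * w₁ ≤ |g| * (7 / 2 * √|g|) := mul_le_mul hδg h5 h1.le (abs_nonneg g)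
    nlinarith

/-- The cost of a level shift is quadratic up to a boundary layer around the turning points. -/
lemma lintegral_levelCost_le {y g G : ℝ} (hG : |g| ≤ G) :
    ∫⁻ w, ENNReal.ofReal (levelCost y g w)
      ≤ ENNReal.ofReal (9 / 8 * (g ^ 2 / √(2 * y)))
        + (Icc (-(6 * G)) (6 * G)).indicator (fun _ => ENNReal.ofReal (7 * (G * √G))) y := by
  have hmono : ∀ g', g' ≤ G → 0 ≤ g' →
      ENNReal.ofReal (7 * (g' * √g')) ≤ ENNReal.ofReal (7 * (G * √G)) := by
    intro g' h h0
    refine ENNReal.ofReal_le_ofReal ?_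
    have := mul_le_mul h (Real.sqrt_le_sqrt h) (Real.sqrt_nonneg _) (h0.trans h)
    linarith
  have hG0 : 0 ≤ G := (abs_nonneg g).trans hG
  rcases le_or_gt y 0 with hy | hy
  · rcases lt_or_ge g y with hgy | hgy
    · refine le_add_left ?_
      have habs : |g| = -g := abs_of_neg (by linarith)
      rw [indicator_of_mem (mem_Icc.2 ⟨by linarith, by linarith⟩)]
      exact (levelCost_of_nonpos hy hgy).trans (hmono _ hG (abs_nonneg g))
    · refine le_trans (le_of_eq ?_) zero_le
      refine (lintegral_congr fun w => ?_).trans lintegral_zero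
      rw [levelCost, if_neg (by nlinarith [sq_nonneg w]),
        max_eq_right (by nlinarith [sq_nonneg w]), ENNReal.ofReal_zero]
  · rcases le_or_gt g 0 with hg | hg
    · refine le_add_right ((levelCost_of_neg hy hg).trans (ENNReal.ofReal_le_ofReal ?_))
      have : 0 ≤ g ^ 2 / √(2 * y) := by positivity
      linarith
    · rcases le_or_gt (6 * g) y with h6 | h6
      · exact le_add_right (levelCost_of_small hg h6)
      · refine le_add_left ?_
        rw [abs_of_pos hg] at hG
        rw [indicator_of_mem (mem_Icc.2 ⟨by linarith, by linarith⟩)]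
        exact (levelCost_of_large hg hy h6).trans (hmono _ hG hg.le)

/-! ### Radial orbits and Antonov's inequality -/

/-- The radial kinetic energy `e - U(r) - L / (2 r²)` of a particle with energy `e` and squared
angular momentum `L`. -/
noncomputable def radialKinetic (U : Space → ℝ) (e L r : ℝ) : ℝ :=
  e - radialProfile U r - L / (2 * r ^ 2)

lemma kingDensity_pos {E₀ c : ℝ} (h : c < E₀) : 0 < kingDensity E₀ c := by
  have hc : Continuous (fun v : Space => max (Real.exp (E₀ - (‖v‖ ^ 2 / 2 + c)) - 1) 0) := by
    fun_prop
  refine integral_pos_of_integrable_nonneg_nonzero (x := 0) hc (kingDensity_integrable E₀ c)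
    (fun v => le_max_right _ _) ?_
  refine (lt_max_of_lt_left ?_).ne'
  rw [sub_pos, Real.one_lt_exp_iff]
  simpa using h

namespace IsKingPotential

variable {E₀ : ℝ} {U₀ : Space → ℝ} (hU : IsKingPotential E₀ U₀)
include hU

/-- This is the function b of `orbit_poincare`; its derivative is r times the weight of
`antonov_weight`, whatever the energy e. -/
lemma hasDerivAt_virial (e r : ℝ) :
    HasDerivAt (fun r => r * deriv (radialProfile U₀) r - 2 * (e - radialProfile U₀ r))
      (3 * deriv (radialProfile U₀) r + r * deriv (deriv (radialProfile U₀)) r) r := by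
  have h1 := (hasDerivAt_id r).mul (hasDerivAt_deriv_radialProfile hU.contDiff r)
  have h2 := ((hasDerivAt_radialProfile hU.contDiff r).const_sub e).const_mul 2
  refine (h1.sub h2).congr_deriv ?_
  simp only [id]
  ring

lemma virial_deriv_ge {r : ℝ} (hr : 0 < r) :
    r * (16 * Real.pi / 3 * kingDensity E₀ (radialProfile U₀ r))
      ≤ 3 * deriv (radialProfile U₀) r + r * deriv (deriv (radialProfile U₀)) r := by
  have h := mul_le_mul_of_nonneg_left (hU.antonov_weight hr) hr.le
  refine h.trans (le_of_eq ?_)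
  field_simp
  ring

lemma virial_monotoneOn (e : ℝ) :
    MonotoneOn (fun r => r * deriv (radialProfile U₀) r - 2 * (e - radialProfile U₀ r))
      (Ioi 0) := by
  refine monotoneOn_of_deriv_nonneg (convex_Ioi 0)
    (fun r _ => (hU.hasDerivAt_virial e r).continuousAt.continuousWithinAt)
    (fun r _ => (hU.hasDerivAt_virial e r).differentiableAt.differentiableWithinAt) fun s hs => ?_
  rw [interior_Ioi] at hs
  rw [(hU.hasDerivAt_virial e s).deriv]
  refine le_trans ?_ (hU.virial_deriv_ge hs)
  have hs' : (0 : ℝ) < s := hs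
  have := kingDensity_nonneg E₀ (radialProfile U₀ s)
  have := Real.pi_pos
  positivity

/-- The function is the square of r times the radial velocity, and its derivative is -2r times the
virial function b. Its root a therefore satisfies a' = -b/√(2y), as `orbit_poincare` requires. -/
lemma hasDerivAt_radialMomentumSq (e L r : ℝ) :
    HasDerivAt (fun r => 2 * r ^ 2 * (e - radialProfile U₀ r) - L)
      (-(2 * r * (r * deriv (radialProfile U₀) r - 2 * (e - radialProfile U₀ r)))) r := by
  have h1 : HasDerivAt (fun r : ℝ => 2 * r ^ 2) (2 * (2 * r)) r := by
    simpa using (hasDerivAt_pow 2 r).const_mul 2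
  have h2 := (hasDerivAt_radialProfile hU.contDiff r).const_sub e
  exact ((h1.mul h2).sub_const L).congr_deriv (by ring)

/-- The radial range of an orbit is an interval between two turning points. -/
lemma orbit_interval {e L : ℝ} (he : e < 0) (hL : 0 < L)
    (hne : ∃ r, 0 < r ∧ 0 < 2 * r ^ 2 * (e - radialProfile U₀ r) - L) :
    ∃ r₁ r₂, 0 < r₁ ∧ r₁ < r₂ ∧
      {r | 0 < r ∧ 0 < 2 * r ^ 2 * (e - radialProfile U₀ r) - L} = Ioo r₁ r₂ ∧
      2 * r₁ ^ 2 * (e - radialProfile U₀ r₁) - L = 0 ∧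
      2 * r₂ ^ 2 * (e - radialProfile U₀ r₂) - L = 0 := by
  set p : ℝ → ℝ := fun r => 2 * r ^ 2 * (e - radialProfile U₀ r) - L with hp
  set I : Set ℝ := {r | 0 < r ∧ 0 < p r}
  have hd := hU.hasDerivAt_radialMomentumSq e L
  have hpc : Continuous p := continuous_iff_continuousAt.2 fun r => (hd r).continuousAt
  have hbm := hU.virial_monotoneOn e
  have hopen : IsOpen I := (isOpen_lt continuous_const continuous_id).inter
    (isOpen_lt continuous_const hpc)
  -- The virial function is increasing, so p first increases and then decreases; its positivity set
  -- has no gaps.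
  have hord : OrdConnected I := by
    refine ⟨fun x hx z hz y hy => ⟨hx.1.trans_le hy.1, ?_⟩⟩
    have hy0 : 0 < y := hx.1.trans_le hy.1
    rcases le_or_gt (y * deriv (radialProfile U₀) y - 2 * (e - radialProfile U₀ y)) 0 with h | h
    · have hm : MonotoneOn p (Icc x y) := by
        refine monotoneOn_of_deriv_nonneg (convex_Icc x y) hpc.continuousOn
          (fun r _ => (hd r).differentiableAt.differentiableWithinAt) fun s hs => ?_
        rw [interior_Icc] at hs
        rw [(hd s).deriv]
        have hs0 : 0 < s := hx.1.trans hs.1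
        have h2 := (hbm hs0 hy0 hs.2.le).trans h
        simp only at h2
        have := mul_nonneg (by linarith : 0 ≤ 2 * s) (neg_nonneg.2 h2)
        linarith
      exact hx.2.trans_le (hm (left_mem_Icc.2 hy.1) (right_mem_Icc.2 hy.1) hy.1)
    · have hm : AntitoneOn p (Icc y z) := by
        refine antitoneOn_of_deriv_nonpos (convex_Icc y z) hpc.continuousOn
          (fun r _ => (hd r).differentiableAt.differentiableWithinAt) fun s hs => ?_
        rw [interior_Icc] at hs
        rw [(hd s).deriv]
        have hs0 : 0 < s := hy0.trans hs.1
        have h2 := h.le.trans (hbm hy0 hs0 hs.1.le)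
        simp only at h2
        have := mul_nonneg (by linarith : 0 ≤ 2 * s) h2
        linarith
      exact hz.2.trans_le (hm (left_mem_Icc.2 hy.2) (right_mem_Icc.2 hy.2) hy.2)
  -- As U₀ vanishes at infinity and e < 0, no orbit of energy e reaches beyond R.
  obtain ⟨R, hR, hRU⟩ := hU.exists_radius he
  have hbdd : ∀ r ∈ I, r < R := by
    intro r hr
    by_contra! hle
    have h1 := hRU r hle
    have h2 := hr.2
    simp only [hp] at h2
    have hr2 : 0 < r ^ 2 := pow_pos hr.1 2
    nlinarith
  have hIne : I.Nonempty := hne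
  have hb1 : BddBelow I := ⟨0, fun r hr => hr.1.le⟩
  have hb2 : BddAbove I := ⟨R, fun r hr => (hbdd r hr).le⟩
  have hconn : IsConnected I := ⟨hIne, hord.isPreconnected⟩
  set r₁ := sInf I
  set r₂ := sSup I
  have hn1 : r₁ ∉ I := fun hmem => by
    obtain ⟨ε, hε, hball⟩ := Metric.isOpen_iff.1 hopen r₁ hmem
    have : r₁ - ε / 2 ∈ I := hball (by
      rw [Metric.mem_ball, Real.dist_eq, abs_lt]; constructor <;> linarith)
    linarith [csInf_le hb1 this]
  have hn2 : r₂ ∉ I := fun hmem => by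
    obtain ⟨ε, hε, hball⟩ := Metric.isOpen_iff.1 hopen r₂ hmem
    have : r₂ + ε / 2 ∈ I := hball (by
      rw [Metric.mem_ball, Real.dist_eq, abs_lt]; constructor <;> linarith)
    linarith [le_csSup hb2 this]
  have hIeq : I = Ioo r₁ r₂ := by
    refine Subset.antisymm (fun r hr => ⟨?_, ?_⟩) (hconn.Ioo_csInf_csSup_subset hb1 hb2)
    · exact lt_of_le_of_ne (csInf_le hb1 hr) fun h => hn1 (h ▸ hr)
    · exact lt_of_le_of_ne (le_csSup hb2 hr) fun h => hn2 (h ▸ hr)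
  have h12 : r₁ < r₂ := by
    obtain ⟨r, hr⟩ := hIne
    rw [hIeq] at hr
    exact hr.1.trans hr.2
  have hcl : ∀ r ∈ closure I, 0 ≤ p r := by
    intro r hr
    exact closure_minimal (fun s hs => hs.2.le : I ⊆ {s | 0 ≤ p s})
      (isClosed_le continuous_const hpc) hr
  have hp1 : 0 ≤ p r₁ := hcl _ (csInf_mem_closure hIne hb1)
  have hp2 : 0 ≤ p r₂ := hcl _ (csSup_mem_closure hIne hb2)
  -- At the centre p equals -L < 0, so positive angular momentum keeps the orbit away from it.
  have hr1 : 0 < r₁ := by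
    have h0 : 0 ≤ r₁ := le_csInf hIne fun r hr => hr.1.le
    refine lt_of_le_of_ne h0 fun h => ?_
    rw [← h] at hp1
    simp only [hp] at hp1
    norm_num at hp1
    linarith
  refine ⟨r₁, r₂, hr1, h12, hIeq, ?_, ?_⟩
  · exact le_antisymm (not_lt.1 fun h => hn1 ⟨hr1, h⟩) hp1
  · exact le_antisymm (not_lt.1 fun h => hn2 ⟨hr1.trans h12, h⟩) hp2

omit hU in
lemma two_mul_sq_mul_radialKinetic {e L r : ℝ} (hr : 0 < r) :
    2 * r ^ 2 * (e - radialProfile U₀ r) - L = r ^ 2 * (2 * radialKinetic U₀ e L r) := by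
  unfold radialKinetic
  field_simp

/-- Antonov's inequality on a single orbit. -/
lemma antonov_orbit {e L : ℝ} (he : e < E₀) (hL : 0 < L) {ψ χ : ℝ → ℝ} (hψm : Measurable ψ)
    {K : ℝ} (hK : ∀ r, |ψ r| ≤ K) (hχ : Measurable χ)
    (hψ : ∀ s r, 0 < s → s < r →
      ENNReal.ofReal |ψ r - ψ s| ≤ ∫⁻ t in Ioo s r, ENNReal.ofReal |χ t|)
    (hfin : IntegrableOn (fun r => 1 / √(2 * radialKinetic U₀ e L r)) (Ioi 0)) :
    ∫⁻ r in Ioi 0, ENNReal.ofReal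
        ((ψ r - (∫ s in Ioi 0, ψ s * (1 / √(2 * radialKinetic U₀ e L s)))
          / ∫ s in Ioi 0, 1 / √(2 * radialKinetic U₀ e L s)) ^ 2
          * (1 / √(2 * radialKinetic U₀ e L r)))
      ≤ ∫⁻ r in Ioi 0, ENNReal.ofReal (χ r ^ 2 *
          (3 / (16 * Real.pi * kingDensity E₀ (radialProfile U₀ r)))
            * √(2 * radialKinetic U₀ e L r)) := by
  set k : ℝ → ℝ := fun r => 1 / √(2 * radialKinetic U₀ e L r) with hk
  have huc : Continuous (radialProfile U₀) := (radialProfile_contDiff hU.contDiff).continuous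
  have hu'c := (contDiff_deriv_radialProfile hU.contDiff).continuous
  have hu''c := continuous_deriv_deriv_radialProfile hU.contDiff
  have hkm : Measurable k := by
    have := huc.measurable
    simp only [hk, radialKinetic]
    fun_prop
  by_cases hne : ∃ r, 0 < r ∧ 0 < 2 * r ^ 2 * (e - radialProfile U₀ r) - L
  swap
  -- Where the radial kinetic energy is not positive its root is 0 and 1/0 = 0, so k vanishes off
  -- the orbit without an indicator.
  · have hk0 : ∀ r ∈ Ioi (0 : ℝ), k r = 0 := by
      intro r hr
      have hr' : (0 : ℝ) < r := hr
      have h1 : 2 * r ^ 2 * (e - radialProfile U₀ r) - L ≤ 0 := by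
        by_contra! h
        exact hne ⟨r, hr, h⟩
      rw [two_mul_sq_mul_radialKinetic hr'] at h1
      have h2 : 2 * radialKinetic U₀ e L r ≤ 0 := by
        by_contra! h
        exact absurd h1 (not_le.2 (by positivity))
      simp only [hk, Real.sqrt_eq_zero_of_nonpos h2, div_zero]
    refine le_trans (le_of_eq ?_) zero_le
    rw [setLIntegral_congr_fun measurableSet_Ioi (g := fun _ => 0) fun r hr => ?_, lintegral_zero]
    have h0 := hk0 r hr
    simp only [hk] at h0
    simp only [h0, mul_zero, ENNReal.ofReal_zero]
  obtain ⟨r₁, r₂, hr1, h12, hI, hp1, hp2⟩ := hU.orbit_interval (he.trans hU.cutoff_neg) hL hne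
  have hpos : ∀ r ∈ Ioo r₁ r₂, 0 < r ∧ 0 < 2 * radialKinetic U₀ e L r := by
    intro r hr
    rw [← hI] at hr
    obtain ⟨h0, h1⟩ := hr
    rw [two_mul_sq_mul_radialKinetic h0] at h1
    exact ⟨h0, pos_of_mul_pos_right h1 (by positivity)⟩
  have hout : ∀ r ∈ Ioi (0 : ℝ), r ∉ Ioo r₁ r₂ → k r = 0 := by
    intro r hr hr'
    have h0 : (0 : ℝ) < r := hr
    have h1 : 2 * radialKinetic U₀ e L r ≤ 0 := by
      by_contra! h
      refine hr' ?_
      rw [← hI]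
      refine ⟨h0, ?_⟩
      rw [two_mul_sq_mul_radialKinetic h0]
      positivity
    simp only [hk, Real.sqrt_eq_zero_of_nonpos h1, div_zero]
  have hsub : Ioo r₁ r₂ ⊆ Ioi 0 := fun r hr => (hpos r hr).1
  have hkset : ∀ g : ℝ → ℝ, ∫ s in Ioi 0, g s * k s = ∫ s in Ioo r₁ r₂, g s * k s := by
    intro g
    refine setIntegral_eq_of_subset_of_forall_sdiff_eq_zero measurableSet_Ioi hsub fun r hr => ?_
    rw [hout r hr.1 hr.2, mul_zero]
  have hk1 : ∫ s in Ioi 0, k s = ∫ s in Ioo r₁ r₂, k s := by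
    have := hkset fun _ => 1
    simpa using this
  rw [hkset ψ, hk1]
  set a : ℝ → ℝ := fun r => √(2 * r ^ 2 * (e - radialProfile U₀ r) - L)
  set b : ℝ → ℝ := fun r => r * deriv (radialProfile U₀) r - 2 * (e - radialProfile U₀ r)
  set β : ℝ → ℝ := fun r => 3 * deriv (radialProfile U₀) r
    + r * deriv (deriv (radialProfile U₀)) r
  have hac : Continuous a := by fun_prop
  have hbc : Continuous b := by fun_prop
  have hβc : Continuous β := by fun_prop
  have ha_eq : ∀ r, 0 < r → a r = r * √(2 * radialKinetic U₀ e L r) := by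
    intro r hr
    simp only [a]
    rw [two_mul_sq_mul_radialKinetic hr, Real.sqrt_mul (by positivity), Real.sqrt_sq hr.le]
  -- On the orbit U₀ < e < E₀, so it lies inside the support of the density and the weight is
  -- strictly positive.
  have hρ : ∀ r ∈ Ioo r₁ r₂, 0 < kingDensity E₀ (radialProfile U₀ r) := by
    intro r hr
    obtain ⟨h0, h1⟩ := hpos r hr
    refine kingDensity_pos ?_
    unfold radialKinetic at h1
    have : 0 < L / (2 * r ^ 2) := by positivity
    linarith
  have hβ : ∀ r ∈ Ioo r₁ r₂, 0 < β r := by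
    intro r hr
    refine lt_of_lt_of_le ?_ (hU.virial_deriv_ge (hpos r hr).1)
    have := hρ r hr
    have := (hpos r hr).1
    have := Real.pi_pos
    positivity
  have key := orbit_poincare h12 (a := a) (b := b) (β := β) (k := k) (ψ := ψ) (χ := χ)
    hac.continuousOn (by simp only [a, hp1, Real.sqrt_zero])
    (by simp only [a, hp2, Real.sqrt_zero]) (fun t ht => ?_) hbc.measurable hbc.continuousOn
    (fun t _ => hU.hasDerivAt_virial e t) hβc.measurable hβ hkm
    (fun t ht => by
      have := Real.sqrt_pos.2 (hpos t ht).2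
      simp only [hk]
      positivity)
    (hfin.mono_set hsub) hψm hK hχ (fun s hs r _ hsr => hψ s r (hpos s hs).1 hsr)
  · refine le_trans (le_of_eq ?_) (key.trans ?_)
    · rw [← lintegral_indicator measurableSet_Ioi, ← lintegral_indicator measurableSet_Ioo]
      refine lintegral_congr fun r => ?_
      by_cases hr : r ∈ Ioo r₁ r₂
      · rw [indicator_of_mem hr, indicator_of_mem (hsub hr)]
      · rw [indicator_of_notMem hr]
        by_cases hr0 : r ∈ Ioi (0 : ℝ)
        · rw [indicator_of_mem hr0]
          have := hout r hr0 hr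
          simp only [hk] at this
          rw [this, mul_zero, ENNReal.ofReal_zero]
        · rw [indicator_of_notMem hr0]
    · refine le_trans ?_ (lintegral_mono_set hsub)
      refine setLIntegral_mono' measurableSet_Ioo fun r hr => ENNReal.ofReal_le_ofReal ?_
      obtain ⟨h0, h1⟩ := hpos r hr
      rw [ha_eq r h0]
      have h2 := hU.virial_deriv_ge h0
      have h3 := hρ r hr
      have h4 : r / β r ≤ 3 / (16 * Real.pi * kingDensity E₀ (radialProfile U₀ r)) := by
        have hpi := Real.pi_pos
        rw [div_le_div_iff₀ (hβ r hr) (by positivity)]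
        simp only [β]
        linarith
      have h5 : χ r ^ 2 / β r * (r * √(2 * radialKinetic U₀ e L r))
          = χ r ^ 2 * (r / β r) * √(2 * radialKinetic U₀ e L r) := by ring
      rw [h5]
      gcongr
  · obtain ⟨h0, h1⟩ := hpos t ht
    have h2 : 0 < 2 * t ^ 2 * (e - radialProfile U₀ t) - L := by
      rw [two_mul_sq_mul_radialKinetic h0]; positivity
    have h3 := (hU.hasDerivAt_radialMomentumSq e L t).sqrt h2.ne'
    refine h3.congr_deriv ?_
    have h4 : √(2 * t ^ 2 * (e - radialProfile U₀ t) - L) = t * √(2 * radialKinetic U₀ e L t) :=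
      ha_eq t h0
    have h5 := Real.sqrt_pos.2 h1
    rw [h4]
    simp only [hk, b]
    field_simp

end IsKingPotential

/-! ### Levels of the King model and integrals over level and angular momentum -/

/-- The energy at which the King model takes the value `t`. -/
noncomputable def levelEnergy (E₀ t : ℝ) : ℝ := E₀ - Real.log (1 + t)

lemma measurable_levelEnergy (E₀ : ℝ) : Measurable (levelEnergy E₀) := by
  unfold levelEnergy
  fun_prop

lemma levelEnergy_lt {E₀ t : ℝ} (ht : 0 < t) : levelEnergy E₀ t < E₀ := by
  have := Real.log_pos (show 1 < 1 + t by linarith)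
  unfold levelEnergy
  linarith

/-- Superlevel sets of the King model are sublevel sets of the energy, which is what converts levels
into orbits. -/
lemma lt_king_iff {E₀ E t : ℝ} (ht : 0 ≤ t) :
    t < max (Real.exp (E₀ - E) - 1) 0 ↔ E < levelEnergy E₀ t := by
  have h : Real.log (1 + t) < E₀ - E ↔ 1 + t < Real.exp (E₀ - E) :=
    Real.log_lt_iff_lt_exp (by linarith)
  rw [lt_max_iff, or_iff_left (not_lt.2 ht), levelEnergy]
  constructor
  · intro hlt
    linarith [h.2 (by linarith)]
  · intro hlt
    linarith [h.1 (by linarith)]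

lemma ofReal_king_eq_lintegral (E₀ E : ℝ) :
    ENNReal.ofReal (max (Real.exp (E₀ - E) - 1) 0)
      = ∫⁻ t in Ioi (0 : ℝ), {t | E < levelEnergy E₀ t}.indicator (fun _ => 1) t := by
  have h1 : ∫⁻ t in Ioi (0 : ℝ), {t | E < levelEnergy E₀ t}.indicator (fun _ => (1 : ℝ≥0∞)) t
      = ∫⁻ t, (Ioo 0 (max (Real.exp (E₀ - E) - 1) 0)).indicator (fun _ => 1) t := by
    rw [← lintegral_indicator measurableSet_Ioi]
    refine lintegral_congr fun t => ?_
    simp only [indicator, mem_Ioi, mem_Ioo, mem_ofPred_eq]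
    by_cases ht : 0 < t
    · simp only [ht, if_true, true_and, lt_king_iff ht.le]
    · simp [ht]
  rw [h1, lintegral_indicator measurableSet_Ioo]
  simp

lemma lintegral_indicator_sq_lt (D : ℝ) :
    ∫⁻ w : ℝ, {w : ℝ | w ^ 2 < D}.indicator (fun _ => (1 : ℝ≥0∞)) w
      = ENNReal.ofReal (2 * √D) := by
  have h : {w : ℝ | w ^ 2 < D} = Ioo (-√D) √D := by
    ext w
    simp only [mem_ofPred_eq, mem_Ioo, ← abs_lt]
    rw [Real.lt_sqrt (abs_nonneg w), sq_abs]
  rw [h, lintegral_indicator measurableSet_Ioo]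
  simp only [lintegral_const, MeasurableSet.univ, Measure.restrict_apply, univ_inter,
    Real.volume_Ioo, one_mul]
  congr 1
  ring

/-- The density of the King model as an integral over levels and angular momenta. -/
lemma lintegral_sqrt_radialKinetic (E₀ : ℝ) {U₀ : Space → ℝ} {r : ℝ} (hr : 0 < r) :
    ∫⁻ t in Ioi (0 : ℝ), ∫⁻ L in Ioi (0 : ℝ),
        ENNReal.ofReal √(2 * radialKinetic U₀ (levelEnergy E₀ t) L r)
      = ENNReal.ofReal (r ^ 2 / (2 * Real.pi) * kingDensity E₀ (radialProfile U₀ r)) := by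
  set c := radialProfile U₀ r with hc
  have hpi := Real.pi_pos
  have hlm := measurable_levelEnergy E₀
  -- The density is the volume of a set of triples (level, q, w). Integrating over w first gives the
  -- length 2√(2y), and q = L/r² introduces the angular momentum.
  set S : ℝ → ℝ → ℝ → ℝ≥0∞ := fun t q w =>
    {p : ℝ × ℝ × ℝ | (p.2.2 ^ 2 + p.2.1) / 2 + c < levelEnergy E₀ p.1}.indicator
      (fun _ => 1) (t, q, w)
  have hSm : Measurable (fun p : ℝ × ℝ × ℝ => S p.1 p.2.1 p.2.2) := by
    refine Measurable.indicator measurable_const (measurableSet_lt ?_ (by fun_prop))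
    fun_prop
  have h1 : ENNReal.ofReal (kingDensity E₀ c) = ENNReal.ofReal Real.pi *
      ∫⁻ w : ℝ, ∫⁻ q in Ioi (0 : ℝ), ∫⁻ t in Ioi (0 : ℝ), S t q w := by
    rw [kingDensity, ofReal_integral_eq_lintegral_ofReal (kingDensity_integrable E₀ c)
      (ae_of_all _ fun _ => le_max_right _ _)]
    have h2 := lintegral_cylindrical axisVector norm_axisVector
      (fun p => ENNReal.ofReal (max (Real.exp (E₀ - ((p.1 ^ 2 + p.2) / 2 + c)) - 1) 0))
      (by fun_prop)
    refine Eq.trans (lintegral_congr fun v => ?_) (h2.trans ?_)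
    · simp only [add_sub_cancel]
    · congr 1
      refine lintegral_congr fun w => lintegral_congr fun q => ?_
      rw [ofReal_king_eq_lintegral]
      rfl
  have h2 : ∫⁻ w : ℝ, ∫⁻ q in Ioi (0 : ℝ), ∫⁻ t in Ioi (0 : ℝ), S t q w
      = ∫⁻ t in Ioi (0 : ℝ), ∫⁻ q in Ioi (0 : ℝ), ∫⁻ w : ℝ, S t q w := by
    calc ∫⁻ w : ℝ, ∫⁻ q in Ioi (0 : ℝ), ∫⁻ t in Ioi (0 : ℝ), S t q w
        = ∫⁻ w : ℝ, ∫⁻ t in Ioi (0 : ℝ), ∫⁻ q in Ioi (0 : ℝ), S t q w := by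
          refine lintegral_congr fun w => ?_
          exact lintegral_lintegral_swap (f := fun q t => S t q w)
            (hSm.comp (f := fun p : ℝ × ℝ => (p.2, p.1, w)) (by fun_prop)).aemeasurable
      _ = ∫⁻ t in Ioi (0 : ℝ), ∫⁻ w : ℝ, ∫⁻ q in Ioi (0 : ℝ), S t q w := by
          refine lintegral_lintegral_swap (f := fun w t => ∫⁻ q in Ioi (0 : ℝ), S t q w) ?_
          refine Measurable.aemeasurable ?_
          exact Measurable.lintegral_prod_right' (f := fun p : (ℝ × ℝ) × ℝ => S p.1.2 p.2 p.1.1)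
            (hSm.comp (f := fun p : (ℝ × ℝ) × ℝ => (p.1.2, p.2, p.1.1)) (by fun_prop))
      _ = _ := by
          refine lintegral_congr fun t => ?_
          exact lintegral_lintegral_swap (f := fun w q => S t q w)
            (hSm.comp (f := fun p : ℝ × ℝ => (t, p.2, p.1)) (by fun_prop)).aemeasurable
  have h3 : ∀ t q, ∫⁻ w : ℝ, S t q w
      = ENNReal.ofReal (2 * √(2 * (levelEnergy E₀ t - c - q / 2))) := by
    intro t q
    rw [← lintegral_indicator_sq_lt]
    refine lintegral_congr fun w => ?_
    simp only [S, indicator, mem_ofPred_eq]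
    congr 1
    refine propext ⟨fun h => by linarith, fun h => by linarith⟩
  have h4 : ∀ t, ∫⁻ q in Ioi (0 : ℝ), ∫⁻ w : ℝ, S t q w = ENNReal.ofReal (2 / r ^ 2) *
      ∫⁻ L in Ioi (0 : ℝ), ENNReal.ofReal √(2 * radialKinetic U₀ (levelEnergy E₀ t) L r) := by
    intro t
    simp only [h3]
    rw [lintegral_Ioi_rescale (c := r ^ 2) (by positivity), div_eq_mul_inv, mul_comm (2 : ℝ),
      ENNReal.ofReal_mul (by positivity), mul_assoc]
    congr 1
    rw [← lintegral_const_mul' _ _ ENNReal.ofReal_ne_top]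
    refine lintegral_congr fun L => ?_
    rw [← ENNReal.ofReal_mul (by norm_num)]
    congr 4
    unfold radialKinetic
    rw [← hc]
    field_simp
  rw [ENNReal.ofReal_mul (by positivity), h1, h2]
  simp only [h4]
  rw [lintegral_const_mul' _ _ ENNReal.ofReal_ne_top, ← mul_assoc, ← mul_assoc,
    ← ENNReal.ofReal_mul (by positivity), ← ENNReal.ofReal_mul (by positivity)]
  rw [show r ^ 2 / (2 * Real.pi) * Real.pi * (2 / r ^ 2) = 1 by field_simp, ENNReal.ofReal_one,
    one_mul]

/-- The angular momentum integral of the time density. -/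
lemma lintegral_inv_sqrt_radialKinetic {U₀ : Space → ℝ} {e c r : ℝ} (hr : 0 < r)
    (hc : e - radialProfile U₀ r ≤ c) :
    ∫⁻ L in Ioi (0 : ℝ), ENNReal.ofReal (1 / √(2 * radialKinetic U₀ e L r))
      ≤ ENNReal.ofReal (2 * r ^ 2 * √(2 * c)) := by
  set Y := e - radialProfile U₀ r with hY
  have hkin : ∀ L, 2 * radialKinetic U₀ e L r = 2 * Y - L / r ^ 2 := by
    intro L
    unfold radialKinetic
    rw [← hY]
    field_simp
  simp only [hkin]
  have hzero : ∀ L, 2 * r ^ 2 * Y ≤ L → ENNReal.ofReal (1 / √(2 * Y - L / r ^ 2)) = 0 := by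
    intro L hL
    rw [Real.sqrt_eq_zero_of_nonpos, div_zero, ENNReal.ofReal_zero]
    rw [sub_nonpos, le_div_iff₀ (by positivity)]
    linarith
  rcases le_or_gt Y 0 with h0 | h0
  · rw [setLIntegral_congr_fun measurableSet_Ioi (g := fun _ => 0) fun L hL => ?_]
    · simp
    · refine hzero L ?_
      have hL' : (0 : ℝ) < L := hL
      nlinarith [sq_nonneg r]
  set A := 2 * r ^ 2 * Y with hA
  have hA0 : 0 < A := by positivity
  have hpos : ∀ L ∈ Ioo 0 A, 0 < 2 * Y - L / r ^ 2 := by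
    intro L hL
    rw [sub_pos, div_lt_iff₀ (by positivity)]
    have := hL.2
    linarith
  -- The integrand is singular at L = A, but this antiderivative is continuous up to there, and its
  -- integrability follows from its sign.
  have hcont : ContinuousOn (fun L => -(2 * r ^ 2) * √(2 * Y - L / r ^ 2)) (Icc 0 A) := by fun_prop
  have hderiv : ∀ L ∈ Ioo 0 A, HasDerivAt (fun L => -(2 * r ^ 2) * √(2 * Y - L / r ^ 2))
      (1 / √(2 * Y - L / r ^ 2)) L := by
    intro L hL
    have h1 : HasDerivAt (fun L : ℝ => 2 * Y - L / r ^ 2) (-(1 / r ^ 2)) L := by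
      simpa using ((hasDerivAt_id L).div_const (r ^ 2)).const_sub (2 * Y)
    refine ((h1.sqrt (hpos L hL).ne').const_mul (-(2 * r ^ 2))).congr_deriv ?_
    have := Real.sqrt_pos.2 (hpos L hL)
    field_simp
  have hnn : ∀ L ∈ Ioo 0 A, 0 ≤ 1 / √(2 * Y - L / r ^ 2) := fun L _ => by positivity
  have hint : IntegrableOn (fun L => 1 / √(2 * Y - L / r ^ 2)) (Ioo 0 A) :=
    (integrableOn_Ioc_iff_integrableOn_Ioo).1
      (intervalIntegral.integrableOn_deriv_of_nonneg hcont hderiv hnn)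
  calc ∫⁻ L in Ioi (0 : ℝ), ENNReal.ofReal (1 / √(2 * Y - L / r ^ 2))
      ≤ ∫⁻ L in Ioo 0 A, ENNReal.ofReal (1 / √(2 * Y - L / r ^ 2)) := by
        rw [← lintegral_indicator measurableSet_Ioi, ← lintegral_indicator measurableSet_Ioo]
        refine lintegral_mono fun L => ?_
        simp only [indicator, mem_Ioi, mem_Ioo]
        by_cases hL : 0 < L
        · by_cases hLA : L < A
          · simp [hL, hLA]
          · rw [if_pos hL, hzero L (not_lt.1 hLA)]
            exact zero_le
        · simp [hL]
    _ = ENNReal.ofReal (2 * r ^ 2 * √(2 * Y)) := by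
        rw [← ofReal_integral_eq_lintegral_ofReal hint (ae_of_all _ fun L => by positivity),
          ← integral_Ioc_eq_integral_Ioo, ← intervalIntegral.integral_of_le hA0.le,
          intervalIntegral.integral_eq_sub_of_hasDerivAt_of_le hA0.le hcont hderiv
            ((intervalIntegrable_iff_integrableOn_Ioo_of_le hA0.le).2 hint)]
        congr 1
        have : 2 * Y - A / r ^ 2 = 0 := by rw [hA]; field_simp; ring
        rw [this]
        simp
    _ ≤ _ := by
        refine ENNReal.ofReal_le_ofReal ?_
        gcongr

/-! ### Truncated potentials of mass profiles -/

/-- The potential generated outside radius `ρ` by the mass profile `m`. -/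
noncomputable def shellPotential (m : ℝ → ℝ) (ρ r : ℝ) : ℝ :=
  -∫ s in Ioi (max r ρ), m s / s ^ 2

/-- Mass profiles with finite field energy `N`. -/
structure IsMassProfile (m : ℝ → ℝ) (N : ℝ) : Prop where
  continuous : Continuous m
  bounded : ∃ M, ∀ s, |m s| ≤ M
  nonneg : 0 ≤ N
  energy : ∫⁻ s in Ioi (0 : ℝ), ENNReal.ofReal (m s ^ 2 / s ^ 2) = ENNReal.ofReal N

namespace IsMassProfile

variable {m : ℝ → ℝ} {N : ℝ} (hm : IsMassProfile m N)
include hm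

lemma measurable_div : Measurable (fun s => m s / s ^ 2) :=
  hm.continuous.measurable.div (by fun_prop)

lemma integrableOn {c : ℝ} (hc : 0 < c) : IntegrableOn (fun s => m s / s ^ 2) (Ioi c) := by
  obtain ⟨M, hM⟩ := hm.bounded
  refine Integrable.mono' ((integral_Ioi_inv_sq hc).1.const_mul M)
    hm.measurable_div.aestronglyMeasurable (ae_of_all _ fun s => ?_)
  rw [Real.norm_eq_abs, abs_div, abs_of_nonneg (sq_nonneg s), mul_one_div]
  exact div_le_div_of_nonneg_right (hM s) (sq_nonneg s)

lemma energy_integrableOn : IntegrableOn (fun s => m s ^ 2 / s ^ 2) (Ioi 0) ∧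
    ∫ s in Ioi (0 : ℝ), m s ^ 2 / s ^ 2 = N := by
  have hmm : Measurable (fun s => m s ^ 2 / s ^ 2) :=
    (hm.continuous.measurable.pow_const 2).div (by fun_prop)
  have hnn : ∀ s : ℝ, 0 ≤ m s ^ 2 / s ^ 2 := fun s => by positivity
  constructor
  · refine ⟨hmm.aestronglyMeasurable, ?_⟩
    rw [hasFiniteIntegral_iff_ofReal (ae_of_all _ hnn), hm.energy]
    exact ENNReal.ofReal_lt_top
  · rw [integral_eq_lintegral_of_nonneg_ae (ae_of_all _ hnn) hmm.aestronglyMeasurable, hm.energy,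
      ENNReal.toReal_ofReal hm.nonneg]

/-- The pointwise bound on the potential by the field energy. -/
lemma integral_abs_le {c : ℝ} (hc : 0 < c) : ∫ s in Ioi c, |m s / s ^ 2| ≤ √(N / c) := by
  have hcs := integral_mul_le_Lp_mul_Lq_of_nonneg (μ := volume.restrict (Ioi c))
    (p := 2) (q := 2) (f := fun s => |m s| / |s|) (g := fun s => 1 / |s|)
    (by constructor <;> norm_num) (ae_of_all _ fun s => by positivity)
    (ae_of_all _ fun s => by positivity) ?_ ?_
  · have hpow : ∀ x : ℝ, x ^ (2 : ℝ) = x ^ 2 := fun x => by norm_cast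
    simp only [hpow, div_pow, sq_abs, one_pow] at hcs
    rw [(integral_Ioi_inv_sq hc).2] at hcs
    have h1 : ∫ s in Ioi c, m s ^ 2 / s ^ 2 ≤ N := by
      rw [← hm.energy_integrableOn.2]
      exact setIntegral_mono_set hm.energy_integrableOn.1 (ae_of_all _ fun s => by positivity)
        (Ioi_subset_Ioi hc.le).eventuallyLE
    have h2 : ∫ s in Ioi c, |m s / s ^ 2| = ∫ s in Ioi c, |m s| / |s| * (1 / |s|) := by
      congr 1
      ext s
      rw [abs_div, abs_pow, div_mul_div_comm, mul_one, sq]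
    rw [h2]
    refine hcs.trans ?_
    rw [← Real.sqrt_eq_rpow, ← Real.sqrt_eq_rpow, ← Real.sqrt_mul
      (integral_nonneg fun s => by positivity)]
    refine Real.sqrt_le_sqrt ?_
    rw [mul_one_div]
    exact div_le_div_of_nonneg_right h1 hc.le
  · rw [show ENNReal.ofReal 2 = 2 by norm_num, memLp_two_iff_integrable_sq]
    · refine (hm.energy_integrableOn.1.mono_set (Ioi_subset_Ioi hc.le)).congr
        (ae_of_all _ fun s => ?_)
      simp only [div_pow, sq_abs]
    · exact (hm.continuous.measurable.abs.div measurable_id.abs).aestronglyMeasurable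
  · rw [show ENNReal.ofReal 2 = 2 by norm_num, memLp_two_iff_integrable_sq]
    · refine (integral_Ioi_inv_sq hc).1.congr (ae_of_all _ fun s => ?_)
      simp only [div_pow, sq_abs, one_pow]
    · exact (measurable_const.div measurable_id.abs).aestronglyMeasurable

lemma abs_shellPotential_le {ρ : ℝ} (hρ : 0 < ρ) (r : ℝ) :
    |shellPotential m ρ r| ≤ √(N / max r ρ) := by
  unfold shellPotential
  rw [abs_neg]
  exact (abs_integral_le_integral_abs).trans (hm.integral_abs_le (lt_max_of_lt_right hρ))

/-- This bound is uniform in ρ and survives shrinking the truncation radius;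
`abs_shellPotential_le_right` is uniform in r and bounds the orbit mean. -/
lemma abs_shellPotential_le_left {ρ : ℝ} (hρ : 0 < ρ) {r : ℝ} (hr : 0 < r) :
    |shellPotential m ρ r| ≤ √(N / r) :=
  (hm.abs_shellPotential_le hρ r).trans (Real.sqrt_le_sqrt
    (div_le_div_of_nonneg_left hm.nonneg hr (le_max_left _ _)))

lemma abs_shellPotential_le_right {ρ : ℝ} (hρ : 0 < ρ) (r : ℝ) :
    |shellPotential m ρ r| ≤ √(N / ρ) :=
  (hm.abs_shellPotential_le hρ r).trans (Real.sqrt_le_sqrt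
    (div_le_div_of_nonneg_left hm.nonneg hρ (le_max_right _ _)))

lemma continuous_shellPotential {ρ : ℝ} (hρ : 0 < ρ) : Continuous (shellPotential m ρ) := by
  have h : ContinuousOn (fun c => -∫ s in Ioi c, m s / s ^ 2) (Ioi 0) := by
    intro c hc
    refine (hasDerivAt_integral_Ioi hc ?_ fun a ha =>
      hm.integrableOn ha).continuousAt.continuousWithinAt
    exact hm.continuous.continuousOn.div (by fun_prop) fun s hs => by
      have : (0 : ℝ) < s := hs
      positivity
  exact h.comp_continuous (continuous_id.max continuous_const) fun r => lt_max_of_lt_right hρ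

lemma shellPotential_sub {ρ : ℝ} (hρ : 0 < ρ) {s r : ℝ} (hsr : s ≤ r) :
    shellPotential m ρ r - shellPotential m ρ s = ∫ t in Ioc (max s ρ) (max r ρ), m t / t ^ 2 := by
  unfold shellPotential
  have h := intervalIntegral.integral_Ioi_sub_Ioi (hm.integrableOn (lt_max_of_lt_right hρ
    (b := s))) (max_le_max_right ρ hsr)
  rw [intervalIntegral.integral_of_le (max_le_max_right ρ hsr)] at h
  rw [← h]
  ring

/-- Truncation only flattens the potential, so its increments are controlled by the full field and
the coercivity constant does not depend on ρ. -/
lemma ofReal_abs_shellPotential_sub_le {ρ : ℝ} (hρ : 0 < ρ) {s r : ℝ} (hsr : s < r) :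
    ENNReal.ofReal |shellPotential m ρ r - shellPotential m ρ s|
      ≤ ∫⁻ t in Ioo s r, ENNReal.ofReal |m t / t ^ 2| := by
  rw [hm.shellPotential_sub hρ hsr.le]
  have hsub : Ioc (max s ρ) (max r ρ) ⊆ Ioi (max s ρ) := fun t ht => ht.1
  have hi := (hm.integrableOn (lt_max_of_lt_right hρ (b := s))).mono_set hsub
  calc ENNReal.ofReal |∫ t in Ioc (max s ρ) (max r ρ), m t / t ^ 2|
      ≤ ENNReal.ofReal (∫ t in Ioc (max s ρ) (max r ρ), |m t / t ^ 2|) :=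
        ENNReal.ofReal_le_ofReal abs_integral_le_integral_abs
    _ = ∫⁻ t in Ioc (max s ρ) (max r ρ), ENNReal.ofReal |m t / t ^ 2| :=
        ofReal_integral_eq_lintegral_ofReal hi.abs (ae_of_all _ fun t => abs_nonneg _)
    _ ≤ ∫⁻ t in Ioc s r, ENNReal.ofReal |m t / t ^ 2| := by
        refine lintegral_mono_set fun t ht => ⟨(le_max_left _ _).trans_lt ht.1, ?_⟩
        rcases le_max_iff.1 ht.2 with h | h
        · exact h
        · exact absurd ((le_max_right s ρ).trans_lt ht.1) (not_lt.2 h)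
    _ = _ := setLIntegral_congr Ioo_ae_eq_Ioc.symm

lemma abs_shellPotential_sub_le {ρ₁ ρ₀ : ℝ} (h10 : ρ₁ ≤ ρ₀) {r : ℝ} (hr : 0 < r) :
    |shellPotential m ρ₁ r - shellPotential m ρ₀ r| ≤ √(N / r) := by
  have hle : max r ρ₁ ≤ max r ρ₀ := max_le_max_left r h10
  have hpos : 0 < max r ρ₁ := lt_max_of_lt_left hr
  have h := intervalIntegral.integral_Ioi_sub_Ioi (hm.integrableOn hpos) hle
  rw [intervalIntegral.integral_of_le hle] at h
  have h2 : shellPotential m ρ₁ r - shellPotential m ρ₀ r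
      = -∫ t in Ioc (max r ρ₁) (max r ρ₀), m t / t ^ 2 := by
    unfold shellPotential
    rw [← h]
    ring
  rw [h2, abs_neg]
  refine abs_integral_le_integral_abs.trans ?_
  refine (setIntegral_mono_set (hm.integrableOn hpos).abs (ae_of_all _ fun t => abs_nonneg _)
    (Ioc_subset_Ioi_self).eventuallyLE).trans ((hm.integral_abs_le hpos).trans
    (Real.sqrt_le_sqrt (div_le_div_of_nonneg_left hm.nonneg hr (le_max_left _ _))))

omit hm in
lemma shellPotential_eq_of_le {ρ₁ ρ₀ r : ℝ} (h10 : ρ₁ ≤ ρ₀) (hr : ρ₀ ≤ r) :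
    shellPotential m ρ₁ r = shellPotential m ρ₀ r := by
  unfold shellPotential
  rw [max_eq_left hr, max_eq_left (h10.trans hr)]

end IsMassProfile

/-! ### Orbit means and the total cost of the displacement -/

/-- The mean of `ψ` over the orbit with energy `levelEnergy E₀ t` and squared angular
momentum `L`, weighted by the time spent at each radius. -/
noncomputable def orbitMean (E₀ : ℝ) (U : Space → ℝ) (ψ : ℝ → ℝ) (p : ℝ × ℝ) : ℝ :=
  (∫ s in Ioi 0, ψ s * (1 / √(2 * radialKinetic U (levelEnergy E₀ p.1) p.2 s)))
    / ∫ s in Ioi 0, 1 / √(2 * radialKinetic U (levelEnergy E₀ p.1) p.2 s)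

/-- No exceptional orbits have to be removed: if the time density is not integrable, the denominator
is 0 by convention and so is the mean. -/
lemma abs_orbitMean_le {E₀ : ℝ} {U : Space → ℝ} {ψ : ℝ → ℝ} {K : ℝ} (hK : ∀ r, |ψ r| ≤ K)
    (p : ℝ × ℝ) : |orbitMean E₀ U ψ p| ≤ K := by
  have hK0 : 0 ≤ K := (abs_nonneg _).trans (hK 0)
  unfold orbitMean
  set k : ℝ → ℝ := fun s => 1 / √(2 * radialKinetic U (levelEnergy E₀ p.1) p.2 s) with hk
  have hk0 : ∀ s, 0 ≤ k s := fun s => by simp only [hk]; positivity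
  by_cases hi : IntegrableOn k (Ioi 0)
  · have hden : 0 ≤ ∫ s in Ioi 0, k s := integral_nonneg hk0
    rw [abs_div, abs_of_nonneg hden]
    refine div_le_of_le_mul₀ hden hK0 ?_
    rw [← integral_const_mul K k, ← Real.norm_eq_abs]
    refine norm_integral_le_of_norm_le (hi.const_mul K) (ae_of_all _ fun s => ?_)
    rw [Real.norm_eq_abs, abs_mul, abs_of_nonneg (hk0 s)]
    exact mul_le_mul_of_nonneg_right (hK s) (hk0 s)
  · rw [integral_undef hi, div_zero, abs_zero]
    exact hK0

lemma lintegral_triple {μ ν κ : Measure ℝ} [SFinite μ] [SFinite ν] [SFinite κ]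
    {F : ℝ × ℝ × ℝ → ℝ≥0∞} (hF : Measurable F) :
    ∫⁻ a, ∫⁻ b, ∫⁻ c, F (a, b, c) ∂κ ∂ν ∂μ = ∫⁻ p, F p ∂(μ.prod (ν.prod κ)) := by
  rw [lintegral_prod _ hF.aemeasurable]
  refine lintegral_congr fun a => ?_
  rw [lintegral_prod]
  exact (hF.comp (measurable_const.prodMk measurable_id)).aemeasurable

lemma lintegral_triple_swap {μ ν κ : Measure ℝ} [SFinite μ] [SFinite ν] [SFinite κ]
    {F : ℝ × ℝ × ℝ → ℝ≥0∞} (hF : Measurable F) :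
    ∫⁻ a, ∫⁻ b, ∫⁻ c, F (a, b, c) ∂κ ∂ν ∂μ = ∫⁻ a, ∫⁻ c, ∫⁻ b, F (a, b, c) ∂ν ∂κ ∂μ := by
  refine lintegral_congr fun a => ?_
  exact lintegral_lintegral_swap (f := fun b c => F (a, b, c))
    (hF.comp (measurable_const.prodMk measurable_id)).aemeasurable

lemma lintegral_triple_rotate {μ ν κ : Measure ℝ} [SFinite μ] [SFinite ν] [SFinite κ]
    {F : ℝ × ℝ × ℝ → ℝ≥0∞} (hF : Measurable F) :
    ∫⁻ a, ∫⁻ b, ∫⁻ c, F (a, b, c) ∂κ ∂ν ∂μ = ∫⁻ b, ∫⁻ a, ∫⁻ c, F (a, b, c) ∂κ ∂μ ∂ν := by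
  refine lintegral_lintegral_swap (f := fun a b => ∫⁻ c, F (a, b, c) ∂κ) (Measurable.aemeasurable ?_)
  exact Measurable.lintegral_prod_right' (f := fun p : (ℝ × ℝ) × ℝ => F (p.1.1, p.1.2, p.2))
    (hF.comp (by fun_prop))

namespace IsKingPotential

variable {E₀ : ℝ} {U₀ : Space → ℝ} (hU : IsKingPotential E₀ U₀)
include hU

lemma continuous_profile : Continuous (radialProfile U₀) :=
  (radialProfile_contDiff hU.contDiff).continuous

lemma measurable_radialKinetic_level :
    Measurable (fun p : ℝ × ℝ × ℝ => radialKinetic U₀ (levelEnergy E₀ p.1) p.2.2 p.2.1) := by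
  have h1 := hU.continuous_profile.measurable
  have h2 := measurable_levelEnergy E₀
  unfold radialKinetic
  fun_prop

lemma measurable_orbitMean {ψ : ℝ → ℝ} (hψ : Measurable ψ) : Measurable (orbitMean E₀ U₀ ψ) := by
  have hk : Measurable (fun q : (ℝ × ℝ) × ℝ =>
      1 / √(2 * radialKinetic U₀ (levelEnergy E₀ q.1.1) q.1.2 q.2)) := by
    have h1 := hU.continuous_profile.measurable
    have h2 := measurable_levelEnergy E₀
    unfold radialKinetic
    fun_prop
  unfold orbitMean
  refine Measurable.div ?_ ?_
  · exact (StronglyMeasurable.integral_prod_right' (f := fun q : (ℝ × ℝ) × ℝ => ψ q.2 *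
      (1 / √(2 * radialKinetic U₀ (levelEnergy E₀ q.1.1) q.1.2 q.2)))
      ((hψ.comp measurable_snd).mul hk).stronglyMeasurable).measurable
  · exact (StronglyMeasurable.integral_prod_right' hk.stronglyMeasurable).measurable

lemma level_sub_profile_le {t r : ℝ} (ht : 0 < t) (hr : 0 ≤ r) :
    levelEnergy E₀ t - radialProfile U₀ r ≤ -radialProfile U₀ 0 := by
  have := levelEnergy_lt (E₀ := E₀) ht
  have := hU.profile_zero_le hr
  have := hU.cutoff_neg
  linarith

/-- Almost every orbit has a finite period. -/
lemma ae_integrableOn_time {t : ℝ} (ht : 0 < t) : ∀ᵐ L ∂(volume.restrict (Ioi (0 : ℝ))),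
    IntegrableOn (fun r => 1 / √(2 * radialKinetic U₀ (levelEnergy E₀ t) L r)) (Ioi 0) := by
  obtain ⟨R, hR, hRu⟩ := hU.exists_radius hU.cutoff_neg
  have hm : Measurable (fun q : ℝ × ℝ =>
      ENNReal.ofReal (1 / √(2 * radialKinetic U₀ (levelEnergy E₀ t) q.1 q.2))) := by
    have h := hU.measurable_radialKinetic_level.comp
      (f := fun q : ℝ × ℝ => (t, q.2, q.1)) (by fun_prop)
    simp only [Function.comp_def] at h
    fun_prop
  have hfin : ∫⁻ L in Ioi (0 : ℝ), ∫⁻ r in Ioi (0 : ℝ),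
      ENNReal.ofReal (1 / √(2 * radialKinetic U₀ (levelEnergy E₀ t) L r)) < ⊤ := by
    -- Integrating over L first removes the turning point singularity and leaves a bounded function
    -- of r that vanishes beyond R.
    rw [lintegral_lintegral_swap hm.aemeasurable]
    calc ∫⁻ r in Ioi (0 : ℝ), ∫⁻ L in Ioi (0 : ℝ),
          ENNReal.ofReal (1 / √(2 * radialKinetic U₀ (levelEnergy E₀ t) L r))
        ≤ ∫⁻ r in Ioi (0 : ℝ), (Ioo 0 R).indicator
            (fun _ => ENNReal.ofReal (2 * R ^ 2 * √(2 * -radialProfile U₀ 0))) r := by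
          refine setLIntegral_mono' measurableSet_Ioi fun r hr => ?_
          have hr0 : (0 : ℝ) < r := hr
          by_cases hrR : r < R
          · rw [indicator_of_mem (show r ∈ Ioo 0 R from ⟨hr0, hrR⟩)]
            refine (lintegral_inv_sqrt_radialKinetic hr0
              (hU.level_sub_profile_le ht hr0.le)).trans (ENNReal.ofReal_le_ofReal ?_)
            gcongr
          · have h1 := hRu r (not_lt.1 hrR)
            have h2 := levelEnergy_lt (E₀ := E₀) ht
            refine (lintegral_inv_sqrt_radialKinetic hr0 (c := 0) (by linarith)).trans ?_
            simp
      _ ≤ ∫⁻ r, (Ioo 0 R).indicator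
            (fun _ => ENNReal.ofReal (2 * R ^ 2 * √(2 * -radialProfile U₀ 0))) r :=
          setLIntegral_le_lintegral _ _
      _ < ⊤ := by
          rw [lintegral_indicator measurableSet_Ioo]
          simp only [lintegral_const, MeasurableSet.univ, Measure.restrict_apply, univ_inter,
            Real.volume_Ioo]
          exact ENNReal.mul_lt_top ENNReal.ofReal_lt_top ENNReal.ofReal_lt_top
  filter_upwards [ae_lt_top hm.lintegral_prod_right' hfin.ne] with L hL
  refine ⟨?_, ?_⟩
  · have h := hU.measurable_radialKinetic_level.comp
      (f := fun r : ℝ => (t, r, L)) (by fun_prop)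
    simp only [Function.comp_def] at h
    exact Measurable.aestronglyMeasurable (by fun_prop)
  · rw [hasFiniteIntegral_iff_ofReal (ae_of_all _ fun r => by positivity)]
    exact hL

variable {m : ℝ → ℝ} {N : ℝ} (hm : IsMassProfile m N)
include hm

/-- The averaged form of the coercivity estimate: fluctuations of the potential along orbits are
controlled by the field energy. -/
lemma lintegral_fluctuation_le {ρ : ℝ} (hρ : 0 < ρ) (T : ℝ) :
    ∫⁻ t in Ioo 0 T, ∫⁻ r in Ioi (0 : ℝ), ∫⁻ L in Ioi (0 : ℝ), ENNReal.ofReal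
        ((shellPotential m ρ r - orbitMean E₀ U₀ (shellPotential m ρ) (t, L)) ^ 2
          * (1 / √(2 * radialKinetic U₀ (levelEnergy E₀ t) L r)))
      ≤ ENNReal.ofReal (3 / (32 * Real.pi ^ 2) * N) := by
  have hpi := Real.pi_pos
  set ψ := shellPotential m ρ with hψ
  have hψm : Measurable ψ := (hm.continuous_shellPotential hρ).measurable
  have hym := hU.measurable_radialKinetic_level
  have hum := hU.continuous_profile.measurable
  have hom := hU.measurable_orbitMean hψm
  have hkd : Measurable (kingDensity E₀) := (kingDensity_antitone E₀).measurable
  set χ : ℝ → ℝ := fun s => m s / s ^ 2 with hχ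
  have hχm : Measurable χ := hm.measurable_div
  have hF : Measurable (fun p : ℝ × ℝ × ℝ => ENNReal.ofReal
      ((ψ p.2.1 - orbitMean E₀ U₀ ψ (p.1, p.2.2)) ^ 2
        * (1 / √(2 * radialKinetic U₀ (levelEnergy E₀ p.1) p.2.2 p.2.1)))) := by
    fun_prop
  have hG : Measurable (fun p : ℝ × ℝ × ℝ => ENNReal.ofReal
      (χ p.2.1 ^ 2 * (3 / (16 * Real.pi * kingDensity E₀ (radialProfile U₀ p.2.1)))
        * √(2 * radialKinetic U₀ (levelEnergy E₀ p.1) p.2.2 p.2.1))) := by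
    fun_prop
  rw [lintegral_triple_swap hF]
  calc ∫⁻ t in Ioo 0 T, ∫⁻ L in Ioi (0 : ℝ), ∫⁻ r in Ioi (0 : ℝ), ENNReal.ofReal
        ((ψ r - orbitMean E₀ U₀ ψ (t, L)) ^ 2
          * (1 / √(2 * radialKinetic U₀ (levelEnergy E₀ t) L r)))
      ≤ ∫⁻ t in Ioo 0 T, ∫⁻ L in Ioi (0 : ℝ), ∫⁻ r in Ioi (0 : ℝ), ENNReal.ofReal
        (χ r ^ 2 * (3 / (16 * Real.pi * kingDensity E₀ (radialProfile U₀ r)))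
          * √(2 * radialKinetic U₀ (levelEnergy E₀ t) L r)) := by
        refine setLIntegral_mono' measurableSet_Ioo fun t ht => ?_
        refine lintegral_mono_ae ?_
        filter_upwards [hU.ae_integrableOn_time ht.1, ae_restrict_mem measurableSet_Ioi]
          with L hL hL0
        exact hU.antonov_orbit (levelEnergy_lt ht.1) hL0 hψm
          (fun r => hm.abs_shellPotential_le_right hρ r) hχm
          (fun s r _ hsr => hm.ofReal_abs_shellPotential_sub_le hρ hsr) hL
    _ ≤ ∫⁻ t in Ioi 0, ∫⁻ L in Ioi (0 : ℝ), ∫⁻ r in Ioi (0 : ℝ), ENNReal.ofReal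
        (χ r ^ 2 * (3 / (16 * Real.pi * kingDensity E₀ (radialProfile U₀ r)))
          * √(2 * radialKinetic U₀ (levelEnergy E₀ t) L r)) :=
        lintegral_mono_set Ioo_subset_Ioi_self
    _ = ∫⁻ r in Ioi (0 : ℝ), ∫⁻ t in Ioi (0 : ℝ), ∫⁻ L in Ioi (0 : ℝ), ENNReal.ofReal
        (χ r ^ 2 * (3 / (16 * Real.pi * kingDensity E₀ (radialProfile U₀ r)))
          * √(2 * radialKinetic U₀ (levelEnergy E₀ t) L r)) := by
        rw [← lintegral_triple_swap hG, lintegral_triple_rotate hG]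
    _ ≤ ∫⁻ r in Ioi (0 : ℝ), ENNReal.ofReal (3 / (32 * Real.pi ^ 2))
          * ENNReal.ofReal (m r ^ 2 / r ^ 2) := by
        refine setLIntegral_mono' measurableSet_Ioi fun r hr => ?_
        have hr0 : (0 : ℝ) < r := hr
        have hd := kingDensity_nonneg E₀ (radialProfile U₀ r)
        have hc : 0 ≤ χ r ^ 2 * (3 / (16 * Real.pi * kingDensity E₀ (radialProfile U₀ r))) := by
          positivity
        simp only [ENNReal.ofReal_mul hc]
        simp only [lintegral_const_mul' _ _ ENNReal.ofReal_ne_top]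
        rw [lintegral_sqrt_radialKinetic E₀ hr0, ← ENNReal.ofReal_mul hc,
          ← ENNReal.ofReal_mul (by positivity)]
        refine ENNReal.ofReal_le_ofReal ?_
        -- Where the density vanishes the coefficient 3/(16πρ₀) reads as 0; elsewhere the density
        -- cancels.
        rcases hd.eq_or_lt with h | h
        · rw [← h]
          simp only [mul_zero]
          positivity
        · refine le_of_eq ?_
          simp only [hχ]
          field_simp
          ring
    _ = _ := by
        rw [lintegral_const_mul' _ _ ENNReal.ofReal_ne_top, hm.energy,
          ← ENNReal.ofReal_mul (by positivity)]

/-- Truncating the potential near the centre costs little. -/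
lemma lintegral_truncation_le {ρ₁ ρ₀ T : ℝ} (hρ₁ : 0 < ρ₁) (h10 : ρ₁ ≤ ρ₀) :
    ∫⁻ t in Ioo 0 T, ∫⁻ r in Ioi (0 : ℝ), ∫⁻ L in Ioi (0 : ℝ), ENNReal.ofReal
        ((shellPotential m ρ₁ r - shellPotential m ρ₀ r) ^ 2
          * (1 / √(2 * radialKinetic U₀ (levelEnergy E₀ t) L r)))
      ≤ ENNReal.ofReal (T * ρ₀ ^ 2 * (2 * √(2 * -radialProfile U₀ 0)) * N) := by
  have hN := hm.nonneg
  have hρ₀ : 0 < ρ₀ := hρ₁.trans_le h10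
  set c := √(2 * -radialProfile U₀ 0)
  have hc : 0 ≤ c := Real.sqrt_nonneg _
  have key : ∀ t ∈ Ioo 0 T, ∀ r ∈ Ioi (0 : ℝ), ∫⁻ L in Ioi (0 : ℝ), ENNReal.ofReal
        ((shellPotential m ρ₁ r - shellPotential m ρ₀ r) ^ 2
          * (1 / √(2 * radialKinetic U₀ (levelEnergy E₀ t) L r)))
      ≤ (Ioo 0 ρ₀).indicator (fun _ => ENNReal.ofReal (ρ₀ * (2 * c) * N)) r := by
    intro t ht r hr
    have hr0 : (0 : ℝ) < r := hr
    by_cases hrρ : r < ρ₀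
    · rw [indicator_of_mem (show r ∈ Ioo 0 ρ₀ from ⟨hr0, hrρ⟩)]
      simp only [ENNReal.ofReal_mul (sq_nonneg _)]
      rw [lintegral_const_mul' _ _ ENNReal.ofReal_ne_top]
      refine (mul_le_mul_right (lintegral_inv_sqrt_radialKinetic hr0
        (hU.level_sub_profile_le ht.1 hr0.le)) _).trans ?_
      rw [← ENNReal.ofReal_mul (sq_nonneg _)]
      refine ENNReal.ofReal_le_ofReal ?_
      have h1 := hm.abs_shellPotential_sub_le h10 hr0
      have h2 : (shellPotential m ρ₁ r - shellPotential m ρ₀ r) ^ 2 ≤ N / r := by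
        rw [← sq_abs]
        calc _ ≤ √(N / r) ^ 2 := by gcongr
          _ = N / r := Real.sq_sqrt (by positivity)
      calc _ ≤ N / r * (2 * r ^ 2 * c) := by gcongr
        _ = r * (2 * c) * N := by field_simp
        _ ≤ _ := by gcongr
    · rw [IsMassProfile.shellPotential_eq_of_le h10 (not_lt.1 hrρ)]
      simp
  calc _ ≤ ∫⁻ t in Ioo 0 T, ∫⁻ r in Ioi (0 : ℝ),
        (Ioo 0 ρ₀).indicator (fun _ => ENNReal.ofReal (ρ₀ * (2 * c) * N)) r :=
        setLIntegral_mono' measurableSet_Ioo fun t ht =>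
          setLIntegral_mono' measurableSet_Ioi fun r hr => key t ht r hr
    _ ≤ ∫⁻ t in Ioo 0 T, ∫⁻ r,
        (Ioo 0 ρ₀).indicator (fun _ => ENNReal.ofReal (ρ₀ * (2 * c) * N)) r :=
        lintegral_mono fun t => setLIntegral_le_lintegral _ _
    _ = _ := by
        rw [lintegral_indicator measurableSet_Ioo]
        simp only [lintegral_const, MeasurableSet.univ, Measure.restrict_apply, univ_inter,
          Real.volume_Ioo, sub_zero]
        rw [← ENNReal.ofReal_mul (by positivity), ← ENNReal.ofReal_mul (by positivity)]
        congr 1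
        ring

end IsKingPotential

/-- The radial kinetic energy is affine in L with slope -1/(2r²), so a band of width 2G is an
interval of length 4r²G in L. -/
lemma volume_radialKinetic_band_le {U : Space → ℝ} {e r G : ℝ} (hr : 0 < r) {c : ℝ} (hc : 0 ≤ c) :
    ∫⁻ L in Ioi (0 : ℝ), (Icc (-G) G).indicator (fun _ => ENNReal.ofReal c) (radialKinetic U e L r)
      ≤ ENNReal.ofReal (4 * r ^ 2 * G * c) := by
  set Y := e - radialProfile U r with hY
  calc _ ≤ ∫⁻ L, (Icc (2 * r ^ 2 * (Y - G)) (2 * r ^ 2 * (Y + G))).indicator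
        (fun _ => ENNReal.ofReal c) L := by
        refine (setLIntegral_le_lintegral _ _).trans (lintegral_mono fun L => ?_)
        by_cases hL : radialKinetic U e L r ∈ Icc (-G) G
        · have hmem : L ∈ Icc (2 * r ^ 2 * (Y - G)) (2 * r ^ 2 * (Y + G)) := by
            unfold radialKinetic at hL
            rw [← hY] at hL
            obtain ⟨h1, h2⟩ := hL
            have h3 : L / (2 * r ^ 2) ≤ Y + G := by linarith
            have h4 : Y - G ≤ L / (2 * r ^ 2) := by linarith
            rw [div_le_iff₀ (by positivity)] at h3
            rw [le_div_iff₀ (by positivity)] at h4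
            constructor <;> linarith
          simp only [indicator_of_mem hL, indicator_of_mem hmem, le_refl]
        · simp only [indicator_of_notMem hL, zero_le]
    _ = _ := by
        rw [lintegral_indicator measurableSet_Icc]
        simp only [lintegral_const, MeasurableSet.univ, Measure.restrict_apply, univ_inter,
          Real.volume_Icc]
        rw [← ENNReal.ofReal_mul hc]
        congr 1
        ring

namespace IsKingPotential

variable {E₀ : ℝ} {U₀ : Space → ℝ} (hU : IsKingPotential E₀ U₀)
include hU

/-- The contribution of phase space points close to the boundary of an energy level. -/
lemma lintegral_band_le {N ρ R T : ℝ} (hN : 0 ≤ N) (hρ : 0 < ρ) (hR : 0 < R)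
    (hRu : ∀ r, R ≤ r → E₀ / 2 < radialProfile U₀ r)
    (hNR : N * (2 * (1 + R / ρ)) / R ≤ (E₀ / 12) ^ 2) :
    ∫⁻ t in Ioo 0 T, ∫⁻ r in Ioi (0 : ℝ), ∫⁻ L in Ioi (0 : ℝ),
        (Icc (-(6 * (√(N / r) + √(N / ρ)))) (6 * (√(N / r) + √(N / ρ)))).indicator
          (fun _ => ENNReal.ofReal (7 * ((√(N / r) + √(N / ρ)) * √(√(N / r) + √(N / ρ)))))
          (radialKinetic U₀ (levelEnergy E₀ t) L r)
      ≤ ENNReal.ofReal (T * R * (168 * (N * (2 * (1 + R / ρ)) *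
          √(√(R ^ 3 * (N * (2 * (1 + R / ρ)))))))) := by
  have hE := hU.cutoff_neg
  set A := 2 * (1 + R / ρ) with hA
  have hA0 : 0 ≤ A := by positivity
  have hsq : ∀ r, 0 < r → (√(N / r) + √(N / ρ)) ^ 2 ≤ 2 * (N / r + N / ρ) := by
    intro r hr
    have h1 := Real.sq_sqrt (show 0 ≤ N / r by positivity)
    have h2 := Real.sq_sqrt (show 0 ≤ N / ρ by positivity)
    nlinarith [sq_nonneg (√(N / r) - √(N / ρ))]
  have key : ∀ t ∈ Ioo 0 T, ∀ r ∈ Ioi (0 : ℝ), ∫⁻ L in Ioi (0 : ℝ),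
        (Icc (-(6 * (√(N / r) + √(N / ρ)))) (6 * (√(N / r) + √(N / ρ)))).indicator
          (fun _ => ENNReal.ofReal (7 * ((√(N / r) + √(N / ρ)) * √(√(N / r) + √(N / ρ)))))
          (radialKinetic U₀ (levelEnergy E₀ t) L r)
      ≤ (Ioo 0 R).indicator (fun _ => ENNReal.ofReal (168 * (N * A * √(√(R ^ 3 * (N * A)))))) r := by
    intro t ht r hr
    have hr0 : (0 : ℝ) < r := hr
    have hs := hsq r hr0
    set G := √(N / r) + √(N / ρ) with hG
    have hG0 : 0 ≤ G := by positivity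
    by_cases hrR : r < R
    · rw [indicator_of_mem (show r ∈ Ioo 0 R from ⟨hr0, hrR⟩)]
      refine (volume_radialKinetic_band_le hr0 (by positivity)).trans (ENNReal.ofReal_le_ofReal ?_)
      -- The layer contributes r²G^(5/2) = (rG²)(r√G). The first factor is O(N), the second
      -- O(N^(1/4)), which makes the total superlinear in N.
      have h1 : r * G ^ 2 ≤ N * A := by
        calc r * G ^ 2 ≤ r * (2 * (N / r + N / ρ)) := by gcongr
          _ = N * (2 * (1 + r / ρ)) := by field_simp
          _ ≤ N * A := by rw [hA]; gcongr
      have h2 : r * √G ≤ √(√(R ^ 3 * (N * A))) := by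
        refine Real.le_sqrt_of_sq_le (Real.le_sqrt_of_sq_le ?_)
        calc ((r * √G) ^ 2) ^ 2 = r ^ 3 * (r * (√G ^ 2) ^ 2) := by ring
          _ = r ^ 3 * (r * G ^ 2) := by rw [Real.sq_sqrt hG0]
          _ ≤ R ^ 3 * (N * A) := by gcongr
      calc 4 * r ^ 2 * (6 * G) * (7 * (G * √G)) = 168 * ((r * G ^ 2) * (r * √G)) := by ring
        _ ≤ _ := by gcongr
    · have hrR' := not_lt.1 hrR
      -- Beyond R the radial kinetic energy is below E₀/2, while the band reaches down only to -6G ≥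
      -- E₀/2.
      have hGE : G ≤ -E₀ / 12 := by
        refine abs_le_of_sq_le_sq' ?_ (by linarith) |>.2
        calc G ^ 2 ≤ 2 * (N / r + N / ρ) := hs
          _ ≤ 2 * (N / R + N / ρ) := by gcongr
          _ = N * A / R := by rw [hA]; field_simp
          _ ≤ _ := by convert hNR using 1; ring
      rw [setLIntegral_congr_fun measurableSet_Ioi (g := fun _ => 0) fun L hL => ?_]
      · simp
      · refine indicator_of_notMem (fun hmem => ?_) _
        have h1 := hmem.1
        unfold radialKinetic at h1
        have hL0 : (0 : ℝ) < L := hL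
        have h2 : 0 < L / (2 * r ^ 2) := by positivity
        have h3 := hRu r hrR'
        have h4 := levelEnergy_lt (E₀ := E₀) ht.1
        linarith
  calc _ ≤ ∫⁻ t in Ioo 0 T, ∫⁻ r in Ioi (0 : ℝ), (Ioo 0 R).indicator
        (fun _ => ENNReal.ofReal (168 * (N * A * √(√(R ^ 3 * (N * A)))))) r :=
        setLIntegral_mono' measurableSet_Ioo fun t ht =>
          setLIntegral_mono' measurableSet_Ioi fun r hr => key t ht r hr
    _ ≤ ∫⁻ t in Ioo 0 T, ∫⁻ r, (Ioo 0 R).indicator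
        (fun _ => ENNReal.ofReal (168 * (N * A * √(√(R ^ 3 * (N * A)))))) r :=
        lintegral_mono fun t => setLIntegral_le_lintegral _ _
    _ = _ := by
        rw [lintegral_indicator measurableSet_Ioo]
        simp only [lintegral_const, MeasurableSet.univ, Measure.restrict_apply, univ_inter,
          Real.volume_Ioo, sub_zero]
        rw [← ENNReal.ofReal_mul (by positivity), ← ENNReal.ofReal_mul (by positivity)]
        congr 1
        ring

/-- The total cost of the level displacement for a fixed potential perturbation, split into the
orbital fluctuation, the central truncation and the boundary layer. -/
lemma lintegral_levelCost_total_le {m : ℝ → ℝ} {N : ℝ} (hm : IsMassProfile m N)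
    {ρ₁ ρ R T : ℝ} (hρ₁ : 0 < ρ₁) (h1 : ρ₁ ≤ ρ) (hR : 0 < R)
    (hRu : ∀ r, R ≤ r → E₀ / 2 < radialProfile U₀ r)
    (hNR : N * (2 * (1 + R / ρ)) / R ≤ (E₀ / 12) ^ 2) :
    ∫⁻ t in Ioo 0 T, ∫⁻ r in Ioi (0 : ℝ), ∫⁻ L in Ioi (0 : ℝ), ∫⁻ w, ENNReal.ofReal
        (levelCost (radialKinetic U₀ (levelEnergy E₀ t) L r)
          (shellPotential m ρ₁ r - orbitMean E₀ U₀ (shellPotential m ρ) (t, L)) w)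
      ≤ ENNReal.ofReal (5 / 4) * ENNReal.ofReal (3 / (32 * Real.pi ^ 2) * N)
        + (ENNReal.ofReal (45 / 4) *
            ENNReal.ofReal (T * ρ ^ 2 * (2 * √(2 * -radialProfile U₀ 0)) * N)
          + ENNReal.ofReal (T * R * (168 * (N * (2 * (1 + R / ρ)) *
            √(√(R ^ 3 * (N * (2 * (1 + R / ρ))))))))) := by
  have hρ : 0 < ρ := hρ₁.trans_le h1
  have hψ₁ : Measurable (shellPotential m ρ₁) := (hm.continuous_shellPotential hρ₁).measurable
  have hψ : Measurable (shellPotential m ρ) := (hm.continuous_shellPotential hρ).measurable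
  have hom := hU.measurable_orbitMean hψ
  have hym := hU.measurable_radialKinetic_level
  set y : ℝ × ℝ × ℝ → ℝ := fun p => radialKinetic U₀ (levelEnergy E₀ p.1) p.2.2 p.2.1 with hy
  set FA : ℝ × ℝ × ℝ → ℝ≥0∞ := fun p => ENNReal.ofReal
    ((shellPotential m ρ p.2.1 - orbitMean E₀ U₀ (shellPotential m ρ) (p.1, p.2.2)) ^ 2
      * (1 / √(2 * y p))) with hFA
  set FB : ℝ × ℝ × ℝ → ℝ≥0∞ := fun p => ENNReal.ofReal
    ((shellPotential m ρ₁ p.2.1 - shellPotential m ρ p.2.1) ^ 2 * (1 / √(2 * y p))) with hFB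
  set G : ℝ → ℝ := fun r => √(N / r) + √(N / ρ) with hG
  set FC : ℝ × ℝ × ℝ → ℝ≥0∞ := fun p => (Icc (-(6 * G p.2.1)) (6 * G p.2.1)).indicator
    (fun _ => ENNReal.ofReal (7 * (G p.2.1 * √(G p.2.1)))) (y p) with hFC
  have hFAm : Measurable FA := by fun_prop
  have hFBm : Measurable FB := by fun_prop
  have hFCm : Measurable FC := by
    have : FC = fun p => {p : ℝ × ℝ × ℝ | -(6 * G p.2.1) ≤ y p ∧ y p ≤ 6 * G p.2.1}.indicator
        (fun p => ENNReal.ofReal (7 * (G p.2.1 * √(G p.2.1)))) p := by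
      ext p
      simp only [hFC, indicator, mem_Icc, mem_ofPred_eq]
    rw [this]
    refine Measurable.indicator (by fun_prop) ?_
    exact (measurableSet_le (by fun_prop) hym).inter (measurableSet_le hym (by fun_prop))
  have hpt : ∀ t, ∀ r ∈ Ioi (0 : ℝ), ∀ L, ∫⁻ w, ENNReal.ofReal
        (levelCost (radialKinetic U₀ (levelEnergy E₀ t) L r)
          (shellPotential m ρ₁ r - orbitMean E₀ U₀ (shellPotential m ρ) (t, L)) w)
      ≤ ENNReal.ofReal (5 / 4) * FA (t, r, L)
        + (ENNReal.ofReal (45 / 4) * FB (t, r, L) + FC (t, r, L)) := by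
    intro t r hr L
    have hr0 : (0 : ℝ) < r := hr
    have hb : |shellPotential m ρ₁ r - orbitMean E₀ U₀ (shellPotential m ρ) (t, L)| ≤ G r := by
      refine (abs_sub _ _).trans (add_le_add (hm.abs_shellPotential_le_left hρ₁ hr0) ?_)
      exact abs_orbitMean_le (fun s => hm.abs_shellPotential_le_right hρ s) _
    refine (lintegral_levelCost_le hb).trans ?_
    rw [← add_assoc]
    refine add_le_add ?_ le_rfl
    simp only [hFA, hFB]
    rw [← ENNReal.ofReal_mul (by norm_num), ← ENNReal.ofReal_mul (by norm_num),
      ← ENNReal.ofReal_add (by positivity) (by positivity)]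
    refine ENNReal.ofReal_le_ofReal ?_
    simp only [hy]
    set k := √(2 * radialKinetic U₀ (levelEnergy E₀ t) L r)
    have hk : 0 ≤ 1 / k := by positivity
    set a := shellPotential m ρ r - orbitMean E₀ U₀ (shellPotential m ρ) (t, L) with ha
    set b := shellPotential m ρ₁ r - shellPotential m ρ r with hb'
    have hab : shellPotential m ρ₁ r - orbitMean E₀ U₀ (shellPotential m ρ) (t, L) = a + b := by
      rw [ha, hb']; ring
    rw [hab]
    -- The difference of the two sides is (a - 9b)²/8. The weights keep the coefficient of the
    -- orbital part near 9/8: with 3/8 from the coercivity estimate it gives 15/32 < 1/2.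
    have : 9 / 8 * (a + b) ^ 2 ≤ 5 / 4 * a ^ 2 + 45 / 4 * b ^ 2 := by
      nlinarith [sq_nonneg (a - 9 * b)]
    calc 9 / 8 * ((a + b) ^ 2 / k) = 9 / 8 * (a + b) ^ 2 * (1 / k) := by ring
      _ ≤ (5 / 4 * a ^ 2 + 45 / 4 * b ^ 2) * (1 / k) := by gcongr
      _ = _ := by ring
  calc _ ≤ ∫⁻ t in Ioo 0 T, ∫⁻ r in Ioi (0 : ℝ), ∫⁻ L in Ioi (0 : ℝ),
        (ENNReal.ofReal (5 / 4) * FA (t, r, L)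
        + (ENNReal.ofReal (45 / 4) * FB (t, r, L) + FC (t, r, L))) :=
        lintegral_mono fun t => setLIntegral_mono' measurableSet_Ioi fun r hr =>
          lintegral_mono fun L => hpt t r hr L
    _ = ENNReal.ofReal (5 / 4) *
          (∫⁻ t in Ioo 0 T, ∫⁻ r in Ioi (0 : ℝ), ∫⁻ L in Ioi (0 : ℝ), FA (t, r, L))
        + (ENNReal.ofReal (45 / 4) *
          (∫⁻ t in Ioo 0 T, ∫⁻ r in Ioi (0 : ℝ), ∫⁻ L in Ioi (0 : ℝ), FB (t, r, L))
          + ∫⁻ t in Ioo 0 T, ∫⁻ r in Ioi (0 : ℝ), ∫⁻ L in Ioi (0 : ℝ), FC (t, r, L)) := by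
        rw [lintegral_triple hFAm, lintegral_triple hFBm, lintegral_triple hFCm,
          lintegral_triple (F := fun p => ENNReal.ofReal (5 / 4) * FA p
            + (ENNReal.ofReal (45 / 4) * FB p + FC p)) (by fun_prop),
          lintegral_add_left (by fun_prop), lintegral_add_left (by fun_prop),
          lintegral_const_mul _ hFAm, lintegral_const_mul _ hFBm]
    _ ≤ _ := by
        refine add_le_add (mul_le_mul_right (hU.lintegral_fluctuation_le hm hρ T) _)
          (add_le_add (mul_le_mul_right (hU.lintegral_truncation_le hm hρ₁ h1) _) ?_)
        exact hU.lintegral_band_le hm.nonneg hρ hR hRu hNR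

/-- For weak perturbations the level displacement costs at most `31/64` of the field energy. -/
lemma exists_levelCost_bound {T : ℝ} (hT : 0 ≤ T) :
    ∃ N₀ : ℝ, 0 < N₀ ∧ ∃ ρ : ℝ, 0 < ρ ∧ ∀ (m : ℝ → ℝ) (N : ℝ), IsMassProfile m N → N ≤ N₀ →
      ∀ ρ₁, 0 < ρ₁ → ρ₁ ≤ ρ → ENNReal.ofReal (4 * Real.pi ^ 2) *
        ∫⁻ t in Ioo 0 T, ∫⁻ r in Ioi (0 : ℝ), ∫⁻ L in Ioi (0 : ℝ), ∫⁻ w, ENNReal.ofReal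
          (levelCost (radialKinetic U₀ (levelEnergy E₀ t) L r)
            (shellPotential m ρ₁ r - orbitMean E₀ U₀ (shellPotential m ρ) (t, L)) w)
        ≤ ENNReal.ofReal (31 / 64 * N) := by
  have hpi := Real.pi_pos
  have hE := hU.cutoff_neg
  obtain ⟨R, hR, hRu⟩ := hU.exists_radius (show E₀ / 2 < 0 by linarith)
  set c := √(2 * -radialProfile U₀ 0) with hc
  -- The truncation radius is fixed first, since the constant A of the boundary layer depends on it;
  -- N₀ is chosen afterwards. Each error is allowed 1/128.
  obtain ⟨ρ, hρ, hρc⟩ : ∃ ρ : ℝ, 0 < ρ ∧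
      4 * Real.pi ^ 2 * (45 / 4 * (T * ρ ^ 2 * (2 * c))) ≤ 1 / 128 := by
    have hcont : Tendsto (fun ρ : ℝ => 4 * Real.pi ^ 2 * (45 / 4 * (T * ρ ^ 2 * (2 * c))))
        (𝓝[>] 0) (𝓝 (4 * Real.pi ^ 2 * (45 / 4 * (T * 0 ^ 2 * (2 * c))))) :=
      Tendsto.mono_left (Continuous.tendsto (by fun_prop) 0) nhdsWithin_le_nhds
    have hev := hcont.eventually (gt_mem_nhds (show _ < (1 / 128 : ℝ) by norm_num))
    obtain ⟨ρ, h1, h2⟩ := (hev.and self_mem_nhdsWithin).exists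
    exact ⟨ρ, h2, h1.le⟩
  set A := 2 * (1 + R / ρ) with hA
  obtain ⟨N₀, hN₀, hN₀'⟩ : ∃ N₀ : ℝ, 0 < N₀ ∧ ∀ N, 0 ≤ N → N ≤ N₀ →
      N * A / R ≤ (E₀ / 12) ^ 2 ∧
      4 * Real.pi ^ 2 * (T * R * (168 * (A * √(√(R ^ 3 * (N * A)))))) ≤ 1 / 128 := by
    have h1 : Tendsto (fun N : ℝ => N * A / R) (𝓝 0) (𝓝 (0 * A / R)) :=
      Continuous.tendsto (by fun_prop) 0
    have h2 : Tendsto (fun N : ℝ =>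
        4 * Real.pi ^ 2 * (T * R * (168 * (A * √(√(R ^ 3 * (N * A))))))) (𝓝 0)
        (𝓝 (4 * Real.pi ^ 2 * (T * R * (168 * (A * √(√(R ^ 3 * (0 * A)))))))) :=
      Continuous.tendsto (by fun_prop) 0
    have hev := (h1.eventually (gt_mem_nhds (show _ < (E₀ / 12) ^ 2 by
      rw [zero_mul, zero_div]; exact sq_pos_of_neg (by linarith)))).and
      (h2.eventually (gt_mem_nhds (show _ < (1 / 128 : ℝ) by simp)))
    obtain ⟨ε, hε, hball⟩ := Metric.eventually_nhds_iff.1 hev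
    refine ⟨ε / 2, by positivity, fun N hN0 hN => ?_⟩
    have := hball (y := N) (by rw [Real.dist_0_eq_abs, abs_of_nonneg hN0]; linarith)
    exact ⟨this.1.le, this.2.le⟩
  refine ⟨N₀, hN₀, ρ, hρ, fun m N hm hN ρ₁ hρ₁ h1 => ?_⟩
  obtain ⟨hNa, hNb⟩ := hN₀' N hm.nonneg hN
  have hN0 := hm.nonneg
  have hc0 : 0 ≤ c := Real.sqrt_nonneg _
  refine (mul_le_mul_right (hU.lintegral_levelCost_total_le hm hρ₁ h1 hR hRu hNa) _).trans ?_
  rw [← ENNReal.ofReal_mul (by norm_num), ← ENNReal.ofReal_mul (by norm_num),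
    ← ENNReal.ofReal_add (by positivity) (by positivity),
    ← ENNReal.ofReal_add (by positivity) (by positivity), ← ENNReal.ofReal_mul (by positivity)]
  refine ENNReal.ofReal_le_ofReal ?_
  have h2 := mul_le_mul_of_nonneg_right hρc hN0
  have h3 := mul_le_mul_of_nonneg_right hNb hN0
  -- In total 15/32 + 1/128 + 1/128 = 31/64.
  have h4 : 4 * Real.pi ^ 2 * (5 / 4 * (3 / (32 * Real.pi ^ 2) * N)) = 15 / 32 * N := by
    field_simp
    ring
  rw [mul_add, mul_add, h4]
  linarith

end IsKingPotential

/-! ### The duality estimate for rearrangements -/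

lemma ofReal_integral_le_lintegral {α : Type*} [MeasurableSpace α] {μ : Measure α} {g : α → ℝ}
    (hg : Integrable g μ) : ENNReal.ofReal (∫ x, g x ∂μ) ≤ ∫⁻ x, ENNReal.ofReal (g x) ∂μ := by
  calc ENNReal.ofReal (∫ x, g x ∂μ) ≤ ENNReal.ofReal (∫ x, max (g x) 0 ∂μ) :=
        ENNReal.ofReal_le_ofReal (integral_mono hg hg.pos_part fun x => le_max_left _ _)
    _ = ∫⁻ x, ENNReal.ofReal (max (g x) 0) ∂μ :=
        ofReal_integral_eq_lintegral_ofReal hg.pos_part (ae_of_all _ fun x => le_max_right _ _)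
    _ = _ := by simp

lemma massIn_eq_integral {f : Phase → ℝ} (hi : Integrable f) (s : ℝ) :
    ∫ z, {z : Phase | ‖z.1‖ < s}.indicator f z = massIn f s := by
  have hS : MeasurableSet {z : Phase | ‖z.1‖ < s} := measurableSet_lt (by fun_prop) (by fun_prop)
  have hi' := hi.indicator hS
  rw [Measure.volume_eq_prod] at hi' ⊢
  rw [integral_prod _ hi', massIn, ← integral_indicator measurableSet_ball]
  refine integral_congr_ae (ae_of_all _ fun x => ?_)
  by_cases hx : ‖x‖ < s
  · simp [indicator, hx, spatialDensity]
  · simp [indicator, hx]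

/-- The potential energy of a state in the field of a mass profile. -/
lemma integral_shellPotential_mul {f : Phase → ℝ} (hi : Integrable f) {m : ℝ → ℝ} {ρ : ℝ}
    (hm : IntegrableOn (fun s => m s / s ^ 2) (Ioi ρ)) :
    ∫ z, shellPotential m ρ ‖z.1‖ * f z = -∫ s in Ioi ρ, m s / s ^ 2 * massIn f s := by
  set g : ℝ → ℝ := fun s => m s / s ^ 2
  set S : Set (Phase × ℝ) := {p | ‖p.1.1‖ < p.2} with hS
  have hSm : MeasurableSet S := measurableSet_lt (by fun_prop) (by fun_prop)
  have hint : Integrable (S.indicator (fun p : Phase × ℝ => f p.1 * g p.2))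
      (volume.prod (volume.restrict (Ioi ρ))) := (hi.mul_prod hm).indicator hSm
  have h1 : ∀ z : Phase, shellPotential m ρ ‖z.1‖ * f z
      = -∫ s in Ioi ρ, S.indicator (fun p : Phase × ℝ => f p.1 * g p.2) (z, s) := by
    intro z
    have h2 : ∀ s, S.indicator (fun p : Phase × ℝ => f p.1 * g p.2) (z, s)
        = f z * (Ioi ‖z.1‖).indicator g s := by
      intro s
      by_cases hs : ‖z.1‖ < s <;> simp [S, indicator, hs]
    simp only [h2]
    rw [integral_const_mul, setIntegral_indicator measurableSet_Ioi, Ioi_inter_Ioi,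
      shellPotential, sup_comm]
    ring
  simp only [h1]
  rw [integral_neg, integral_integral_swap
    (f := fun z s => S.indicator (fun p : Phase × ℝ => f p.1 * g p.2) (z, s)) hint]
  congr 1
  refine integral_congr_ae (ae_of_all _ fun s => ?_)
  simp only
  rw [← massIn_eq_integral hi, ← integral_const_mul]
  refine integral_congr_ae (ae_of_all _ fun z => ?_)
  by_cases hs : ‖z.1‖ < s
  · simp [S, g, indicator, hs, mul_comm]
  · simp [S, indicator, hs]

/-- The cost of moving the energy level `e` by `g` at a point with energy `E`. -/
noncomputable def energyCost (E e g : ℝ) : ℝ :=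
  if E < e then max (E - e + g) 0 else max (-(E - e + g)) 0

lemma measurable_energyCost : Measurable (fun p : ℝ × ℝ × ℝ => energyCost p.1 p.2.1 p.2.2) := by
  unfold energyCost
  exact Measurable.ite (measurableSet_lt (by fun_prop) (by fun_prop)) (by fun_prop) (by fun_prop)

/-- In the reduced variables E - e = w²/2 - y, with y the radial kinetic energy. -/
lemma energyCost_eq_levelCost (U : Space → ℝ) (e L r g w : ℝ) :
    energyCost ((w ^ 2 + L / r ^ 2) / 2 + radialProfile U r) e g
      = levelCost (radialKinetic U e L r) g w := by
  have h : L / (2 * r ^ 2) = L / r ^ 2 / 2 := by rw [mul_comm, div_div]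
  unfold energyCost levelCost radialKinetic
  rw [h]
  have hc : ((w ^ 2 + L / r ^ 2) / 2 + radialProfile U r < e)
      = (w ^ 2 / 2 < e - radialProfile U r - L / r ^ 2 / 2) :=
    propext ⟨fun h => by linarith, fun h => by linarith⟩
  have hv : (w ^ 2 + L / r ^ 2) / 2 + radialProfile U r - e
      = w ^ 2 / 2 - (e - radialProfile U r - L / r ^ 2 / 2) := by ring
  simp only [hc, hv]

/-- The pointwise duality inequality: replacing the King value by `a` is bounded by the cost of
moving the levels in between. -/
lemma ofReal_level_exchange_le {E₀ E T a ψ K : ℝ} {η : ℝ → ℝ} (hη : Measurable η)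
    (hK : ∀ t, |η t| ≤ K) (ha : 0 ≤ a) (haT : a ≤ T)
    (hbT : max (Real.exp (E₀ - E) - 1) 0 ≤ T) :
    ENNReal.ofReal ((E + ψ) * (max (Real.exp (E₀ - E) - 1) 0 - a)
        - (E₀ * (max (Real.exp (E₀ - E) - 1) 0 - a)
          - (kingCasimir (max (Real.exp (E₀ - E) - 1) 0) - kingCasimir a))
        - ((∫ t in Ioo 0 (max (Real.exp (E₀ - E) - 1) 0), η t) - ∫ t in Ioo 0 a, η t))
      ≤ ∫⁻ t in Ioo 0 T, ENNReal.ofReal (energyCost E (levelEnergy E₀ t) (ψ - η t)) := by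
  have hking : ∀ t, 0 ≤ t → (t < max (Real.exp (E₀ - E) - 1) 0 ↔ E < levelEnergy E₀ t) :=
    fun t ht => lt_king_iff ht
  set b := max (Real.exp (E₀ - E) - 1) 0 with hb
  have hb0 : 0 ≤ b := le_max_right _ _
  have hηi : ∀ x y : ℝ, IntervalIntegrable η volume x y := by
    intro x y
    exact (intervalIntegrable_const (c := K)).mono_fun' hη.aestronglyMeasurable (ae_of_all _ hK)
  have hpos : ∀ t ∈ uIcc a b, 0 ≤ t := fun t ht => (le_min ha hb0).trans ht.1
  have hec : ContinuousOn (levelEnergy E₀) (uIcc a b) := by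
    refine continuousOn_const.sub (ContinuousOn.log (by fun_prop) fun t ht => ?_)
    have := hpos t ht
    linarith
  have hei : IntervalIntegrable (levelEnergy E₀) volume a b := hec.intervalIntegrable
  -- As Φ₀'(t) = ln(1 + t), an antiderivative of the level energy is E₀t - Φ₀(t).
  have he : ∫ t in a..b, levelEnergy E₀ t = E₀ * (b - a) - (kingCasimir b - kingCasimir a) := by
    rw [intervalIntegral.integral_eq_sub_of_hasDerivAt (f := fun t => E₀ * t - kingCasimir t)
      (fun t ht => ?_) hei]
    · ring
    · have := hpos t ht
      have hd := ((hasDerivAt_id t).const_mul E₀).sub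
        (hasDerivAt_kingCasimir (show -1 < t by linarith))
      exact hd.congr_deriv (by simp [levelEnergy])
  have hsub : (∫ t in Ioo 0 b, η t) - ∫ t in Ioo 0 a, η t = ∫ t in a..b, η t := by
    rw [← integral_Ioc_eq_integral_Ioo, ← integral_Ioc_eq_integral_Ioo,
      ← intervalIntegral.integral_of_le hb0, ← intervalIntegral.integral_of_le ha]
    exact intervalIntegral.integral_interval_sub_left (hηi _ _) (hηi _ _)
  set k : ℝ → ℝ := fun t => E - levelEnergy E₀ t + (ψ - η t) with hk
  have hki : IntervalIntegrable k volume a b :=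
    (intervalIntegrable_const.sub hei).add (intervalIntegrable_const.sub (hηi _ _))
  have htot : (E + ψ) * (b - a) - (E₀ * (b - a) - (kingCasimir b - kingCasimir a))
      - ((∫ t in Ioo 0 b, η t) - ∫ t in Ioo 0 a, η t) = ∫ t in a..b, k t := by
    rw [hsub, ← he, hk, intervalIntegral.integral_add (intervalIntegrable_const.sub hei)
      (intervalIntegrable_const.sub (hηi _ _)), intervalIntegral.integral_sub
      intervalIntegrable_const hei, intervalIntegral.integral_sub intervalIntegrable_const (hηi _ _),
      intervalIntegral.integral_const, intervalIntegral.integral_const]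
    simp only [smul_eq_mul]
    ring
  rw [htot]
  -- The levels between a and the King value b satisfy E < e(t) if a < b and E ≥ e(t) if b < a,
  -- which selects the branch of `energyCost`; in the second case reversing the interval supplies
  -- its sign.
  rcases le_total a b with hab | hab
  · rw [intervalIntegral.integral_of_le hab, integral_Ioc_eq_integral_Ioo]
    refine (ofReal_integral_le_lintegral
      ((intervalIntegrable_iff_integrableOn_Ioo_of_le hab).1 hki)).trans ?_
    calc _ ≤ ∫⁻ t in Ioo a b, ENNReal.ofReal (energyCost E (levelEnergy E₀ t) (ψ - η t)) := by
          refine setLIntegral_mono' measurableSet_Ioo fun t ht => ENNReal.ofReal_le_ofReal ?_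
          rw [energyCost, if_pos ((hking t (ha.trans ht.1.le)).1 ht.2)]
          exact le_max_left _ _
      _ ≤ _ := lintegral_mono_set (Ioo_subset_Ioo ha hbT)
  · rw [intervalIntegral.integral_symm, intervalIntegral.integral_of_le hab,
      integral_Ioc_eq_integral_Ioo, ← integral_neg]
    refine (ofReal_integral_le_lintegral
      ((intervalIntegrable_iff_integrableOn_Ioo_of_le hab).1 hki.symm).neg).trans ?_
    calc _ ≤ ∫⁻ t in Ioo b a, ENNReal.ofReal (energyCost E (levelEnergy E₀ t) (ψ - η t)) := by
          refine setLIntegral_mono' measurableSet_Ioo fun t ht => ENNReal.ofReal_le_ofReal ?_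
          rw [energyCost, if_neg (fun h => ht.1.not_gt ((hking t (hb0.trans ht.1.le)).2 h))]
          exact le_max_left _ _
      _ ≤ _ := lintegral_mono_set (Ioo_subset_Ioo hb0 haT)

/-- A state with finite kinetic energy whose level distribution and Casimir energy agree with
those of the King model. -/
structure IsRearrangement (E₀ : ℝ) (U₀ : Space → ℝ) (f : Phase → ℝ) : Prop where
  measurable : Measurable f
  integrable : Integrable f
  nonneg : ∀ z, 0 ≤ f z
  level : levelMeasure f = levelMeasure (kingModel E₀ U₀)
  kinetic : Integrable (fun z : Phase => ‖z.2‖ ^ 2 * f z)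
  casimir : Integrable (fun z => kingCasimir (f z))
  casimir_eq : ∫ z, kingCasimir (f z) = ∫ z, kingCasimir (kingModel E₀ U₀ z)

namespace IsKingPotential

variable {E₀ : ℝ} {U₀ : Space → ℝ} (hU : IsKingPotential E₀ U₀)
include hU

lemma kingModel_casimir_integrable : Integrable (fun z => kingCasimir (kingModel E₀ U₀ z)) := by
  have hc : Continuous (fun z => kingCasimir (kingModel E₀ U₀ z)) := by
    have := hU.kingModel_continuous
    unfold kingCasimir
    refine ((continuous_const.add this).mul ((continuous_const.add this).log fun z => ?_)).sub this
    have := kingModel_nonneg E₀ U₀ z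
    simp only [Pi.add_apply]
    positivity
  exact hc.integrable_of_hasCompactSupport (hU.kingModel_hasCompactSupport.comp_left
    (g := kingCasimir) (by simp [kingCasimir]))

lemma potential_mul_integrable {f : Phase → ℝ} (hi : Integrable f) :
    Integrable (fun z => U₀ z.1 * f z) := by
  refine hi.bdd_mul (c := -radialProfile U₀ 0)
    (hU.contDiff.continuous.comp continuous_fst).aestronglyMeasurable (ae_of_all _ fun z => ?_)
  have h1 := hU.potential_lower z.1
  have h2 := hU.potential_nonpos z.1
  rw [Real.norm_eq_abs, abs_le]
  constructor <;> linarith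

lemma particleEnergy_mul_integrable {f : Phase → ℝ} (hi : Integrable f)
    (hk : Integrable (fun z : Phase => ‖z.2‖ ^ 2 * f z)) :
    Integrable (fun z => particleEnergy U₀ z * f z) := by
  refine ((hk.const_mul (1 / 2)).add (hU.potential_mul_integrable hi)).congr
    (ae_of_all _ fun z => ?_)
  simp only [Pi.add_apply, particleEnergy]
  ring

/-- The duality estimate for rearrangements of the King model. -/
lemma ofReal_energy_exchange_le {f : Phase → ℝ} (hf : IsRearrangement E₀ U₀ f) {T : ℝ}
    (hT : T = max (Real.exp (E₀ - radialProfile U₀ 0) - 1) 0) {ψ : ℝ → ℝ} (hψ : Continuous ψ)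
    {K : ℝ} (hψK : ∀ r, |ψ r| ≤ K) {η : ℝ × ℝ → ℝ} (hη : Measurable η) (hηK : ∀ p, |η p| ≤ K) :
    ENNReal.ofReal (∫ z : Phase, (particleEnergy U₀ z + ψ ‖z.1‖) * (kingModel E₀ U₀ z - f z))
      ≤ ENNReal.ofReal (4 * Real.pi ^ 2) * ∫⁻ t in Ioo 0 T, ∫⁻ r in Ioi (0 : ℝ),
          ∫⁻ L in Ioi (0 : ℝ), ∫⁻ w, ENNReal.ofReal
            (levelCost (radialKinetic U₀ (levelEnergy E₀ t) L r) (ψ r - η (t, L)) w) := by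
  set f₀ := kingModel E₀ U₀ with hf₀
  have hf₀m : Measurable f₀ := hU.kingModel_continuous.measurable
  have hf₀i : Integrable f₀ := hU.kingModel_integrable
  have hT0 : 0 ≤ T := hT ▸ le_max_right _ _
  have hf₀T : ∀ z, f₀ z ≤ T := fun z => hT ▸ hU.kingModel_le z
  have hfT := ae_le_of_levelMeasure_eq hf₀m hf.measurable hT0 hf₀T hf.level
  have hum := hU.continuous_profile.measurable
  have hlm := measurable_levelEnergy E₀
  have hLm := measurable_angularMomentumSq
  obtain ⟨hη1, hη2⟩ := integral_levelMeasure hf.measurable hf.integrable hη hηK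
  obtain ⟨hη3, hη4⟩ := integral_levelMeasure hf₀m hf₀i hη hηK
  -- The function Φ = f violates ∂_fΦ(0, L) = 0, so the mass is recovered from the level measure,
  -- with η = 1.
  have hmass : ∫ z, f z = ∫ z, f₀ z := by
    have h1 := (integral_levelMeasure hf.measurable hf.integrable (η := fun _ => 1)
      measurable_const (K := 1) (by simp)).2
    have h2 := (integral_levelMeasure hf₀m hf₀i (η := fun _ => 1)
      measurable_const (K := 1) (by simp)).2
    rw [hf.level, h2] at h1
    simp only [integral_const, MeasurableSet.univ, measureReal_restrict_apply, univ_inter,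
      Real.volume_real_Ioo, sub_zero, smul_eq_mul, mul_one] at h1
    simpa [max_eq_left (hf.nonneg _), max_eq_left (kingModel_nonneg E₀ U₀ _), hf₀] using h1.symm
  have hψi : ∀ {g : Phase → ℝ}, Integrable g → Integrable (fun z => ψ ‖z.1‖ * g z) := fun hg =>
    hg.bdd_mul (c := K) (hψ.comp (by fun_prop : Continuous fun z : Phase => ‖z.1‖)).aestronglyMeasurable
      (ae_of_all _ fun z => hψK _)
  have hEf := hU.particleEnergy_mul_integrable hf.integrable hf.kinetic
  have hEf₀ := hU.particleEnergy_mul_integrable hf₀i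
    (hU.kingModel_mul_integrable (by fun_prop : Continuous fun z : Phase => ‖z.2‖ ^ 2))
  have hX : Integrable (fun z : Phase => (particleEnergy U₀ z + ψ ‖z.1‖) * (f₀ z - f z)) := by
    refine ((hEf₀.add (hψi hf₀i)).sub (hEf.add (hψi hf.integrable))).congr (ae_of_all _ fun z => ?_)
    simp only [Pi.add_apply, Pi.sub_apply]
    ring
  have hc₀ : Integrable (fun z => kingCasimir (f₀ z)) := hU.kingModel_casimir_integrable
  have hm₁ : Integrable (fun z => E₀ * (f₀ z - f z)) := (hf₀i.sub hf.integrable).const_mul E₀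
  have hc₁ : Integrable (fun z => kingCasimir (f₀ z) - kingCasimir (f z)) := hc₀.sub hf.casimir
  have hY : Integrable (fun z : Phase => E₀ * (f₀ z - f z)
      - (kingCasimir (f₀ z) - kingCasimir (f z))) :=
    hm₁.sub hc₁
  -- This term and the one with η are the two free subtractions: equal mass and Casimir energy make
  -- the first vanish, equal level measures the second.
  have hY0 : ∫ z : Phase, (E₀ * (f₀ z - f z) - (kingCasimir (f₀ z) - kingCasimir (f z))) = 0 := by
    rw [integral_sub hm₁ hc₁,
      integral_const_mul, integral_sub hf₀i hf.integrable, integral_sub hc₀ hf.casimir, hmass,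
      hf.casimir_eq]
    ring
  have hZ0 : ∫ z : Phase, ((∫ t in Ioo 0 (f₀ z), η (t, angularMomentumSq z))
      - ∫ t in Ioo 0 (f z), η (t, angularMomentumSq z)) = 0 := by
    rw [integral_sub hη3 hη1, ← hη2, ← hη4, hf.level, sub_self]
  have hsplit : ∫ z : Phase, (particleEnergy U₀ z + ψ ‖z.1‖) * (f₀ z - f z)
      = ∫ z : Phase, ((particleEnergy U₀ z + ψ ‖z.1‖) * (f₀ z - f z)
        - (E₀ * (f₀ z - f z) - (kingCasimir (f₀ z) - kingCasimir (f z)))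
        - ((∫ t in Ioo 0 (f₀ z), η (t, angularMomentumSq z))
          - ∫ t in Ioo 0 (f z), η (t, angularMomentumSq z))) := by
    have h := (integral_sub (hX.sub hY) (hη3.sub hη1)).symm
    simp only [Pi.sub_apply] at h
    rw [hZ0, integral_sub hX hY, hY0, sub_zero, sub_zero] at h
    exact h
  have hpe : Measurable (particleEnergy U₀) := by
    have := hU.contDiff.continuous.measurable
    unfold particleEnergy
    fun_prop
  have hψm := hψ.measurable
  have hcm := measurable_energyCost
  rw [hsplit]
  calc _ ≤ ∫⁻ z : Phase, ENNReal.ofReal ((particleEnergy U₀ z + ψ ‖z.1‖) * (f₀ z - f z)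
        - (E₀ * (f₀ z - f z) - (kingCasimir (f₀ z) - kingCasimir (f z)))
        - ((∫ t in Ioo 0 (f₀ z), η (t, angularMomentumSq z))
          - ∫ t in Ioo 0 (f z), η (t, angularMomentumSq z))) :=
        ofReal_integral_le_lintegral ((hX.sub hY).sub (hη3.sub hη1))
    _ ≤ ∫⁻ z : Phase, ∫⁻ t in Ioo 0 T, ENNReal.ofReal (energyCost (particleEnergy U₀ z)
          (levelEnergy E₀ t) (ψ ‖z.1‖ - η (t, angularMomentumSq z))) := by
        refine lintegral_mono_ae (hfT.mono fun z hz => ?_)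
        exact ofReal_level_exchange_le (η := fun t => η (t, angularMomentumSq z))
          (hη.comp (by fun_prop)) (fun t => hηK _) (hf.nonneg z) hz (hf₀T z)
    _ = ∫⁻ t in Ioo 0 T, ∫⁻ z : Phase, ENNReal.ofReal (energyCost (particleEnergy U₀ z)
          (levelEnergy E₀ t) (ψ ‖z.1‖ - η (t, angularMomentumSq z))) := by
        refine lintegral_lintegral_swap (Measurable.aemeasurable ?_)
        refine (hcm.comp (f := fun p : Phase × ℝ => (particleEnergy U₀ p.1, levelEnergy E₀ p.2,
          ψ ‖p.1.1‖ - η (p.2, angularMomentumSq p.1))) ?_).ennreal_ofReal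
        fun_prop
    _ = _ := by
        rw [← lintegral_const_mul' _ _ ENNReal.ofReal_ne_top]
        refine lintegral_congr fun t => ?_
        have h := lintegral_phase_reduction (fun p => ENNReal.ofReal (energyCost
          (p.2.1 / 2 + radialProfile U₀ p.1) (levelEnergy E₀ t) (ψ p.1 - η (t, p.2.2)))) (by
            refine (hcm.comp (f := fun p : ℝ × ℝ × ℝ => (p.2.1 / 2 + radialProfile U₀ p.1,
              levelEnergy E₀ t, ψ p.1 - η (t, p.2.2))) ?_).ennreal_ofReal
            fun_prop)
        simp only [energyCost_eq_levelCost] at h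
        rw [← h]
        refine lintegral_congr fun z => ?_
        rw [particleEnergy, hU.eq_profile]

end IsKingPotential

/-! ### Field energy and the lower bound on the energy difference -/

lemma massIn_sub {f g : Phase → ℝ} (hf : Integrable f) (hg : Integrable g) (s : ℝ) :
    massIn (fun z => f z - g z) s = massIn f s - massIn g s := by
  have hS : MeasurableSet {z : Phase | ‖z.1‖ < s} := measurableSet_lt (by fun_prop) (by fun_prop)
  rw [← massIn_eq_integral hf, ← massIn_eq_integral hg, ← massIn_eq_integral (f := fun z => f z - g z) (hf.sub hg),
    ← integral_sub (hf.indicator hS) (hg.indicator hS)]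
  exact integral_congr_ae (ae_of_all _ fun z => congrFun (indicator_sub _ f g) z)

/-- The field has modulus |M|/s², and 4πs²(M/s²)² = 4πM²/s²: the parameter of a mass profile is its
squared field norm up to 4π. -/
lemma lintegral_radial_field {F : Space → Space} {M : ℝ → ℝ} (hM : Measurable M)
    (hF : ∀ x, x ≠ 0 → F x = (M ‖x‖ / ‖x‖ ^ 3) • x) :
    ∫⁻ x, ‖F x‖ₑ ^ 2
      = ENNReal.ofReal (4 * Real.pi) * ∫⁻ s in Ioi (0 : ℝ), ENNReal.ofReal (M s ^ 2 / s ^ 2) := by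
  have hne : ∀ᵐ x : Space, x ≠ 0 := by
    filter_upwards [ae_norm_ne 0] with x hx h
    exact hx (by rw [h, norm_zero])
  rw [lintegral_congr_ae (g := fun x => ENNReal.ofReal (M ‖x‖ ^ 2 / ‖x‖ ^ 4)),
    lintegral_fun_norm (fun s => ENNReal.ofReal (M s ^ 2 / s ^ 4)) (by fun_prop)]
  · congr 1
    refine setLIntegral_congr_fun measurableSet_Ioi fun s hs => ?_
    have hs0 : (0 : ℝ) < s := hs
    rw [← ENNReal.ofReal_mul (by positivity)]
    congr 1
    field_simp
  · filter_upwards [hne] with x hx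
    have hx0 : 0 < ‖x‖ := norm_pos_iff.2 hx
    rw [hF x hx, ← ofReal_norm, ← ENNReal.ofReal_pow (norm_nonneg _), norm_smul,
      Real.norm_eq_abs, mul_pow, sq_abs]
    congr 1
    field_simp

lemma radial_field_memLp {F : Space → Space} {M : ℝ → ℝ} {N : ℝ} (hM : IsMassProfile M N)
    (hF : ∀ x, x ≠ 0 → F x = (M ‖x‖ / ‖x‖ ^ 3) • x) :
    MemLp F 2 (volume : Measure Space) ∧ ∫ x, ‖F x‖ ^ 2 = 4 * Real.pi * N := by
  have hpi := Real.pi_pos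
  have hMm := hM.continuous.measurable
  have hl := lintegral_radial_field hMm hF
  rw [hM.energy, ← ENNReal.ofReal_mul (by positivity)] at hl
  have hae : AEStronglyMeasurable F volume := by
    refine AEStronglyMeasurable.congr (f := fun x => (M ‖x‖ / ‖x‖ ^ 3) • x)
      (Measurable.aestronglyMeasurable (by fun_prop)) ?_
    filter_upwards [ae_norm_ne 0] with x hx
    exact (hF x fun h => hx (by rw [h, norm_zero])).symm
  have hn : ∫⁻ x, ENNReal.ofReal (‖F x‖ ^ 2) = ENNReal.ofReal (4 * Real.pi * N) := by
    rw [← hl]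
    refine lintegral_congr fun x => ?_
    rw [← ofReal_norm, ENNReal.ofReal_pow (norm_nonneg _)]
  have hN := hM.nonneg
  constructor
  · rw [memLp_two_iff_integrable_sq_norm hae]
    refine ⟨(hae.norm.pow 2), ?_⟩
    rw [hasFiniteIntegral_iff_ofReal (ae_of_all _ fun x => by positivity), hn]
    exact ENNReal.ofReal_lt_top
  · rw [integral_eq_lintegral_of_nonneg_ae (f := fun x => ‖F x‖ ^ 2)
      (ae_of_all _ fun x => sq_nonneg _) (hae.norm.pow 2), hn, ENNReal.toReal_ofReal (by positivity)]

lemma isMassProfile_of_integrableOn {m : ℝ → ℝ} (hc : Continuous m) (hb : ∃ M, ∀ s, |m s| ≤ M)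
    (hi : IntegrableOn (fun s => m s ^ 2 / s ^ 2) (Ioi 0)) :
    IsMassProfile m (∫ s in Ioi (0 : ℝ), m s ^ 2 / s ^ 2) :=
  ⟨hc, hb, integral_nonneg fun s => by positivity,
    (ofReal_integral_eq_lintegral_ofReal hi (ae_of_all _ fun s => by positivity)).symm⟩

/-- The integrand of the deviation is non-negative. -/
lemma deviation_integrand_nonneg {E₀ E a : ℝ} (ha : 0 ≤ a) :
    0 ≤ kingCasimir a - kingCasimir (max (Real.exp (E₀ - E) - 1) 0)
      + (E - E₀) * (a - max (Real.exp (E₀ - E) - 1) 0) := by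
  -- The exchange inequality without perturbation, where every displacement cost is zero.
  have h := ofReal_level_exchange_le (E₀ := E₀) (E := E) (ψ := 0) (K := 0) (η := fun _ => 0)
    measurable_const (by simp) ha (le_max_left a _) (le_max_right a _)
  have hz : ∀ e, energyCost E e (0 - 0) = 0 := by
    intro e
    unfold energyCost
    split_ifs with h
    · exact max_eq_right (by linarith)
    · exact max_eq_right (by linarith)
  simp only [hz, ENNReal.ofReal_zero, lintegral_zero, nonpos_iff_eq_zero,
    ENNReal.ofReal_eq_zero, integral_zero] at h
  linarith

namespace IsKingPotential

variable {E₀ : ℝ} {U₀ : Space → ℝ} (hU : IsKingPotential E₀ U₀)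
include hU

/-- Rearrangements of the King model raise the energy by more than half of the field energy
of the perturbation. -/
lemma exists_energy_bound : ∃ N₀ : ℝ, 0 < N₀ ∧ ∀ (f : Phase → ℝ) (N : ℝ),
    IsRearrangement E₀ U₀ f →
    IsMassProfile (fun s => massIn f s - massIn (kingModel E₀ U₀) s) N → N ≤ N₀ →
      33 / 64 * N ≤ ∫ z, particleEnergy U₀ z * (f z - kingModel E₀ U₀ z) := by
  set T := max (Real.exp (E₀ - radialProfile U₀ 0) - 1) 0 with hT
  obtain ⟨N₀, hN₀, ρ, hρ, hbound⟩ := hU.exists_levelCost_bound (T := T) (le_max_right _ _)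
  refine ⟨N₀, hN₀, fun f N hf hm hN => ?_⟩
  set f₀ := kingModel E₀ U₀ with hf₀
  have hf₀i : Integrable f₀ := hU.kingModel_integrable
  set m : ℝ → ℝ := fun s => massIn f s - massIn f₀ s with hmdef
  have hEf := hU.particleEnergy_mul_integrable hf.integrable hf.kinetic
  have hEf₀ := hU.particleEnergy_mul_integrable hf₀i
    (hU.kingModel_mul_integrable (by fun_prop : Continuous fun z : Phase => ‖z.2‖ ^ 2))
  have hhi : Integrable (fun z => f z - f₀ z) := hf.integrable.sub hf₀i
  have hEh : Integrable (fun z => particleEnergy U₀ z * (f z - f₀ z)) := by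
    refine (hEf.sub hEf₀).congr (ae_of_all _ fun z => ?_)
    simp only [Pi.sub_apply]
    ring
  -- The potential truncated at ρ₁, paired with f₀ - f, returns the field energy outside ρ₁. The
  -- truncation keeps it bounded; η stays truncated at the fixed ρ.
  have key : ∀ ρ₁, 0 < ρ₁ → ρ₁ ≤ ρ → ∫ s in Ioi ρ₁, m s ^ 2 / s ^ 2
      ≤ (∫ z, particleEnergy U₀ z * (f z - f₀ z)) + 31 / 64 * N := by
    intro ρ₁ hρ₁ h1
    have hψc := hm.continuous_shellPotential hρ₁
    have hψb := hm.abs_shellPotential_le_right hρ₁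
    have hηm := hU.measurable_orbitMean (hm.continuous_shellPotential hρ).measurable
    have hηb := abs_orbitMean_le (E₀ := E₀) (U := U₀) (hm.abs_shellPotential_le_right hρ)
    have h2 := (hU.ofReal_energy_exchange_le hf hT hψc
      (K := max √(N / ρ₁) √(N / ρ)) (fun r => (hψb r).trans (le_max_left _ _)) hηm
      (fun p => (hηb p).trans (le_max_right _ _))).trans (hbound m N hm hN ρ₁ hρ₁ h1)
    have hN0 := hm.nonneg
    rw [ENNReal.ofReal_le_ofReal_iff (by positivity)] at h2
    have hψi : Integrable (fun z : Phase => shellPotential m ρ₁ ‖z.1‖ * (f z - f₀ z)) :=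
      hhi.bdd_mul (c := √(N / ρ₁))
        (hψc.comp (by fun_prop : Continuous fun z : Phase => ‖z.1‖)).aestronglyMeasurable
        (ae_of_all _ fun z => hψb _)
    have h3 : ∫ z : Phase, (particleEnergy U₀ z + shellPotential m ρ₁ ‖z.1‖) * (f₀ z - f z)
        = -(∫ z, particleEnergy U₀ z * (f z - f₀ z))
          - ∫ z : Phase, shellPotential m ρ₁ ‖z.1‖ * (f z - f₀ z) := by
      rw [← integral_neg, ← integral_sub (f := fun z => -(particleEnergy U₀ z * (f z - f₀ z)))
        hEh.neg hψi]
      refine integral_congr_ae (ae_of_all _ fun z => ?_)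
      simp only
      ring
    rw [h3, integral_shellPotential_mul hhi (hm.integrableOn hρ₁)] at h2
    have h4 : ∫ s in Ioi ρ₁, m s / s ^ 2 * massIn (fun z => f z - f₀ z) s
        = ∫ s in Ioi ρ₁, m s ^ 2 / s ^ 2 := by
      refine integral_congr_ae (ae_of_all _ fun s => ?_)
      simp only
      rw [massIn_sub hf.integrable hf₀i]
      simp only [hmdef]
      ring
    rw [h4] at h2
    linarith
  -- The bound does not depend on ρ₁, so ρ₁ = 1/(n+1) → 0 recovers the full field energy N.
  have hlim := tendsto_setIntegral_of_monotone (μ := volume) (f := fun s => m s ^ 2 / s ^ 2)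
    (s := fun n : ℕ => Ioi (1 / ((n : ℝ) + 1))) (fun n => measurableSet_Ioi)
    (fun a b hab => Ioi_subset_Ioi (one_div_le_one_div_of_le (by positivity) (by
      have : (a : ℝ) ≤ b := by exact_mod_cast hab
      linarith)))
  have hun : ⋃ n : ℕ, Ioi (1 / ((n : ℝ) + 1)) = Ioi 0 := by
    ext s
    simp only [mem_iUnion, mem_Ioi]
    constructor
    · rintro ⟨n, hn⟩
      exact lt_trans (by positivity) hn
    · intro hs
      exact exists_nat_one_div_lt hs
  rw [hun] at hlim
  have hlim' := hlim hm.energy_integrableOn.1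
  rw [hm.energy_integrableOn.2] at hlim'
  have := le_of_tendsto hlim' (b := (∫ z, particleEnergy U₀ z * (f z - f₀ z)) + 31 / 64 * N) (by
    obtain ⟨n₀, hn₀⟩ := exists_nat_one_div_lt hρ
    filter_upwards [eventually_ge_atTop n₀] with n hn
    refine key _ (by positivity) ?_
    refine le_trans (one_div_le_one_div_of_le (by positivity) ?_) hn₀.le
    have : (n₀ : ℝ) ≤ n := by exact_mod_cast hn
    linarith)
  linarith

end IsKingPotential

/-! ### Passage to representatives, expansion of the functional, conclusion -/

lemma spatialDensity_congr_ae {f g : Phase → ℝ} (h : f =ᵐ[volume] g) :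
    spatialDensity f =ᵐ[volume] spatialDensity g := by
  rw [Measure.volume_eq_prod] at h
  filter_upwards [Measure.ae_ae_of_ae_prod h] with x hx
  exact integral_congr_ae hx

/-- The potentials agree at every point, so the gradients are the same functions. -/
lemma potential_congr_ae {f g : Phase → ℝ} (h : f =ᵐ[volume] g) : potential f = potential g := by
  ext x
  unfold potential
  congr 1
  refine integral_congr_ae ?_
  filter_upwards [spatialDensity_congr_ae h] with y hy
  rw [hy]

lemma measurePreserving_rotate (A : Space ≃ₗᵢ[ℝ] Space) :
    MeasurePreserving (fun z : Phase => (A z.1, A z.2)) volume volume := by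
  rw [Measure.volume_eq_prod]
  exact A.measurePreserving.prod A.measurePreserving

lemma IsSphericallySymmetric.congr_ae {f g : Phase → ℝ} (hf : IsSphericallySymmetric f)
    (h : f =ᵐ[volume] g) : IsSphericallySymmetric g := by
  intro A hA
  filter_upwards [hf A hA, h, (measurePreserving_rotate A).quasiMeasurePreserving.ae h]
    with z h1 h2 h3
  rw [← h3, h1, h2]

lemma IsAdmissible.congr_ae {f₀ f g : Phase → ℝ} (hf : IsAdmissible f₀ f)
    (h : f =ᵐ[volume] g) : IsAdmissible f₀ g where
  integrable := hf.integrable.congr h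
  nonneg := by
    filter_upwards [hf.nonneg, h] with z h1 h2
    rwa [← h2]
  symmetric := hf.symmetric.congr_ae h
  casimir_integrable Φ hΦ := (hf.casimir_integrable Φ hΦ).congr (h.mono fun z hz => by
    simp only [hz])
  casimir_eq Φ hΦ := by
    rw [← hf.casimir_eq Φ hΦ]
    exact integral_congr_ae (h.mono fun z hz => by simp only [hz])

lemma HasFiniteEnergyCasimir.congr_ae {f g : Phase → ℝ} (hf : HasFiniteEnergyCasimir f)
    (h : f =ᵐ[volume] g) : HasFiniteEnergyCasimir g where
  kinetic := hf.kinetic.congr (h.mono fun z hz => by simp only [hz])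
  field := potential_congr_ae h ▸ hf.field
  casimir := hf.casimir.congr (h.mono fun z hz => by simp only [hz])

lemma energyCasimir_congr_ae {f g : Phase → ℝ} (h : f =ᵐ[volume] g) :
    energyCasimir f = energyCasimir g := by
  unfold energyCasimir
  have h1 : ∫ z : Phase, ‖z.2‖ ^ 2 * f z = ∫ z : Phase, ‖z.2‖ ^ 2 * g z :=
    integral_congr_ae (h.mono fun z hz => by simp only [hz])
  have h2 : ∫ z : Phase, kingCasimir (f z) = ∫ z : Phase, kingCasimir (g z) :=
    integral_congr_ae (h.mono fun z hz => by simp only [hz])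
  rw [potential_congr_ae h, h1, h2]

lemma deviation_congr_ae {E₀ : ℝ} {U₀ : Space → ℝ} {f g : Phase → ℝ} (h : f =ᵐ[volume] g) :
    deviation E₀ U₀ f = deviation E₀ U₀ g := by
  unfold deviation
  rw [potential_congr_ae h]
  congr 1
  exact lintegral_congr_ae (h.mono fun z hz => by simp only [hz])

namespace IsKingPotential

variable {E₀ : ℝ} {U₀ : Space → ℝ} (hU : IsKingPotential E₀ U₀)
include hU

lemma massIn_kingModel_div_integrableOn :
    IntegrableOn (fun s => massIn (kingModel E₀ U₀) s / s ^ 2) (Ioi 0) := by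
  refine (hU.integral_deriv_profile le_rfl).1.congr_fun (fun s hs => ?_) measurableSet_Ioi
  have hs0 : (0 : ℝ) < s := hs
  rw [hU.massIn_kingModel hs0]
  field_simp

/-- Shell radius 0 is allowed here because m₀/s² = U₀' is integrable down to the centre. -/
lemma potential_eq_shellPotential (x : Space) :
    U₀ x = shellPotential (massIn (kingModel E₀ U₀)) 0 ‖x‖ := by
  rw [hU.eq_profile, (hU.integral_deriv_profile (norm_nonneg x)).2, shellPotential,
    max_eq_left (norm_nonneg x)]
  congr 1
  refine setIntegral_congr_fun measurableSet_Ioi fun s hs => ?_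
  have hs0 : (0 : ℝ) < s := (norm_nonneg x).trans_lt hs
  rw [hU.massIn_kingModel hs0]
  field_simp

/-- Covers both the cross term of the field energies and the King model's own field energy. -/
lemma bounded_mul_massIn_integrableOn {m : ℝ → ℝ} (hc : Continuous m) {M : ℝ}
    (hM : ∀ s, |m s| ≤ M) :
    IntegrableOn (fun s => m s * massIn (kingModel E₀ U₀) s / s ^ 2) (Ioi 0) := by
  refine (hU.massIn_kingModel_div_integrableOn.bdd_mul (c := M)
    hc.aestronglyMeasurable (ae_of_all _ hM)).congr (ae_of_all _ fun s => ?_)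
  simp only
  ring

lemma isMassProfile_kingModel : IsMassProfile (massIn (kingModel E₀ U₀))
    (∫ s in Ioi (0 : ℝ), massIn (kingModel E₀ U₀) s ^ 2 / s ^ 2) := by
  have hc := massIn_continuous hU.kingModel_integrable
  have h0 := kingModel_nonneg E₀ U₀
  have hb : ∀ s, |massIn (kingModel E₀ U₀) s| ≤ ∫ z, kingModel E₀ U₀ z := fun s => by
    rw [abs_of_nonneg (massIn_nonneg h0 s)]
    exact massIn_le h0 hU.kingModel_integrable s
  refine isMassProfile_of_integrableOn hc ⟨_, hb⟩ ?_
  simpa only [sq] using hU.bounded_mul_massIn_integrableOn hc hb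

/-- A bound on the deviation bounds the field energy of the perturbation. -/
lemma exists_massProfile {f : Phase → ℝ} (hf : Measurable f) (hi : Integrable f)
    (h0 : ∀ z, 0 ≤ f z) (hs : IsSphericallySymmetric f) {δ : ℝ} (hδ : 0 ≤ δ)
    (hd : deviation E₀ U₀ f ≤ ENNReal.ofReal δ) :
    ∃ N, IsMassProfile (fun s => massIn f s - massIn (kingModel E₀ U₀) s) N ∧ N ≤ 2 * δ := by
  have hpi := Real.pi_pos
  set m : ℝ → ℝ := fun s => massIn f s - massIn (kingModel E₀ U₀) s with hm
  have hc : Continuous m := (massIn_continuous hi).sub (massIn_continuous hU.kingModel_integrable)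
  have hb : ∀ s, |m s| ≤ (∫ z, f z) + ∫ z, kingModel E₀ U₀ z := fun s => by
    have h1 := massIn_nonneg h0 s
    have h2 := massIn_le h0 hi s
    have h3 := massIn_nonneg (kingModel_nonneg E₀ U₀) s
    have h4 := massIn_le (kingModel_nonneg E₀ U₀) hU.kingModel_integrable s
    rw [abs_le]
    simp only [hm]
    constructor <;> linarith
  have hgrad : ∀ x, x ≠ 0 → gradient (potential f) x - gradient U₀ x
      = (m ‖x‖ / ‖x‖ ^ 3) • x := fun x hx => by
    rw [gradient_potential hf hi h0 hs hx, hU.gradient_eq hx, ← sub_smul]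
    simp only [hm, sub_div]
  have hl := lintegral_radial_field hc.measurable hgrad
  have hle : ∫⁻ s in Ioi (0 : ℝ), ENNReal.ofReal (m s ^ 2 / s ^ 2) ≤ ENNReal.ofReal (2 * δ) := by
    -- The field part of the deviation is (1/8π) 4πN = N/2.
    have h1 : ENNReal.ofReal (1 / (8 * Real.pi)) * (ENNReal.ofReal (4 * Real.pi) *
        ∫⁻ s in Ioi (0 : ℝ), ENNReal.ofReal (m s ^ 2 / s ^ 2)) ≤ ENNReal.ofReal δ := by
      rw [← hl]
      exact le_trans le_add_self hd
    calc _ = ENNReal.ofReal 2 * (ENNReal.ofReal (1 / (8 * Real.pi)) *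
          (ENNReal.ofReal (4 * Real.pi) *
            ∫⁻ s in Ioi (0 : ℝ), ENNReal.ofReal (m s ^ 2 / s ^ 2))) := by
          rw [← mul_assoc, ← mul_assoc, ← ENNReal.ofReal_mul (by norm_num),
            ← ENNReal.ofReal_mul (by positivity),
            show 2 * (1 / (8 * Real.pi)) * (4 * Real.pi) = 1 by field_simp; norm_num,
            ENNReal.ofReal_one, one_mul]
      _ ≤ ENNReal.ofReal 2 * ENNReal.ofReal δ := mul_le_mul_right h1 _
      _ = _ := (ENNReal.ofReal_mul (by norm_num)).symm
  have hint : IntegrableOn (fun s => m s ^ 2 / s ^ 2) (Ioi 0) := by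
    refine ⟨((hc.measurable.pow_const 2).div (by fun_prop)).aestronglyMeasurable, ?_⟩
    rw [hasFiniteIntegral_iff_ofReal (ae_of_all _ fun s => by positivity)]
    exact hle.trans_lt ENNReal.ofReal_lt_top
  have hprof := isMassProfile_of_integrableOn hc ⟨_, hb⟩ hint
  refine ⟨_, hprof, ?_⟩
  rw [hprof.energy, ENNReal.ofReal_le_ofReal_iff (by positivity)] at hle
  exact hle

/-- A finite deviation implies a finite kinetic energy. -/
lemma kinetic_integrable {f : Phase → ℝ} (hi : Integrable f)
    (h0 : ∀ z, 0 ≤ f z) (hcas : Integrable (fun z => kingCasimir (f z)))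
    (hd : deviation E₀ U₀ f < ⊤) : Integrable (fun z : Phase => ‖z.2‖ ^ 2 * f z) := by
  set f₀ := kingModel E₀ U₀ with hf₀
  have hf₀i : Integrable f₀ := hU.kingModel_integrable
  have hcas₀ := hU.kingModel_casimir_integrable
  have hUc := hU.contDiff.continuous
  have hpe : Continuous (particleEnergy U₀) := by
    unfold particleEnergy
    fun_prop
  have hX : Integrable (fun z => kingCasimir (f z) - kingCasimir (f₀ z)
      + (particleEnergy U₀ z - E₀) * (f z - f₀ z)) := by
    refine ⟨((hcas.sub hcas₀).aestronglyMeasurable.add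
      ((hpe.sub continuous_const).aestronglyMeasurable.mul
        (hi.sub hf₀i).aestronglyMeasurable)), ?_⟩
    have hnn : ∀ z, 0 ≤ kingCasimir (f z) - kingCasimir (f₀ z)
        + (particleEnergy U₀ z - E₀) * (f z - f₀ z) := fun z => deviation_integrand_nonneg (h0 z)
    rw [hasFiniteIntegral_iff_ofReal (ae_of_all _ hnn)]
    exact lt_of_le_of_lt le_self_add hd
  have hE₀ : Integrable (fun z => particleEnergy U₀ z * f₀ z) := hU.kingModel_mul_integrable hpe
  have hUf := hU.potential_mul_integrable hi
  -- The kinetic term is solved for: |v|²f/2 is the deviation integrand minus Φ₀(f) - Φ₀(f₀), plus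
  -- E₀(f - f₀) + E f₀ - U₀f, all integrable.
  refine ((((hX.sub (hcas.sub hcas₀)).add ((hi.sub hf₀i).const_mul E₀)).add hE₀).sub
    hUf).const_mul 2 |>.congr (ae_of_all _ fun z => ?_)
  simp only [Pi.add_apply, Pi.sub_apply, particleEnergy]
  ring

/-- Expansion of the energy-Casimir functional around the King model. -/
lemma energyCasimir_expansion {f : Phase → ℝ} (hf : IsRearrangement E₀ U₀ f)
    (hs : IsSphericallySymmetric f) {N : ℝ}
    (hm : IsMassProfile (fun s => massIn f s - massIn (kingModel E₀ U₀) s) N) :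
    HasFiniteEnergyCasimir f ∧ HasFiniteEnergyCasimir (kingModel E₀ U₀) ∧
      energyCasimir f - energyCasimir (kingModel E₀ U₀)
        = (∫ z, particleEnergy U₀ z * (f z - kingModel E₀ U₀ z)) - N / 2 := by
  have hpi := Real.pi_pos
  set f₀ := kingModel E₀ U₀ with hf₀
  have hf₀i : Integrable f₀ := hU.kingModel_integrable
  have hf₀m : Measurable f₀ := hU.kingModel_continuous.measurable
  set M := massIn f with hM
  set M₀ := massIn f₀ with hM₀
  have hM₀p := hU.isMassProfile_kingModel
  rw [← hf₀, ← hM₀] at hM₀p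
  obtain ⟨B, hB⟩ := hm.bounded
  have hcross := hU.bounded_mul_massIn_integrableOn hm.continuous hB
  rw [← hf₀, ← hM₀] at hcross
  obtain ⟨hNi, hN⟩ := hm.energy_integrableOn
  have hN₀i := hM₀p.energy_integrableOn.1
  have hexp : ∀ s, M s ^ 2 / s ^ 2 = (M s - M₀ s) ^ 2 / s ^ 2
      + (2 * ((M s - M₀ s) * M₀ s / s ^ 2) + M₀ s ^ 2 / s ^ 2) := fun s => by ring
  have hMi : IntegrableOn (fun s => M s ^ 2 / s ^ 2) (Ioi 0) := by
    simp only [hexp]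
    exact hNi.add ((hcross.const_mul 2).add hN₀i)
  have hMb : ∃ K, ∀ s, |M s| ≤ K := ⟨_, fun s => by
    rw [abs_of_nonneg (massIn_nonneg hf.nonneg s)]
    exact massIn_le hf.nonneg hf.integrable s⟩
  have hMp := isMassProfile_of_integrableOn (massIn_continuous hf.integrable) hMb hMi
  have hMexp : ∫ s in Ioi (0 : ℝ), M s ^ 2 / s ^ 2 = N
      + (2 * (∫ s in Ioi (0 : ℝ), (M s - M₀ s) * M₀ s / s ^ 2)
        + ∫ s in Ioi (0 : ℝ), M₀ s ^ 2 / s ^ 2) := by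
    simp only [hexp]
    rw [integral_add (f := fun s => (M s - M₀ s) ^ 2 / s ^ 2)
      (g := fun s => 2 * ((M s - M₀ s) * M₀ s / s ^ 2) + M₀ s ^ 2 / s ^ 2) hNi
      ((hcross.const_mul 2).add hN₀i),
      integral_add (f := fun s => 2 * ((M s - M₀ s) * M₀ s / s ^ 2)) (hcross.const_mul 2) hN₀i,
      integral_const_mul, hN]
  obtain ⟨hmem, hint⟩ := radial_field_memLp hMp fun x hx =>
    gradient_potential hf.measurable hf.integrable hf.nonneg hs hx
  obtain ⟨hmem₀, hint₀⟩ := radial_field_memLp hM₀p fun x hx =>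
    gradient_potential hf₀m hf₀i (kingModel_nonneg E₀ U₀) hU.kingModel_symmetric hx
  have hkin₀ : Integrable (fun z : Phase => ‖z.2‖ ^ 2 * f₀ z) :=
    hU.kingModel_mul_integrable (by fun_prop : Continuous fun z : Phase => ‖z.2‖ ^ 2)
  refine ⟨⟨hf.kinetic, hmem, hf.casimir⟩, ⟨hkin₀, hmem₀, hU.kingModel_casimir_integrable⟩, ?_⟩
  have hhi : Integrable (fun z => f z - f₀ z) := hf.integrable.sub hf₀i
  -- This interaction term cancels the cross term in `hMexp`, leaving only -N/2 from the field
  -- energies.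
  have hpot : ∫ z : Phase, U₀ z.1 * (f z - f₀ z)
      = -∫ s in Ioi (0 : ℝ), (M s - M₀ s) * M₀ s / s ^ 2 := by
    simp only [hU.potential_eq_shellPotential]
    rw [← hf₀, integral_shellPotential_mul hhi hU.massIn_kingModel_div_integrableOn]
    congr 1
    refine integral_congr_ae (ae_of_all _ fun s => ?_)
    simp only [massIn_sub hf.integrable hf₀i]
    ring
  have henergy : ∫ z, particleEnergy U₀ z * (f z - f₀ z)
      = 1 / 2 * (∫ z : Phase, ‖z.2‖ ^ 2 * f z) - 1 / 2 * (∫ z : Phase, ‖z.2‖ ^ 2 * f₀ z)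
        + ∫ z : Phase, U₀ z.1 * (f z - f₀ z) := by
    rw [← mul_sub, ← integral_sub hf.kinetic hkin₀, ← integral_const_mul, ← integral_add
      (f := fun z : Phase => 1 / 2 * (‖z.2‖ ^ 2 * f z - ‖z.2‖ ^ 2 * f₀ z))
      ((hf.kinetic.sub hkin₀).const_mul _) (hU.potential_mul_integrable hhi)]
    refine integral_congr_ae (ae_of_all _ fun z => ?_)
    simp only [particleEnergy]
    ring
  unfold energyCasimir
  rw [hint, hint₀, hf.casimir_eq, henergy, hpot, hMexp]
  field_simp
  ring

end IsKingPotential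

theorem theorem2p2 (E₀ : ℝ) (U₀ : Space → ℝ) (hU₀ : IsKingPotential E₀ U₀) :
    ∃ δ₀ : ℝ, 0 < δ₀ ∧ ∃ C₀ : ℝ, 0 < C₀ ∧
      ∀ f : Phase → ℝ, IsAdmissible (kingModel E₀ U₀) f →
        deviation E₀ U₀ f ≤ ENNReal.ofReal δ₀ →
          HasFiniteEnergyCasimir f ∧ HasFiniteEnergyCasimir (kingModel E₀ U₀) ∧
          MemLp (fun x => gradient (potential f) x - gradient U₀ x) 2
            (volume : MeasureTheory.Measure Space) ∧
          C₀ * ∫ x : Space, ‖gradient (potential f) x - gradient U₀ x‖ ^ 2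
            ≤ energyCasimir f - energyCasimir (kingModel E₀ U₀) := by
  have hpi := Real.pi_pos
  obtain ⟨N₀, hN₀, hbound⟩ := hU₀.exists_energy_bound
  -- N is at most twice the deviation, whence δ₀ = N₀/2. The surplus is (33/64 - 1/2)N = N/64 and
  -- the squared field norm is 4πN, whence C₀ = 1/(256π).
  refine ⟨N₀ / 2, by positivity, 1 / (256 * Real.pi), by positivity, fun f' hf' hd' => ?_⟩
  -- A Borel representative that is non-negative everywhere makes the subgraph measurable and every
  -- pointwise estimate available.
  obtain ⟨f, hf, h0, hff⟩ : ∃ f : Phase → ℝ, Measurable f ∧ (∀ z, 0 ≤ f z) ∧ f' =ᵐ[volume] f := by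
    refine ⟨fun z => max (hf'.integrable.aestronglyMeasurable.aemeasurable.mk f' z) 0,
      (AEMeasurable.measurable_mk _).max measurable_const, fun z => le_max_right _ _, ?_⟩
    filter_upwards [hf'.nonneg, hf'.integrable.aestronglyMeasurable.aemeasurable.ae_eq_mk]
      with z h1 h2
    rw [← h2, max_eq_left h1]
  have hadm := hf'.congr_ae hff
  have hd : deviation E₀ U₀ f ≤ ENNReal.ofReal (N₀ / 2) := deviation_congr_ae hff ▸ hd'
  have hcas := hadm.casimir_integrable _ isCasimirFunction_kingCasimir
  have hrea : IsRearrangement E₀ U₀ f :=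
    { measurable := hf
      integrable := hadm.integrable
      nonneg := h0
      level := levelMeasure_eq hU₀.kingModel_continuous.measurable hU₀.kingModel_integrable
        (kingModel_nonneg E₀ U₀) hf hadm.integrable h0 hadm.casimir_eq
      kinetic := hU₀.kinetic_integrable hadm.integrable h0 hcas
        (hd.trans_lt ENNReal.ofReal_lt_top)
      casimir := hcas
      casimir_eq := hadm.casimir_eq _ isCasimirFunction_kingCasimir }
  obtain ⟨N, hm, hN⟩ := hU₀.exists_massProfile hf hadm.integrable h0 hadm.symmetric
    (by positivity) hd
  obtain ⟨hfin, hfin₀, hexp⟩ := hU₀.energyCasimir_expansion hrea hadm.symmetric hm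
  have hgrad : ∀ x, x ≠ 0 → gradient (potential f) x - gradient U₀ x
      = ((massIn f ‖x‖ - massIn (kingModel E₀ U₀) ‖x‖) / ‖x‖ ^ 3) • x := fun x hx => by
    rw [gradient_potential hf hadm.integrable h0 hadm.symmetric hx, hU₀.gradient_eq hx,
      ← sub_smul, sub_div]
  obtain ⟨hmem, hint⟩ := radial_field_memLp
    (F := fun x => gradient (potential f) x - gradient U₀ x) hm hgrad
  rw [potential_congr_ae hff, energyCasimir_congr_ae hff]
  refine ⟨hfin.congr_ae hff.symm, hfin₀, hmem, ?_⟩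
  rw [hint, hexp]
  have := hbound f N hrea hm (by linarith)
  have h2 : 1 / (256 * Real.pi) * (4 * Real.pi * N) = 1 / 64 * N := by
    field_simp
    ring
  rw [h2]
  linarith
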